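/- Let $L$ be a closed smooth manifold (compact, without boundary) of dimension $\ell\ge 0$ with a Riemannian metric, and let $p\colon M\to L$ be a smooth disk bundle of fiber dimension $c\ge 0$: $M$ is a compact smooth manifold with (possibly empty) boundary and $p$ is a smooth fiber bundle with fiber the closed unit disk $D^c\subset\mathbb R^c$. Let $\delta\mathcal P(L)$ be the set, without topology, of pairs $(S,\rho)$ where $S\subset L$ is a finite subset and $\rho\colon S\to(0,\infty)$ is a function such that - for each $s\in S$, the exponential map $\exp_s$ is defined and regular on the compact disk of radius $\rho(s)$ about $0$ in $T_sL$, that is, it is injective on this disk and its differential is invertible at each point of the disk; - the images in $L$ of these disks under the maps $\exp_s$, $s\in S$, are pairwise disjoint. Let $V_L(S,\rho)\subset L$ be the union of the open balls of radius $\rho(s)$ about the points $s\in S$, for the Riemannian distance on $L$ (infinite between different components), and (pre)order $\delta\mathcal P(L)$ by $(S,\rho)\le(T,\sigma)$ if and only if $V_L(S,\rho)\subset V_L(T,\sigma)$. For $k\ge 0$ and a space $X$, let $C_k(X)$ be the space of unordered configurations of $k$ distinct points in $X$ (the quotient by the symmetric group $\Sigma_k$ of the subspace of injective maps in $X^{k}$).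 Then for every $k\ge 0$ the map $$\operatorname*{hocolim}_{(S,\rho)\in\delta\mathcal P(L)} C_k\big(p^{-1}(V_L(S,\rho))\smallsetminus\partial M\big)\longrightarrow C_k(M\smallsetminus\partial M)$$ determined by the inclusions $C_k(p^{-1}(V_L(S,\rho))\smallsetminus\partial M)\to C_k(M\smallsetminus\partial M)$ is a weak homotopy equivalence. Here $\operatorname{hocolim}$ is the Bousfield–Kan homotopy colimit, i.e. the geometric realization of the simplicial space whose space of $r$-simplices is the disjoint union, over strings $a_0\le\dots\le a_r$ in $\delta\mathcal P(L)$, of the values of the functor at $a_0$. -/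

import Mathlib

open Set Manifold ContDiff Topology CategoryTheory Bundle

noncomputable section

/-! ### Weak homotopy equivalences -/

section WeakEquivalence

variable {X Y : Type*} [TopologicalSpace X] [TopologicalSpace Y]

/-- The map of path components induced by a continuous map. -/
def ZerothHomotopy.induced (f : C(X, Y)) : ZerothHomotopy X → ZerothHomotopy Y :=
  Quotient.map f fun _ _ h => h.map f.continuous

/-- Composition of an `n`-dimensional loop at `x` with a continuous map `f`. -/
def GenLoop.push {N : Type*} (f : C(X, Y)) (x : X) (γ : GenLoop N X x) : GenLoop N Y (f x) :=
  ⟨f.comp γ.1, fun y hy => congrArg f (γ.2 y hy)⟩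

/-- The map `π_n(X, x) → π_n(Y, f x)` induced by a continuous map `f`. -/
def HomotopyGroup.induced (N : Type*) (f : C(X, Y)) (x : X) :
    HomotopyGroup N X x → HomotopyGroup N Y (f x) :=
  Quotient.map (GenLoop.push f x) fun _ _ h => h.comp_continuousMap f

/-- A weak homotopy equivalence: a bijection on path components and on all homotopy groups
`π_n`, `n ≥ 1`, at all base points. -/
def IsWeakHomotopyEquiv (f : C(X, Y)) : Prop :=
  Function.Bijective (ZerothHomotopy.induced f) ∧
    ∀ (n : ℕ) (x : X), 1 ≤ n → Function.Bijective (HomotopyGroup.induced (Fin n) f x)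

end WeakEquivalence

/-! ### Homotopy colimits -/

section HomotopyColimit

universe u v

variable {P : Type u} [Preorder P]

/-- The disjoint union, over all `r` and all strings `c 0 ≤ c 1 ≤ ⋯ ≤ c r` in `P`, of the spaces
`F (c 0) × Δ^r`. The set of strings is discrete. -/
abbrev PreHocolim (F : P ⥤ TopCat.{v}) : Type (max u v) :=
  Σ r : ℕ, Σ c : Fin (r + 1) →o P, F.obj (c 0) × stdSimplex ℝ (Fin (r + 1))

/-- The identifications made in the geometric realization of the simplicial replacement
`[r] ↦ ∐_{c 0 ≤ ⋯ ≤ c r} F (c 0)`, one for each monotone map `θ : [q] → [r]`. -/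
inductive HocolimRel (F : P ⥤ TopCat.{v}) : PreHocolim F → PreHocolim F → Prop
  | glue (r q : ℕ) (c : Fin (r + 1) →o P) (θ : Fin (q + 1) →o Fin (r + 1))
      (x : F.obj (c 0)) (t : stdSimplex ℝ (Fin (q + 1))) :
      HocolimRel F ⟨r, c, x, stdSimplex.map θ t⟩
        ⟨q, c.comp θ, F.map (homOfLE (c.monotone (Fin.zero_le (θ 0)))) x, t⟩

/-- The Bousfield-Kan homotopy colimit of a diagram of spaces indexed by a (discrete) preordered
set, with the quotient topology. -/
def Hocolim (F : P ⥤ TopCat.{v}) : Type (max u v) := Quot (HocolimRel F)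

instance (F : P ⥤ TopCat.{v}) : TopologicalSpace (Hocolim F) :=
  inferInstanceAs (TopologicalSpace (Quot (HocolimRel F)))

/-- The map from the homotopy colimit to a space `X` determined by compatible maps
`F a → X`. -/
def Hocolim.desc (F : P ⥤ TopCat.{v}) {X : TopCat.{v}} (α : F ⟶ (Functor.const P).obj X) :
    C(Hocolim F, X) where
  toFun := Quot.lift (fun z => α.app (z.2.1 0) z.2.2.1) (by
    rintro _ _ ⟨r, q, c, θ, x, t⟩
    exact (ConcreteCategory.congr_hom
      (α.naturality (homOfLE (c.monotone (Fin.zero_le (θ 0))))) x).symm)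
  continuous_toFun := by
    refine continuous_quot_lift _ ?_
    refine continuous_sigma fun r => continuous_sigma fun c => ?_
    exact (α.app (c 0)).hom.continuous.comp continuous_fst

end HomotopyColimit

/-! ### Unordered configuration spaces -/

section Configurations

variable {X Y : Type*} [TopologicalSpace X] [TopologicalSpace Y]

/-- The space of ordered configurations of `k` distinct points, a subspace of `X ^ k`. -/
abbrev OrderedConf (k : ℕ) (X : Type*) : Type _ := {f : Fin k → X // Function.Injective f}

/-- Two ordered configurations are identified if they differ by a permutation of the labels. -/
instance orderedConfSetoid (k : ℕ) (X : Type*) : Setoid (OrderedConf k X) where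
  r f g := ∃ σ : Equiv.Perm (Fin k), g.1 = f.1 ∘ σ
  iseqv :=
    { refl := fun f => ⟨1, rfl⟩
      symm := by
        rintro f g ⟨σ, h⟩
        exact ⟨σ⁻¹, by rw [h]; funext i; simp⟩
      trans := by
        rintro f g h ⟨σ, hσ⟩ ⟨τ, hτ⟩
        exact ⟨σ * τ, by rw [hτ, hσ]; rfl⟩ }

/-- The space `C_k(X)` of unordered configurations of `k` points in `X`, with the quotient
topology. -/
def Conf (k : ℕ) (X : Type*) : Type _ := Quotient (orderedConfSetoid k X)

instance (k : ℕ) : TopologicalSpace (Conf k X) :=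
  inferInstanceAs (TopologicalSpace (Quotient (orderedConfSetoid k X)))

/-- The map of configuration spaces induced by an injective continuous map. -/
def Conf.map (k : ℕ) (f : C(X, Y)) (hf : Function.Injective f) : C(Conf k X, Conf k Y) where
  toFun := Quotient.map (fun g : OrderedConf k X => (⟨f ∘ g.1, hf.comp g.2⟩ : OrderedConf k Y)) (by
    rintro g h ⟨σ, hσ⟩
    exact ⟨σ, by simp only [hσ, Function.comp_assoc]⟩)
  continuous_toFun := by
    refine Continuous.quotient_map' ?_ _
    refine Continuous.subtype_mk ?_ _
    exact continuous_pi fun i => f.continuous.comp ((continuous_apply i).comp continuous_subtype_val)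

/-- The map `C_k(A) → C_k(B)` determined by an inclusion of subspaces `A ⊆ B`. -/
def Conf.incl (k : ℕ) {A B : Set X} (h : A ⊆ B) : C(Conf k A, Conf k B) :=
  Conf.map k ⟨inclusion h, continuous_inclusion h⟩ (inclusion_injective h)

end Configurations

/-! ### Geodesics and the exponential map -/

section Riemannian

variable {E : Type*} [NormedAddCommGroup E] [NormedSpace ℝ E]
  {H : Type*} [TopologicalSpace H] (I : ModelWithCorners ℝ E H)
  {L : Type*} [TopologicalSpace L] [ChartedSpace H L]
  [RiemannianBundle (fun x : L => TangentSpace I x)]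

/-- The Riemannian metric in the chart at `x₀`: the bilinear form `g_y(v, w)` on the model vector
space at the point of `L` with coordinate `y`. -/
def chartMetric (x₀ : L) (y v w : E) : ℝ :=
  inner ℝ
    (mfderiv 𝓘(ℝ, E) I (extChartAt I x₀).symm y v : TangentSpace I ((extChartAt I x₀).symm y))
    (mfderiv 𝓘(ℝ, E) I (extChartAt I x₀).symm y w : TangentSpace I ((extChartAt I x₀).symm y))

/-- The geodesic equation at time `t` for the curve `γ`, in the chart at `x₀`. With `u` the
coordinate expression of `γ` and `g` that of the metric, it reads
`g_u(u'', w) + (D_{u'} g)_u(u', w) - (1/2) (D_w g)_u(u', u') = 0` for all `w`,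
that is, `∑ g_{kl} (u''^k + ∑ Γ^k_{ij} u'^i u'^j) = 0` for all `l`, where `Γ^k_{ij}` are the
Christoffel symbols of the Levi-Civita connection. -/
def GeodesicEquation (x₀ : L) (γ : ℝ → L) (t : ℝ) : Prop :=
  let u : ℝ → E := fun τ => extChartAt I x₀ (γ τ)
  ∀ w : E,
    chartMetric I x₀ (u t) (deriv (deriv u) t) w
      + fderiv ℝ (fun y => chartMetric I x₀ y (deriv u t) w) (u t) (deriv u t)
      - (1 / 2) * fderiv ℝ (fun y => chartMetric I x₀ y (deriv u t) (deriv u t)) (u t) w = 0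

/-- `γ` is a geodesic on the open set of times `T`: it is twice continuously differentiable
there and satisfies the geodesic equation in all charts `chartAt H x₀`. -/
def IsGeodesicOn (γ : ℝ → L) (T : Set ℝ) : Prop :=
  ContMDiffOn 𝓘(ℝ, ℝ) I 2 γ T ∧
    ∀ t ∈ T, ∀ x₀ : L, γ t ∈ (chartAt H x₀).source → GeodesicEquation I x₀ γ t

/-- `HasExp I s v y` means that there is a geodesic defined on an open interval containing `[0,1]`
which starts at `s` with velocity `v` and is at `y` at time `1`; in other words `exp_s` is defined
at `v` and takes the value `y` there. -/
def HasExp (s : L) (v : TangentSpace I s) (y : L) : Prop :=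
  ∃ (γ : ℝ → L) (ε : ℝ), 0 < ε ∧ IsGeodesicOn I γ (Ioo (-ε) (1 + ε)) ∧
    (⟨γ 0, mfderiv 𝓘(ℝ, ℝ) I γ 0 (1 : ℝ)⟩ : TangentBundle I L) = ⟨s, v⟩ ∧ γ 1 = y

open Classical in
/-- The Riemannian exponential map `exp_s : T_s L → L` (with the junk value `s` outside its
domain of definition). -/
def riemannianExp (s : L) (v : TangentSpace I s) : L :=
  if h : ∃ y, HasExp I s v y then h.choose else s

/-! ### The poset of fat configurations -/

variable (L) in
/-- The elements of `δ𝒫(L)`: pairs `(S, ρ)` where `S` is a finite subset of `L` and `ρ` assigns to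
each `s ∈ S` a positive radius such that `exp_s` is defined and regular (a smooth embedding) on the
compact disk of radius `ρ s` in `T_s L`, the images of these disks being pairwise disjoint.
There is no topology on this set. -/
structure FatConf where
  /-- The finite set of centres. -/
  centers : Finset L
  /-- The radii. -/
  radius : centers → ℝ
  radius_pos : ∀ s, 0 < radius s
  exp_defined : ∀ (s : centers) (v : TangentSpace I s.1), ‖v‖ ≤ radius s → ∃ y, HasExp I s.1 v y
  exp_regular : ∀ (s : centers) (v : TangentSpace I s.1), ‖v‖ ≤ radius s →
    Function.Bijective (mfderiv 𝓘(ℝ, E) I (fun v : E => riemannianExp I s.1 v) v)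
  exp_injOn : ∀ s : centers,
    InjOn (riemannianExp I s.1) {v : TangentSpace I s.1 | ‖v‖ ≤ radius s}
  disjoint : ∀ s s' : centers, s ≠ s' →
    Disjoint (riemannianExp I s.1 '' {v : TangentSpace I s.1 | ‖v‖ ≤ radius s})
      (riemannianExp I s'.1 '' {v : TangentSpace I s'.1 | ‖v‖ ≤ radius s'})

variable {I} in
/-- `V_L(S, ρ)`: the union of the open balls of radius `ρ s` about the points `s ∈ S`, with respect
to the Riemannian distance. -/
def FatConf.V (a : FatConf I L) : Set L :=
  ⋃ s : a.centers, {y | riemannianEDist I s.1 y < ENNReal.ofReal (a.radius s)}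

/-- `(S, ρ) ≤ (T, σ)` means `V_L(S, ρ) ⊆ V_L(T, σ)`. -/
instance : Preorder (FatConf I L) := Preorder.lift FatConf.V

end Riemannian

/-! ### Smooth disk bundles -/

section DiskBundle

variable {E : Type*} [NormedAddCommGroup E] [NormedSpace ℝ E]
  {H : Type*} [TopologicalSpace H] (I : ModelWithCorners ℝ E H)
  {E' : Type*} [NormedAddCommGroup E'] [NormedSpace ℝ E']
  {H' : Type*} [TopologicalSpace H'] (J : ModelWithCorners ℝ E' H')
  {L : Type*} [TopologicalSpace L] [ChartedSpace H L]
  {M : Type*} [TopologicalSpace M] [ChartedSpace H' M]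

/-- The model `J` is a closed half-space, or (the case `f = 0`) the whole vector space. Manifolds
modelled on such `J` are manifolds with (possibly empty) boundary, without corners. -/
def IsHalfSpaceModel : Prop :=
  ∃ f : E' →L[ℝ] ℝ, range J = {x | 0 ≤ f x}

/-- `p : M → L` is a smooth fiber bundle with fiber the closed unit disk `D^c` in `ℝ^c`: it is
smooth, and over a neighbourhood `U` of each point of `L` there is a diffeomorphism
`p⁻¹(U) ≅ U × D^c` over `U`. -/
def IsSmoothDiskBundle (c : ℕ) (p : M → L) : Prop :=
  ContMDiff J I ∞ p ∧
  ∀ x : L, ∃ (U : Set L) (e : PartialEquiv M (L × EuclideanSpace ℝ (Fin c))),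
    IsOpen U ∧ x ∈ U ∧
    e.source = p ⁻¹' U ∧
    e.target = U ×ˢ Metric.closedBall (0 : EuclideanSpace ℝ (Fin c)) 1 ∧
    (∀ z ∈ e.source, (e z).1 = p z) ∧
    ContMDiffOn J (I.prod 𝓘(ℝ, EuclideanSpace ℝ (Fin c))) ∞ e e.source ∧
    ContMDiffOn (I.prod 𝓘(ℝ, EuclideanSpace ℝ (Fin c))) J ∞ e.symm e.target

variable [RiemannianBundle (fun x : L => TangentSpace I x)]

/-- The subspace `p⁻¹(V_L(S, ρ)) ∖ ∂M` of `M`. -/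
def tube (p : M → L) (a : FatConf I L) : Set M := p ⁻¹' a.V \ J.boundary M

/-- The functor `(S, ρ) ↦ C_k(p⁻¹(V_L(S, ρ)) ∖ ∂M)` on `δ𝒫(L)`; the morphisms are induced by
inclusions. -/
def tubeConf (p : M → L) (k : ℕ) : FatConf I L ⥤ TopCat where
  obj a := TopCat.of (Conf k (tube I J p a))
  map {a b} h := TopCat.ofHom
    (Conf.incl k (sdiff_subset_sdiff_left (preimage_mono (leOfHom h : a ≤ b))))
  map_id a := by
    ext z
    induction z using Quotient.inductionOn with | _ g => rfl
  map_comp f g := by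
    ext z
    induction z using Quotient.inductionOn with | _ g => rfl

/-- The inclusions `C_k(p⁻¹(V_L(S, ρ)) ∖ ∂M) → C_k(M ∖ ∂M)`, as a natural transformation. -/
def tubeConfIncl (p : M → L) (k : ℕ) :
    tubeConf I J p k ⟶
      (Functor.const (FatConf I L)).obj (TopCat.of (Conf k ((J.boundary M)ᶜ : Set M))) where
  app a := TopCat.ofHom (Conf.incl k (fun _ hz => hz.2))
  naturality a b h := by
    ext z
    induction z using Quotient.inductionOn with | _ g => rfl

/-- The map `hocolim_{(S, ρ) ∈ δ𝒫(L)} C_k(p⁻¹(V_L(S, ρ)) ∖ ∂M) → C_k(M ∖ ∂M)` determined by the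
inclusions. -/
def tubeMap (p : M → L) (k : ℕ) :
    C(Hocolim (tubeConf I J p k), Conf k ((J.boundary M)ᶜ : Set M)) :=
  Hocolim.desc (tubeConf I J p k) (tubeConfIncl I J p k)

end DiskBundle

end

/-!
The proof has two independent parts.

*A general fact about homotopy colimits.* Let `F` be a diagram of spaces over a preordered set `P`,
with a map `α` to a Hausdorff space `X` which embeds every `F a` as an open subset of `X`, such that
the `F a` containing a given point form a nonempty, downward directed family
(`Hocolim.IsDirectedCover`). Then `hocolim F → X` is a weak equivalence
(`Hocolim.isWeakHomotopyEquiv_desc`). A point of the homotopy colimit is a point `y` of `X` together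
with barycentric coordinates on a chain of indices whose values contain `y`. It is enough to lift a
map `f` from a cube to `X`, where a lift is prescribed on the boundary, up to shrinking the cube
(`Hocolim.exists_lift_stretch`). Three ingredients go into this.

* Irrational translates of fine grids, one grid for each `j ≤ n`, give a cover of the cube by boxes
  and a partition of unity with at most one box of each `j` in use at any point. Directedness
  provides, inductively in `j`, indices for these boxes which decrease along every flag of meeting
  boxes (`Cube.exists_flag_cover`). They define a lift of `f` by the barycentric coordinates.
* Near any point, all indices occurring in a continuous family of points of the homotopy colimit are
  bounded below by a single index (`Hocolim.exists_eventually_le_of_wt_ne_zero`). Hence the boxes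
  can be chosen so that the indices for boxes near the boundary are below all indices which occur in the
  prescribed lift there.
* Under this condition the two lifts are joined by straight lines in the simplices given by the
  concatenated chains (`Hocolim.join`); this interpolation takes place in a collar of the boundary.

*Fat configurations form such a cover.* The configuration space of a Hausdorff space is Hausdorff,
and open subspaces induce open embeddings of configuration spaces. What remains is that any finite
subset of `L` is the set of centres of fat configurations `a` with `a.V` in a given open
neighbourhood (`FatConf.exists_subset_V`). Here the exponential map has to be constructed and shown
to be regular near `0`. In a chart the geodesic equation is `u'' = -B(u, u')`, with `B` quadratic in
the velocity. Solutions on a fixed time interval with small initial velocity are obtained from the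
inverse function theorem in the Banach space of continuous functions
(`exists_solution_small_velocity`), which also shows that the position at time `1` is a `C^1`
function of the initial velocity with derivative the identity at `0`. Invariance of the geodesic
equation under changes of charts (`eulerLagrange_pullback`) and uniqueness of geodesics
(`IsGeodesicOn.apply_one_eq`) identify this position with the exponential map.
-/

/-! ### Points of the homotopy colimit -/

section HocolimPoints

universe u v

open Filter

namespace Hocolim

variable {P : Type u} [Preorder P] {F : P ⥤ TopCat.{v}} {X : TopCat.{v}}
  (α : F ⟶ (Functor.const P).obj X)

/-- The values of the diagram are open subsets of `X`, and those which contain a given point of `X`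
form a nonempty, downward directed family. -/
structure IsDirectedCover : Prop where
  isOpenEmbedding (a : P) : IsOpenEmbedding (α.app a)
  exists_mem_range (y : X) : ∃ a, y ∈ range (α.app a)
  directed (y : X) (a b : P) : y ∈ range (α.app a) → y ∈ range (α.app b) →
    ∃ c, c ≤ a ∧ c ≤ b ∧ y ∈ range (α.app c)

/-- The point of the homotopy colimit lying over `y : X`, with barycentric coordinates `t` in the
simplex given by the chain `c`; it exists if `y` lies in the image of `F (c 0)`. -/
noncomputable def pt {r : ℕ} (c : Fin (r + 1) →o P) (y : X) (h : y ∈ range (α.app (c 0)))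
    (t : stdSimplex ℝ (Fin (r + 1))) : Hocolim F :=
  Quot.mk _ ⟨r, c, h.choose, t⟩

variable {α}

@[simp]
theorem desc_pt {r : ℕ} (c : Fin (r + 1) →o P) (y : X) (h : y ∈ range (α.app (c 0)))
    (t : stdSimplex ℝ (Fin (r + 1))) : desc F α (pt α c y h t) = y :=
  h.choose_spec

theorem mk_eq_pt (hα : ∀ a, IsOpenEmbedding (α.app a)) (z : PreHocolim F) :
    (Quot.mk (HocolimRel F) z : Hocolim F) =
      pt α z.2.1 (α.app (z.2.1 0) z.2.2.1) ⟨_, rfl⟩ z.2.2.2 := by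
  obtain ⟨r, c, x, t⟩ := z
  have h : α.app (c 0) x ∈ range (α.app (c 0)) := ⟨x, rfl⟩
  have : h.choose = x := (hα (c 0)).injective h.choose_spec
  change _ = Quot.mk _ (⟨r, c, h.choose, t⟩ : PreHocolim F)
  rw [this]

theorem exists_eq_pt (hα : ∀ a, IsOpenEmbedding (α.app a)) (w : Hocolim F) :
    ∃ (r : ℕ) (c : Fin (r + 1) →o P) (h : desc F α w ∈ range (α.app (c 0)))
      (t : stdSimplex ℝ (Fin (r + 1))), w = pt α c (desc F α w) h t := by
  induction w using Quot.ind with | _ z =>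
  exact ⟨_, z.2.1, ⟨_, rfl⟩, z.2.2.2, mk_eq_pt hα z⟩

theorem app_map {a b : P} (h : a ≤ b) (x : F.obj a) :
    α.app b (F.map (homOfLE h) x) = α.app a x :=
  ConcreteCategory.congr_hom (α.naturality (homOfLE h)) x

theorem range_mono {a b : P} (h : a ≤ b) : range (α.app a) ⊆ range (α.app b) := by
  rintro _ ⟨x, rfl⟩
  exact ⟨F.map (homOfLE h) x, app_map h x⟩

theorem pt_glue (hα : ∀ a, IsOpenEmbedding (α.app a)) {r q : ℕ} (c : Fin (r + 1) →o P)
    (θ : Fin (q + 1) →o Fin (r + 1)) (y : X) (h : y ∈ range (α.app (c 0)))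
    (t : stdSimplex ℝ (Fin (q + 1))) :
    pt α c y h (stdSimplex.map θ t) =
      pt α (c.comp θ) y (range_mono (c.monotone (Fin.zero_le _)) h) t := by
  refine (Quot.sound (HocolimRel.glue r q c θ h.choose t)).trans ?_
  rw [mk_eq_pt hα]
  congr 1
  exact (app_map (α := α) (c.monotone (Fin.zero_le (θ 0))) h.choose).trans h.choose_spec

theorem pt_congr_chain {r : ℕ} {c c' : Fin (r + 1) →o P} (e : c = c') {y : X}
    (h : y ∈ range (α.app (c 0))) (h' : y ∈ range (α.app (c' 0)))
    (t : stdSimplex ℝ (Fin (r + 1))) : pt α c y h t = pt α c' y h' t := by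
  subst e; rfl

theorem stdSimplex_exists_ne_zero {r : ℕ} (t : stdSimplex ℝ (Fin (r + 1))) : ∃ i, t i ≠ 0 := by
  by_contra! h
  have := stdSimplex.sum_eq_one t
  simp [h] at this

/-- Vertices of weight zero do not matter: a simplex is glued to all simplices of which it is a
face. -/
theorem pt_congr (hα : ∀ a, IsOpenEmbedding (α.app a)) {r : ℕ} {c c' : Fin (r + 1) →o P} {y : X}
    (h : y ∈ range (α.app (c 0))) (h' : y ∈ range (α.app (c' 0)))
    (t : stdSimplex ℝ (Fin (r + 1))) (e : ∀ i, t i ≠ 0 → c i = c' i) :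
    pt α c y h t = pt α c' y h' t := by
  classical
  set S : Finset (Fin (r + 1)) := Finset.univ.filter (fun i => t i ≠ 0) with hS
  have hne : S.Nonempty := by
    obtain ⟨i, hi⟩ := stdSimplex_exists_ne_zero t
    exact ⟨i, by simp [hS, hi]⟩
  obtain ⟨q, hq⟩ : ∃ q, S.card = q + 1 := ⟨S.card - 1, by have := hne.card_pos; omega⟩
  let θ : Fin (q + 1) ↪o Fin (r + 1) := S.orderEmbOfFin hq
  have hθ : ∀ j, θ j ∈ S := fun j => S.orderEmbOfFin_mem hq j
  have hsum : ∀ φ : Fin (r + 1) → ℝ, (∀ i, t i = 0 → φ i = 0) → ∑ j, φ (θ j) = ∑ i, φ i := by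
    intro φ hφ
    have h1 : ∑ j, φ (θ j) = ∑ i ∈ Finset.univ.map θ.toEmbedding, φ i := by
      rw [Finset.sum_map]; rfl
    have h2 : Finset.univ.map θ.toEmbedding = S := by
      apply Finset.coe_injective
      simp only [Finset.coe_map, Finset.coe_univ, image_univ]
      exact S.range_orderEmbOfFin hq
    rw [h1, h2, hS, Finset.sum_filter]
    refine Finset.sum_congr rfl fun i _ => ?_
    split_ifs with hi
    · rfl
    · exact (hφ i (not_not.mp hi)).symm
  let u : stdSimplex ℝ (Fin (q + 1)) := ⟨fun j => t (θ j), fun j => stdSimplex.zero_le t _, by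
    rw [hsum (fun i => t i) (fun i hi => hi)]; exact stdSimplex.sum_eq_one t⟩
  have hu : stdSimplex.map (θ : Fin (q + 1) →o Fin (r + 1)) u = t := by
    ext i
    rw [stdSimplex.map_coe]
    rw [FunOnFinite.linearMap_apply_apply]
    change ∑ j with θ j = i, t (θ j) = t i
    rw [Finset.sum_filter, hsum (fun k => if k = i then t k else 0)]
    · simp
    · intro k hk; simp [hk]
  rw [← hu, pt_glue hα, pt_glue hα]
  apply pt_congr_chain
  ext j
  exact e _ (by have := hθ j; simpa [hS] using this)

theorem continuous_pt (hα : ∀ a, IsOpenEmbedding (α.app a)) {r : ℕ} (c : Fin (r + 1) →o P) :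
    Continuous fun p : range (α.app (c 0)) × stdSimplex ℝ (Fin (r + 1)) =>
      pt α c p.1.1 p.1.2 p.2 := by
  have h1 : Continuous fun y : range (α.app (c 0)) => y.2.choose := by
    rw [(hα (c 0)).continuous_iff]
    exact continuous_subtype_val.congr fun y => y.2.choose_spec.symm
  have h2 : Continuous fun p : range (α.app (c 0)) × stdSimplex ℝ (Fin (r + 1)) =>
      (⟨r, c, p.1.2.choose, p.2⟩ : PreHocolim F) :=
    continuous_sigmaMk.comp (continuous_sigmaMk.comp
      ((h1.comp continuous_fst).prodMk continuous_snd))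
  exact continuous_quot_mk.comp h2

/-! ### Weights of vertices -/

open Classical in
/-- The weight of the vertex `b` at a point of the homotopy colimit. -/
noncomputable def wt (w : Hocolim F) (b : P) : ℝ :=
  Quot.lift (fun z : PreHocolim F => ∑ i, if z.2.1 i = b then z.2.2.2 i else 0) (by
    rintro _ _ ⟨r, q, c, θ, x, t⟩
    simp only [stdSimplex.map_coe, FunOnFinite.linearMap_apply_apply]
    simp_rw [Finset.sum_filter, ← Finset.sum_filter (fun i => c i = b)]
    rw [Finset.sum_comm]
    refine Finset.sum_congr rfl fun j _ => ?_
    simp) w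

open Classical in
theorem wt_pt {r : ℕ} (c : Fin (r + 1) →o P) (y : X) (h : y ∈ range (α.app (c 0)))
    (t : stdSimplex ℝ (Fin (r + 1))) (b : P) :
    wt (pt α c y h t) b = ∑ i, if c i = b then t i else 0 :=
  rfl

theorem wt_nonneg (w : Hocolim F) (b : P) : 0 ≤ wt w b := by
  classical
  induction w using Quot.ind with | _ z =>
  exact Finset.sum_nonneg fun i _ => by split_ifs <;> simp

theorem wt_pt_ne_zero {r : ℕ} (c : Fin (r + 1) →o P) (y : X) (h : y ∈ range (α.app (c 0)))
    (t : stdSimplex ℝ (Fin (r + 1))) {i : Fin (r + 1)} (hi : t i ≠ 0) :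
    wt (pt α c y h t) (c i) ≠ 0 := by
  classical
  rw [wt_pt]
  have h1 : t i ≤ ∑ j, if c j = c i then t j else 0 := by
    have := Finset.single_le_sum (f := fun j => if c j = c i then t j else 0)
      (fun j _ => by by_cases hj : c j = c i <;> simp [hj]) (Finset.mem_univ i)
    simpa using this
  have h2 : 0 < t i := lt_of_le_of_ne (stdSimplex.zero_le t i) hi.symm
  exact (h2.trans_le h1).ne'

end Hocolim

end HocolimPoints

/-! ### Joins in the homotopy colimit -/

section HocolimJoin

universe u v

namespace Hocolim

section Chains

variable {P : Type u} [Preorder P]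

open Classical in
/-- The chain `c` with its vertices not above `e` replaced by `e`. -/
noncomputable def truncChain (e : P) {r : ℕ} (c : Fin (r + 1) →o P) : Fin (r + 1) →o P where
  toFun i := if e ≤ c i then c i else e
  monotone' i j hij := by
    have := c.monotone hij
    dsimp only
    split_ifs with h1 h2 h2
    · exact this
    · exact absurd (h1.trans this) h2
    · exact h2
    · exact le_rfl

theorem truncChain_of_le {e : P} {r : ℕ} (c : Fin (r + 1) →o P) {i : Fin (r + 1)}
    (h : e ≤ c i) : truncChain e c i = c i := if_pos h

theorem le_truncChain (e : P) {r : ℕ} (c : Fin (r + 1) →o P) (i : Fin (r + 1)) :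
    e ≤ truncChain e c i := by
  by_cases h : e ≤ c i
  · rwa [truncChain_of_le c h]
  · exact (if_neg h : truncChain e c i = e).ge

theorem monotone_append {β : Type*} [Preorder β] {m n : ℕ} {d : Fin (m + 1) → β} {c : Fin n → β}
    (hd : Monotone d) (hc : Monotone c) (h : ∀ i, d (Fin.last m) ≤ c i) :
    Monotone (Fin.append d c) := by
  intro i j
  refine Fin.addCases (fun i => ?_) (fun i => ?_) i <;>
    refine Fin.addCases (fun j => ?_) (fun j => ?_) j <;> intro hij
  · simpa using hd (Fin.le_def.2 (Fin.le_def.1 hij))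
  · simpa using (hd (Fin.le_last i)).trans (h j)
  · exact absurd hij (by simp [Fin.le_def]; omega)
  · simpa using hc (Fin.le_def.2 (Nat.le_of_add_le_add_left (Fin.le_def.1 hij)))

/-- The chain `d`, followed by the chain `c` with its vertices not above the last vertex of `d`
replaced by the latter. -/
noncomputable def joinChain {m r : ℕ} (d : Fin (m + 1) →o P) (c : Fin (r + 1) →o P) :
    Fin (m + 1 + r + 1) →o P where
  toFun := Fin.append (n := r + 1) d (truncChain (d (Fin.last m)) c)
  monotone' := monotone_append d.monotone (truncChain _ c).monotone (le_truncChain _ c)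

theorem joinChain_castAdd {m r : ℕ} (d : Fin (m + 1) →o P) (c : Fin (r + 1) →o P)
    (i : Fin (m + 1)) : joinChain d c (Fin.castAdd (r + 1) i) = d i :=
  Fin.append_left (n := r + 1) _ _ i

theorem joinChain_natAdd {m r : ℕ} (d : Fin (m + 1) →o P) (c : Fin (r + 1) →o P)
    (i : Fin (r + 1)) :
    joinChain d c (Fin.natAdd (m + 1) i) = truncChain (d (Fin.last m)) c i :=
  Fin.append_right (n := r + 1) _ _ i

theorem joinChain_zero {m r : ℕ} (d : Fin (m + 1) →o P) (c : Fin (r + 1) →o P) :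
    joinChain d c 0 = d 0 :=
  joinChain_castAdd d c 0

/-- The inclusion of the first block of vertices of a join. -/
def leftMap (m r : ℕ) : Fin (m + 1) →o Fin (m + 1 + r + 1) where
  toFun := Fin.castAdd (r + 1)
  monotone' _ _ h := Fin.le_def.2 (Fin.le_def.1 h)

/-- The inclusion of the last block of vertices of a join. -/
def rightMap (m r : ℕ) : Fin (r + 1) →o Fin (m + 1 + r + 1) where
  toFun := Fin.natAdd (m := r + 1) (m + 1)
  monotone' _ _ h := Fin.le_def.2 (Nat.add_le_add_left (Fin.le_def.1 h) (m + 1))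

/-- The monotone map between joins induced by a monotone map of the last blocks. -/
def joinMap (m : ℕ) {r q : ℕ} (θ : Fin (q + 1) →o Fin (r + 1)) :
    Fin (m + 1 + q + 1) →o Fin (m + 1 + r + 1) where
  toFun := Fin.append (n := q + 1) (leftMap m r) ((rightMap m r).comp θ)
  monotone' := monotone_append (leftMap m r).monotone ((rightMap m r).comp θ).monotone
    fun _ => Fin.le_def.2 (Nat.le_add_right_of_le m.le_succ)

theorem fin_join_cases {m r : ℕ} {p : Fin (m + 1 + r + 1) → Prop}
    (h1 : ∀ i, p (leftMap m r i)) (h2 : ∀ i, p (rightMap m r i)) : ∀ i, p i :=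
  fun i : Fin (m + 1 + (r + 1)) =>
  Fin.addCases (m := m + 1) (n := r + 1) h1 h2 i

theorem joinChain_comp_leftMap {m r : ℕ} (d : Fin (m + 1) →o P) (c : Fin (r + 1) →o P) :
    (joinChain d c).comp (leftMap m r) = d :=
  OrderHom.ext _ _ (funext fun i => joinChain_castAdd d c i)

theorem joinChain_comp_rightMap {m r : ℕ} (d : Fin (m + 1) →o P) (c : Fin (r + 1) →o P) :
    (joinChain d c).comp (rightMap m r) = truncChain (d (Fin.last m)) c :=
  OrderHom.ext _ _ (funext fun i => joinChain_natAdd d c i)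

theorem joinMap_left (m : ℕ) {r q : ℕ} (θ : Fin (q + 1) →o Fin (r + 1)) (i : Fin (m + 1)) :
    joinMap m θ (leftMap m q i) = leftMap m r i :=
  Fin.append_left (n := q + 1) _ _ i

theorem joinMap_right (m : ℕ) {r q : ℕ} (θ : Fin (q + 1) →o Fin (r + 1)) (i : Fin (q + 1)) :
    joinMap m θ (rightMap m q i) = rightMap m r (θ i) :=
  Fin.append_right (n := q + 1) _ _ i

theorem joinChain_left {m r : ℕ} (d : Fin (m + 1) →o P) (c : Fin (r + 1) →o P)
    (i : Fin (m + 1)) : joinChain d c (leftMap m r i) = d i :=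
  joinChain_castAdd d c i

theorem joinChain_right {m r : ℕ} (d : Fin (m + 1) →o P) (c : Fin (r + 1) →o P)
    (i : Fin (r + 1)) :
    joinChain d c (rightMap m r i) = truncChain (d (Fin.last m)) c i :=
  joinChain_natAdd d c i

theorem joinChain_comp_joinMap {m r q : ℕ} (d : Fin (m + 1) →o P) (c : Fin (r + 1) →o P)
    (θ : Fin (q + 1) →o Fin (r + 1)) :
    (joinChain d c).comp (joinMap m θ) = joinChain d (c.comp θ) := by
  refine OrderHom.ext _ _ (funext (fin_join_cases (fun i => ?_) (fun i => ?_)))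
  · change joinChain d c (joinMap m θ _) = _
    rw [joinMap_left, joinChain_left, joinChain_left]
  · change joinChain d c (joinMap m θ _) = _
    rw [joinMap_right, joinChain_right, joinChain_right]; rfl

end Chains

section Simplices

theorem sum_fin_join {m r : ℕ} (φ : Fin (m + 1 + r + 1) → ℝ) :
    ∑ i, φ i = ∑ i, φ (leftMap m r i) + ∑ i, φ (rightMap m r i) :=
  Fin.sum_univ_add (a := m + 1) (b := r + 1) φ

/-- The point dividing the segment from `u` to `t` in the ratio `s : 1 - s` in the join of two
simplices. -/
noncomputable def joinSimplex {m r : ℕ} (u : stdSimplex ℝ (Fin (m + 1)))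
    (t : stdSimplex ℝ (Fin (r + 1))) (s : unitInterval) :
    stdSimplex ℝ (Fin (m + 1 + r + 1)) :=
  ⟨Fin.append (m := m + 1) (n := r + 1) (fun i => (1 - s) * u i) (fun i => s * t i), by
    constructor
    · refine fin_join_cases (fun i => ?_) (fun i => ?_)
      · exact (mul_nonneg (sub_nonneg.2 s.2.2) (stdSimplex.zero_le u i)).trans_eq
          (Fin.append_left (m := m + 1) (n := r + 1) (fun i => (1 - s : ℝ) * u i)
            (fun i => s * t i) i).symm
      · exact (mul_nonneg s.2.1 (stdSimplex.zero_le t i)).trans_eq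
          (Fin.append_right (m := m + 1) (n := r + 1) (fun i => (1 - s : ℝ) * u i)
            (fun i => s * t i) i).symm
    · rw [sum_fin_join]
      have h1 : ∀ i, Fin.append (m := m + 1) (n := r + 1) (fun i => (1 - s : ℝ) * u i)
          (fun i => s * t i) (leftMap m r i) = (1 - s) * u i :=
        fun i => Fin.append_left _ _ i
      have h2 : ∀ i, Fin.append (m := m + 1) (n := r + 1) (fun i => (1 - s : ℝ) * u i)
          (fun i => s * t i) (rightMap m r i) = s * t i :=
        fun i => Fin.append_right (n := r + 1) _ _ i
      simp_rw [h1, h2, ← Finset.mul_sum, stdSimplex.sum_eq_one]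
      ring⟩

variable {m r : ℕ} (u : stdSimplex ℝ (Fin (m + 1))) (t : stdSimplex ℝ (Fin (r + 1)))
  (s : unitInterval)

@[simp]
theorem joinSimplex_left (i : Fin (m + 1)) :
    joinSimplex u t s (leftMap m r i) = (1 - s) * u i :=
  Fin.append_left (m := m + 1) (n := r + 1) (fun i => (1 - s : ℝ) * u i) (fun i => s * t i) i

@[simp]
theorem joinSimplex_right (i : Fin (r + 1)) :
    joinSimplex u t s (rightMap m r i) = s * t i :=
  Fin.append_right (m := m + 1) (n := r + 1) (fun i => (1 - s : ℝ) * u i) (fun i => s * t i) i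

theorem continuous_joinSimplex :
    Continuous fun p : stdSimplex ℝ (Fin (m + 1)) × stdSimplex ℝ (Fin (r + 1)) × unitInterval =>
      joinSimplex p.1 p.2.1 p.2.2 := by
  have ht : ∀ {n : ℕ} (i : Fin n), Continuous fun t : stdSimplex ℝ (Fin n) => t i :=
    fun i => (continuous_apply i).comp continuous_subtype_val
  refine Continuous.subtype_mk (continuous_pi ?_) _
  refine fin_join_cases (fun i => ?_) (fun i => ?_)
  · refine Continuous.congr (f := fun p => (1 - (p.2.2 : ℝ)) * p.1 i) ?_
      fun p => (joinSimplex_left _ _ _ i).symm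
    have := (ht i).comp (continuous_fst (X := stdSimplex ℝ (Fin (m + 1)))
      (Y := stdSimplex ℝ (Fin (r + 1)) × unitInterval))
    exact ((continuous_const.sub (continuous_subtype_val.comp
      (continuous_snd.comp continuous_snd)))).mul this
  · refine Continuous.congr (f := fun p => (p.2.2 : ℝ) * p.2.1 i) ?_
      fun p => (joinSimplex_right _ _ _ i).symm
    have := (ht i).comp (continuous_fst.comp (continuous_snd (X := stdSimplex ℝ (Fin (m + 1)))
      (Y := stdSimplex ℝ (Fin (r + 1)) × unitInterval)))
    exact (continuous_subtype_val.comp (continuous_snd.comp continuous_snd)).mul this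

theorem stdSimplex_map_apply {n k : ℕ} (f : Fin n → Fin k) (t : stdSimplex ℝ (Fin n)) (i : Fin k) :
    stdSimplex.map f t i = ∑ j, if f j = i then t j else 0 := by
  rw [stdSimplex.map_coe, FunOnFinite.linearMap_apply_apply, Finset.sum_filter]

theorem leftMap_ne_rightMap (i : Fin (m + 1)) (j : Fin (r + 1)) :
    leftMap m r i ≠ rightMap m r j := by
  intro h
  have h' : (i : ℕ) = m + 1 + j := congrArg Fin.val h
  omega

theorem leftMap_injective : Function.Injective (leftMap m r) :=
  fun _ _ h => Fin.ext (Fin.ext_iff.1 h :)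

theorem rightMap_injective : Function.Injective (rightMap m r) :=
  fun _ _ h => Fin.ext (Nat.add_left_cancel (Fin.ext_iff.1 h :))

theorem joinSimplex_zero : joinSimplex u t 0 = stdSimplex.map (leftMap m r) u := by
  ext i
  revert i
  refine fin_join_cases (fun i => ?_) (fun i => ?_)
  · refine (joinSimplex_left _ _ _ i).trans ((stdSimplex_map_apply _ _ _).trans ?_).symm
    simp [leftMap_injective.eq_iff]
  · refine (joinSimplex_right _ _ _ i).trans ((stdSimplex_map_apply _ _ _).trans ?_).symm
    simp [leftMap_ne_rightMap]

theorem joinSimplex_one : joinSimplex u t 1 = stdSimplex.map (rightMap m r) t := by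
  ext i
  revert i
  refine fin_join_cases (fun i => ?_) (fun i => ?_)
  · refine (joinSimplex_left _ _ _ i).trans ((stdSimplex_map_apply _ _ _).trans ?_).symm
    simp [(leftMap_ne_rightMap _ _).symm]
  · refine (joinSimplex_right _ _ _ i).trans ((stdSimplex_map_apply _ _ _).trans ?_).symm
    simp [rightMap_injective.eq_iff]

theorem joinSimplex_map {q : ℕ} (θ : Fin (q + 1) →o Fin (r + 1))
    (t : stdSimplex ℝ (Fin (q + 1))) :
    joinSimplex u (stdSimplex.map θ t) s = stdSimplex.map (joinMap m θ) (joinSimplex u t s) := by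
  ext i
  revert i
  refine fin_join_cases (fun i => ?_) (fun i => ?_)
  · refine (joinSimplex_left _ _ _ i).trans ((stdSimplex_map_apply _ _ _).trans ?_).symm
    rw [sum_fin_join]
    simp [joinMap_left, joinMap_right, leftMap_injective.eq_iff, (leftMap_ne_rightMap _ _).symm]
  · refine (joinSimplex_right _ _ _ i).trans ((stdSimplex_map_apply _ _ _).trans ?_).symm
    rw [sum_fin_join, stdSimplex_map_apply]
    simp [joinMap_left, joinMap_right, rightMap_injective.eq_iff, leftMap_ne_rightMap,
      Finset.mul_sum]

end Simplices

variable {P : Type u} [Preorder P] {F : P ⥤ TopCat.{v}} {X : TopCat.{v}}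
  {α : F ⟶ (Functor.const P).obj X} (hα : ∀ a, IsOpenEmbedding (α.app a))

/-- The point over `y` dividing the segment from `(d, u)` to the coordinates of `w` in the ratio
`s : 1 - s`. Vertices of `w` not above `d` are replaced by the last vertex of `d`: this makes the
join well-defined on the whole homotopy colimit, but it is geometrically meaningful only if all
vertices of `w` are above `d`. -/
noncomputable def join {m : ℕ} (d : Fin (m + 1) →o P) (y : X) (h : y ∈ range (α.app (d 0)))
    (u : stdSimplex ℝ (Fin (m + 1))) (s : unitInterval) (w : Hocolim F) : Hocolim F :=
  Quot.lift (fun z : PreHocolim F =>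
    pt α (joinChain d z.2.1) y ((joinChain_zero d z.2.1).symm ▸ h) (joinSimplex u z.2.2.2 s)) (by
    rintro _ _ ⟨r, q, c, θ, x, t⟩
    dsimp only
    simp_rw [joinSimplex_map]
    rw [pt_glue hα]
    exact pt_congr_chain (joinChain_comp_joinMap d c θ) _ _ _) w

theorem join_pt {m : ℕ} (d : Fin (m + 1) →o P) (y : X) (h : y ∈ range (α.app (d 0)))
    (u : stdSimplex ℝ (Fin (m + 1))) (s : unitInterval) {r : ℕ} (c : Fin (r + 1) →o P) (y' : X)
    (h' : y' ∈ range (α.app (c 0))) (t : stdSimplex ℝ (Fin (r + 1))) :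
    join hα d y h u s (pt α c y' h' t) =
      pt α (joinChain d c) y ((joinChain_zero d c).symm ▸ h) (joinSimplex u t s) :=
  rfl

theorem desc_join {m : ℕ} (d : Fin (m + 1) →o P) (y : X) (h : y ∈ range (α.app (d 0)))
    (u : stdSimplex ℝ (Fin (m + 1))) (s : unitInterval) (w : Hocolim F) :
    desc F α (join hα d y h u s w) = y := by
  induction w using Quot.ind with | _ z =>
  exact desc_pt _ _ _ _

theorem join_zero {m : ℕ} (d : Fin (m + 1) →o P) (y : X) (h : y ∈ range (α.app (d 0)))
    (u : stdSimplex ℝ (Fin (m + 1))) (w : Hocolim F) :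
    join hα d y h u 0 w = pt α d y h u := by
  obtain ⟨r, c, h', t, e⟩ := exists_eq_pt hα w
  rw [e, join_pt]
  simp_rw [joinSimplex_zero]
  rw [pt_glue hα]
  exact pt_congr_chain (joinChain_comp_leftMap d c) _ _ _

theorem join_one {m : ℕ} (d : Fin (m + 1) →o P) (u : stdSimplex ℝ (Fin (m + 1))) (w : Hocolim F)
    (h : desc F α w ∈ range (α.app (d 0))) (hw : ∀ b, wt w b ≠ 0 → d (Fin.last m) ≤ b) :
    join hα d (desc F α w) h u 1 w = w := by
  obtain ⟨r, c, h', t, e⟩ := exists_eq_pt hα w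
  generalize hy : desc F α w = y at h h' e
  subst e
  rw [join_pt]
  simp_rw [joinSimplex_one]
  rw [pt_glue hα]
  refine pt_congr hα _ _ _ fun i hi => ?_
  rw [joinChain_comp_rightMap]
  exact truncChain_of_le _ (hw _ (wt_pt_ne_zero _ _ _ _ hi))

theorem join_congr {m : ℕ} {d d' : Fin (m + 1) →o P} {y : X} (h : y ∈ range (α.app (d 0)))
    (h' : y ∈ range (α.app (d' 0))) {u : stdSimplex ℝ (Fin (m + 1))} (s : unitInterval)
    {w : Hocolim F} (hw : ∀ b, wt w b ≠ 0 → d (Fin.last m) ≤ b)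
    (hw' : ∀ b, wt w b ≠ 0 → d' (Fin.last m) ≤ b) (e : ∀ i, u i ≠ 0 → d i = d' i) :
    join hα d y h u s w = join hα d' y h' u s w := by
  obtain ⟨r, c, h'', t, e'⟩ := exists_eq_pt hα w
  generalize hy : desc F α w = y at h'' e'
  subst e'
  rw [join_pt, join_pt]
  refine pt_congr hα _ _ _ (fin_join_cases (fun i hi => ?_) (fun i hi => ?_))
  · rw [joinChain_left, joinChain_left]
    rw [joinSimplex_left] at hi
    exact e i (right_ne_zero_of_mul hi)
  · rw [joinChain_right, joinChain_right]
    rw [joinSimplex_right] at hi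
    have := wt_pt_ne_zero c _ h'' t (right_ne_zero_of_mul hi)
    rw [truncChain_of_le _ (hw _ this), truncChain_of_le _ (hw' _ this)]

/-- Joining with a fixed chain is continuous. The parameters range over a compact space, and the
product with it preserves the quotient map defining the homotopy colimit. -/
theorem continuous_join {m : ℕ} (d : Fin (m + 1) →o P) :
    Continuous fun p : (desc F α ⁻¹' range (α.app (d 0))) ×
        (stdSimplex ℝ (Fin (m + 1)) × unitInterval) =>
      join hα d (desc F α p.1.1) p.1.2 p.2.1 p.2.2 p.1.1 := by
  have hq : IsQuotientMap (Quot.mk (HocolimRel F)) := isQuotientMap_quot_mk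
  have hS : IsOpen (desc F α ⁻¹' range (α.app (d 0))) :=
    (hα (d 0)).isOpen_range.preimage (desc F α).continuous
  refine (hq.restrictPreimage_isOpen hS).continuous_lift_prod_left ?_
  rw [continuous_iff_continuousAt]
  rintro ⟨⟨⟨r, c, x, t⟩, hx⟩, u, s⟩
  -- it suffices to argue on the open set of points with the given chain `c`
  let T : Type _ := {p : F.obj (c 0) × stdSimplex ℝ (Fin (r + 1)) //
    α.app (c 0) p.1 ∈ range (α.app (d 0))}
  let ι₀ : T → (Quot.mk (HocolimRel F) ⁻¹' (desc F α ⁻¹' range (α.app (d 0)))) :=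
    fun p => ⟨⟨r, c, p.1⟩, p.2⟩
  have hι₀ : IsOpenEmbedding ι₀ := by
    have h0 : IsOpenEmbedding (fun p : F.obj (c 0) × stdSimplex ℝ (Fin (r + 1)) =>
        (⟨r, c, p⟩ : PreHocolim F)) :=
      IsOpenEmbedding.comp IsOpenEmbedding.sigmaMk
        (IsOpenEmbedding.sigmaMk (σ := fun c : Fin (r + 1) →o P =>
          F.obj (c 0) × stdSimplex ℝ (Fin (r + 1))))
    exact h0.restrictPreimage (Quot.mk (HocolimRel F) ⁻¹' (desc F α ⁻¹' range (α.app (d 0))))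
  let ι : T × (stdSimplex ℝ (Fin (m + 1)) × unitInterval) → _ := Prod.map ι₀ id
  have hι : IsOpenEmbedding ι := hι₀.prodMap .id
  have key : Continuous ((fun p : (Quot.mk (HocolimRel F) ⁻¹' (desc F α ⁻¹' range (α.app (d 0)))) ×
      (stdSimplex ℝ (Fin (m + 1)) × unitInterval) =>
      join hα d (desc F α (Quot.mk _ p.1.1)) p.1.2 p.2.1 p.2.2 (Quot.mk _ p.1.1)) ∘ ι) := by
    have h1 : Continuous fun p : T × (stdSimplex ℝ (Fin (m + 1)) × unitInterval) =>
        ((⟨α.app (c 0) p.1.1.1,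
        by rw [joinChain_zero]; exact p.1.2⟩ : range (α.app (joinChain d c 0))),
        joinSimplex p.2.1 p.1.1.2 p.2.2) := by
      refine Continuous.prodMk ?_ ?_
      · refine Continuous.subtype_mk ?_ _
        exact (α.app (c 0)).hom.continuous.comp
          (continuous_fst.comp (continuous_subtype_val.comp continuous_fst))
      · exact continuous_joinSimplex.comp ((continuous_fst.comp continuous_snd).prodMk
          ((continuous_snd.comp (continuous_subtype_val.comp continuous_fst)).prodMk
            (continuous_snd.comp continuous_snd)))
    exact (continuous_pt hα (joinChain d c)).comp h1
  exact (hι.continuousAt_iff (x := (⟨⟨x, t⟩, hx⟩, u, s))).1 key.continuousAt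

end Hocolim

end HocolimJoin

/-! ### Local lower bounds for the vertices of a continuous family -/

section LowerBounds

universe u v

open Filter

namespace Hocolim

variable {P : Type u} [Preorder P] {F : P ⥤ TopCat.{v}} {X : TopCat.{v}}
  {α : F ⟶ (Functor.const P).obj X}

/-- The point of the homotopy colimit given by a point of `F (c 0) × Δ^r`, for a fixed chain
`c`. -/
def mk {r : ℕ} (c : Fin (r + 1) →o P) (p : F.obj (c 0) × stdSimplex ℝ (Fin (r + 1))) :
    Hocolim F :=
  Quot.mk _ ⟨r, c, p⟩

theorem continuous_wt_mk {r : ℕ} (c : Fin (r + 1) →o P) (b : P) :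
    Continuous fun p : F.obj (c 0) × stdSimplex ℝ (Fin (r + 1)) => wt (mk c p) b := by
  classical
  change Continuous fun p : F.obj (c 0) × stdSimplex ℝ (Fin (r + 1)) =>
    ∑ i, if c i = b then p.2 i else 0
  refine continuous_finsetSum _ fun i _ => ?_
  by_cases hi : c i = b
  · simp only [hi, if_true]
    exact ((continuous_apply i).comp continuous_subtype_val).comp continuous_snd
  · simp only [hi, if_false]
    exact continuous_const

theorem mem_range_of_wt_ne_zero {r : ℕ} {c : Fin (r + 1) →o P}
    {p : F.obj (c 0) × stdSimplex ℝ (Fin (r + 1))} {b : P}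
    (h : wt (mk c p) b ≠ 0) : ∃ i, c i = b := by
  classical
  by_contra! hb
  exact h (Finset.sum_eq_zero fun i _ => if_neg (hb i))

theorem isClosed_of_preimage_mk {D : Set (Hocolim F)}
    (h : ∀ (r : ℕ) (c : Fin (r + 1) →o P),
      IsClosed (mk c ⁻¹' D)) : IsClosed D := by
  have hq : IsQuotientMap (Quot.mk (HocolimRel F)) := isQuotientMap_quot_mk
  refine hq.isClosed_preimage.1 ?_
  rw [isClosed_sigma_iff]
  intro r
  rw [isClosed_sigma_iff]
  intro c
  exact h r c

/-- The vertices at `g z`, for `z` near `z₀`, are bounded below by a vertex `a` whose value contains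
the image of `g z₀`. This rests on the fact that the quotient topology is fine: otherwise there is a
sequence `g (z n)` converging to `g z₀` whose terms use vertices `b n` such that each simplex of the
homotopy colimit either has finitely many of the `b n` among its vertices, or lies over a set not
containing the limit of the images of the `z n`. A closed set separates such a sequence from
`g z₀`. -/
theorem exists_eventually_le_of_wt_ne_zero [T2Space X] (hα : IsDirectedCover α)
    {Z : Type*} [TopologicalSpace Z] [FirstCountableTopology Z] {g : Z → Hocolim F} {z₀ : Z}
    (hg : ContinuousAt g z₀) :
    ∃ a, desc F α (g z₀) ∈ range (α.app a) ∧ ∀ᶠ z in 𝓝 z₀, ∀ b, wt (g z) b ≠ 0 → a ≤ b := by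
  classical
  by_contra! hcon
  set x₀ : X := desc F α (g z₀) with hx₀
  obtain ⟨V, hV⟩ := (𝓝 z₀).exists_antitone_basis
  -- the choice of `z` and `b` for given `a` and `n`
  have h1 : ∀ (a : {a // x₀ ∈ range (α.app a)}) (n : ℕ), ∃ z ∈ V n, ∃ b, wt (g z) b ≠ 0 ∧
      ¬ a.1 ≤ b := fun a n => by
    have := hcon a.1 a.2
    obtain ⟨z, hz, hzV⟩ := (this.and_eventually (hV.1.mem_of_mem trivial : V n ∈ 𝓝 z₀)).exists
    exact ⟨z, hzV, hz⟩
  choose zz hzV bb hbw hab using h1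
  have h2 : ∀ (a : {a // x₀ ∈ range (α.app a)}) (b : P), ∃ a' : {a // x₀ ∈ range (α.app a)},
      a'.1 ≤ a.1 ∧ (x₀ ∈ range (α.app b) → a'.1 ≤ b) := fun a b => by
    by_cases hb : x₀ ∈ range (α.app b)
    · obtain ⟨c, hca, hcb, hc⟩ := hα.directed x₀ a.1 b a.2 hb
      exact ⟨⟨c, hc⟩, hca, fun _ => hcb⟩
    · exact ⟨a, le_rfl, fun h => absurd h hb⟩
  choose nx hnx1 hnx2 using h2
  obtain ⟨a₀, ha₀⟩ := hα.exists_mem_range x₀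
  let A : ℕ → {a // x₀ ∈ range (α.app a)} := fun n =>
    Nat.rec ⟨a₀, ha₀⟩ (fun n a => nx a (bb a n)) n
  have hA : ∀ n, A (n + 1) = nx (A n) (bb (A n) n) := fun n => rfl
  have hanti : Antitone fun n => (A n).1 :=
    antitone_nat_of_succ_le fun n => by rw [hA]; exact hnx1 _ _
  let z : ℕ → Z := fun n => zz (A n) n
  let b : ℕ → P := fun n => bb (A n) n
  have hzlim : Tendsto z atTop (𝓝 z₀) := hV.tendsto fun n => hzV _ _
  have hinj : ∀ n m, x₀ ∈ range (α.app (b n)) → n < m → b n ≠ b m := fun n m hx hnm e =>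
    hab (A m) m (by
      have : (A m).1 ≤ b n := (hanti (Nat.succ_le_of_lt hnm)).trans
        (by dsimp only; rw [Nat.succ_eq_add_one, hA]; exact hnx2 _ _ hx)
      rwa [e] at this)
  -- over the limit point, a chain contains only finitely many of the vertices `b n`
  have hfin : ∀ (r : ℕ) (c : Fin (r + 1) →o P), x₀ ∈ range (α.app (c 0)) →
      {n | ∃ i, c i = b n}.Finite := fun r c hc => by
    have : InjOn b {n | ∃ i, c i = b n} := by
      rintro n ⟨i, hi⟩ m ⟨j, hj⟩ e
      by_contra hnm
      have hn : x₀ ∈ range (α.app (b n)) := hi ▸ range_mono (c.monotone (Fin.zero_le i)) hc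
      rcases lt_or_gt_of_ne hnm with h | h
      · exact hinj n m hn h e
      · exact hinj m n (e ▸ hn) h e.symm
    refine Set.Finite.of_finite_image ((finite_range c).subset ?_) this
    rintro _ ⟨n, ⟨i, hi⟩, rfl⟩
    exact ⟨i, hi⟩
  have hxlim : Tendsto (fun n => desc F α (g (z n))) atTop (𝓝 x₀) :=
    ((desc F α).continuous.continuousAt.comp hg).tendsto.comp hzlim
  let D : ℕ → Set (Hocolim F) := fun n =>
    {w | desc F α w = desc F α (g (z n)) ∧ wt (g (z n)) (b n) ≤ wt w (b n)}
  let J : Set ℕ := {n | wt (g z₀) (b n) = 0}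
  have hDb : ∀ n, ∀ w ∈ D n, wt w (b n) ≠ 0 := fun n w hw h0 =>
    hbw (A n) n (le_antisymm (hw.2.trans h0.le) (wt_nonneg _ _))
  have hJ : Jᶜ.Finite := by
    obtain ⟨⟨r, c, p⟩, hp⟩ := Quot.exists_rep (g z₀)
    change mk c p = g z₀ at hp
    have hc : x₀ ∈ range (α.app (c 0)) := by
      rw [hx₀, ← hp]; exact ⟨_, rfl⟩
    refine (hfin r c hc).subset fun n hn => ?_
    have : wt (g z₀) (b n) ≠ 0 := hn
    rw [← hp] at this
    exact mem_range_of_wt_ne_zero this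
  have hclosed : IsClosed (⋃ n : J, D n) := by
    refine isClosed_of_preimage_mk fun r c => ?_
    rw [preimage_iUnion]
    refine LocallyFinite.isClosed_iUnion ?_ fun n => ?_
    · intro p
      by_cases hc : x₀ ∈ range (α.app (c 0))
      · refine ⟨univ, univ_mem, ?_⟩
        refine Set.Finite.of_finite_image ((hfin r c hc).subset ?_) Subtype.val_injective.injOn
        rintro _ ⟨n, ⟨p', hp', -⟩, rfl⟩
        exact mem_range_of_wt_ne_zero (hDb n _ hp')
      · have hp : (α.app (c 0) p.1 : X) ≠ x₀ := fun e => hc ⟨_, e⟩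
        obtain ⟨O₁, O₂, hO₁, hO₂, hp1, hx2, hdis⟩ := t2_separation (X := X) hp
        have hcont : Continuous fun p : F.obj (c 0) × stdSimplex ℝ (Fin (r + 1)) =>
            α.app (c 0) p.1 := (α.app (c 0)).hom.continuous.comp continuous_fst
        refine ⟨_, (hO₁.preimage hcont).mem_nhds hp1, ?_⟩
        obtain ⟨N, hN⟩ := (hxlim.eventually (hO₂.mem_nhds hx2)).exists_forall_of_atTop
        refine Set.Finite.of_finite_image ((finite_lt_nat N).subset ?_) Subtype.val_injective.injOn
        rintro _ ⟨n, ⟨p', hp', hp'O⟩, rfl⟩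
        by_contra hnN
        have h3 : α.app (c 0) p'.1 = desc F α (g (z n)) := hp'.1
        have h4 := hN n (not_lt.1 hnN)
        rw [← h3] at h4
        exact disjoint_left.1 hdis hp'O h4
    · have hcont : Continuous fun p : F.obj (c 0) × stdSimplex ℝ (Fin (r + 1)) =>
            α.app (c 0) p.1 := (α.app (c 0)).hom.continuous.comp continuous_fst
      exact (isClosed_eq (X := X) hcont continuous_const).inter
        (isClosed_le continuous_const (continuous_wt_mk c (b n)))
  have hnot : g z₀ ∈ (⋃ n : J, D n)ᶜ := by
    rintro ⟨_, ⟨n, rfl⟩, hn⟩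
    exact hDb n _ hn n.2
  have hev := (hg.tendsto.comp hzlim).eventually (hclosed.isOpen_compl.mem_nhds hnot)
  have hJev : ∀ᶠ n in atTop, n ∈ J := by
    rw [← Nat.cofinite_eq_atTop]
    exact hJ
  obtain ⟨n, hn, hnJ⟩ := (hev.and hJev).exists
  exact hn (mem_iUnion.2 ⟨⟨n, hnJ⟩, rfl, le_rfl⟩)

end Hocolim

end LowerBounds

/-! ### Covers of a cube by flags -/

section Flags

open Filter unitInterval

namespace Cube

universe w

variable {ι : Type w}

/-- The coordinates of a point of the cube with respect to the grid of mesh `1 / N` that is shifted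
by `j √2`. The shifts make the grids for different `j` disjoint. -/
noncomputable def gridCoord (j N : ℕ) (z : ι → I) (i : ι) : ℝ := N * (z i - j * √2)

/-- The closed boxes of the grid of mesh `1 / N` that is shifted by `j √2`. -/
def gridBox (j N : ℕ) (κ : ι → ℤ) : Set (ι → I) :=
  {z | ∀ i, (κ i : ℝ) ≤ gridCoord j N z i ∧ gridCoord j N z i ≤ κ i + 1}

theorem continuous_gridCoord (j N : ℕ) (i : ι) :
    Continuous fun z : ι → I => gridCoord j N z i := by
  unfold gridCoord
  fun_prop

theorem isClosed_gridBox (j N : ℕ) (κ : ι → ℤ) : IsClosed (gridBox (ι := ι) j N κ) := by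
  simp only [gridBox, ofPred_forall, ofPred_and]
  exact isClosed_iInter fun i =>
    (isClosed_le continuous_const (continuous_gridCoord j N i)).inter
      (isClosed_le (continuous_gridCoord j N i) continuous_const)

theorem mem_gridBox_floor (j N : ℕ) (z : ι → I) :
    z ∈ gridBox j N fun i => ⌊gridCoord j N z i⌋ :=
  fun _ => ⟨Int.floor_le _, (Int.lt_floor_add_one _).le⟩

theorem locallyFinite_gridBox [Finite ι] (j N : ℕ) : LocallyFinite (gridBox (ι := ι) j N) := by
  cases nonempty_fintype ι
  intro z₀
  refine ⟨{z | ∀ i, |gridCoord j N z i - gridCoord j N z₀ i| < 1}, ?_, ?_⟩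
  · refine IsOpen.mem_nhds ?_ (by simp)
    simp only [ofPred_forall]
    exact isOpen_iInter_of_finite fun i =>
      isOpen_lt ((continuous_gridCoord j N i).sub continuous_const).abs continuous_const
  · refine (Set.Finite.pi' fun i => finite_Icc ⌊gridCoord j N z₀ i - 2⌋
      ⌈gridCoord j N z₀ i + 2⌉).subset ?_
    rintro κ ⟨z, hz, hz'⟩ i
    have h1 := hz i
    have h2 := abs_lt.1 (hz' i)
    rw [mem_Icc]
    constructor
    · have : (⌊gridCoord j N z₀ i - 2⌋ : ℝ) ≤ κ i :=
        (Int.floor_le _).trans (by linarith)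
      exact_mod_cast this
    · have : (κ i : ℝ) ≤ ⌈gridCoord j N z₀ i + 2⌉ :=
        le_trans (by linarith) (Int.le_ceil _)
      exact_mod_cast this

variable [Fintype ι]

/-- A function on the cube which vanishes exactly on the hyperplanes of a grid. -/
noncomputable def gridWeight (j N : ℕ) (z : ι → I) : ℝ :=
  ∏ i, Real.sin (Real.pi * gridCoord j N z i) ^ 2

theorem continuous_gridWeight (j N : ℕ) : Continuous (gridWeight (ι := ι) j N) := by
  have := continuous_gridCoord (ι := ι) j N
  unfold gridWeight
  fun_prop

theorem gridWeight_nonneg (j N : ℕ) (z : ι → I) : 0 ≤ gridWeight j N z :=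
  Finset.prod_nonneg fun _ _ => sq_nonneg _

theorem sin_pi_mul_eq_zero_iff (x : ℝ) : Real.sin (Real.pi * x) = 0 ↔ ∃ k : ℤ, x = k := by
  rw [Real.sin_eq_zero_iff]
  refine exists_congr fun k => ?_
  rw [mul_comm, mul_right_inj' Real.pi_ne_zero, eq_comm]

theorem eq_of_gridWeight_ne_zero {j N : ℕ} {z : ι → I} {κ κ' : ι → ℤ} (hz : z ∈ gridBox j N κ)
    (hz' : z ∈ gridBox j N κ') (h : gridWeight j N z ≠ 0) : κ = κ' := by
  have hfl : ∀ κ : ι → ℤ, z ∈ gridBox j N κ → ∀ i, ⌊gridCoord j N z i⌋ = κ i := by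
    intro κ hκ i
    rw [Int.floor_eq_iff]
    refine ⟨(hκ i).1, (hκ i).2.lt_of_ne fun e => ?_⟩
    refine h (Finset.prod_eq_zero (Finset.mem_univ i) ?_)
    rw [sq_eq_zero_iff, sin_pi_mul_eq_zero_iff]
    exact ⟨κ i + 1, by rw [e]; push_cast; rfl⟩
  funext i
  rw [← hfl κ hz i, hfl κ' hz' i]

/-- A point of the `n`-dimensional cube does not lie on `n + 1` of the grids: otherwise one of
its coordinates would be a grid coordinate for two of them. -/
theorem exists_gridWeight_ne_zero (N : ℕ → ℕ) (hN : ∀ j ≤ Fintype.card ι, 1 ≤ N j) (z : ι → I) :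
    ∃ j ≤ Fintype.card ι, gridWeight j (N j) z ≠ 0 := by
  by_contra! hcon
  have h1 : ∀ j : Fin (Fintype.card ι + 1), ∃ i, ∃ k : ℤ, gridCoord j (N j) z i = k := fun j => by
    obtain ⟨i, -, hi⟩ := Finset.prod_eq_zero_iff.1 (hcon j (Nat.lt_succ_iff.1 j.2))
    rw [sq_eq_zero_iff, sin_pi_mul_eq_zero_iff] at hi
    exact ⟨i, hi⟩
  choose i k hk using h1
  obtain ⟨j, j', hne, hi⟩ := Fintype.exists_ne_map_eq_of_card_lt i (by simp)
  have hj := hk j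
  have hj' := hk j'
  rw [← hi] at hj'
  have hNj : (0 : ℝ) < N j := by exact_mod_cast hN j (Nat.lt_succ_iff.1 j.2)
  have hNj' : (0 : ℝ) < N j' := by exact_mod_cast hN j' (Nat.lt_succ_iff.1 j'.2)
  unfold gridCoord at hj hj'
  have hjj : ((j : ℕ) : ℝ) - (j' : ℕ) ≠ 0 := by
    rw [sub_ne_zero]
    exact_mod_cast fun e => hne (Fin.ext e)
  have hs : √2 = (k j' / N j' - k j / N j) / (((j : ℕ) : ℝ) - (j' : ℕ)) := by
    rw [eq_div_iff hjj]
    field_simp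
    linear_combination (N j : ℝ) * hj' - (N j' : ℝ) * hj
  refine irrational_sqrt_two ⟨(k j' / N j' - k j / N j) / (((j : ℕ) : ℚ) - (j' : ℕ)), ?_⟩
  rw [hs]
  push_cast
  rfl

section Constraints

variable {P : Type*}

theorem dist_lt_of_mem_gridBox {j N : ℕ} {κ : ι → ℤ} {z z' : ι → I} {δ : ℝ}
    (hδ : 0 < δ) (hN : 1 < N * δ)
    (hz : z ∈ gridBox j N κ) (hz' : z' ∈ gridBox j N κ) : dist z z' < δ := by
  have hN0 : (0 : ℝ) < N := by
    by_contra! h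
    nlinarith
  rw [dist_pi_lt_iff hδ]
  intro i
  rw [Subtype.dist_eq, Real.dist_eq, abs_lt]
  have h1 := hz i
  have h2 := hz' i
  unfold gridCoord at h1 h2
  constructor <;> nlinarith

/-- For a sufficiently fine grid the constraint `R` can be satisfied on each box by a single element
of `P`, by Lebesgue's lemma. -/
theorem exists_grid (R : (ι → I) → Set P) (hR : ∀ z₀, ∃ a, ∀ᶠ z in 𝓝 z₀, a ∈ R z) (j : ℕ) :
    ∃ N : ℕ, 1 ≤ N ∧ ∃ A : (ι → ℤ) → P, ∀ κ, ∀ z ∈ gridBox j N κ, A κ ∈ R z := by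
  classical
  obtain ⟨δ, hδ, h⟩ := lebesgue_number_lemma_of_metric (ι := P) (s := univ)
    (c := fun a => interior {z | a ∈ R z}) isCompact_univ (fun _ => isOpen_interior)
    (fun z _ => by
      obtain ⟨a, ha⟩ := hR z
      exact mem_iUnion.2 ⟨a, mem_interior_iff_mem_nhds.2 ha⟩)
  obtain ⟨N, hN⟩ := exists_nat_gt (1 / δ)
  have hN1 : 1 < N * δ := by rwa [div_lt_iff₀ hδ] at hN
  refine ⟨N, ?_, ?_⟩
  · rw [Nat.one_le_iff_ne_zero]
    rintro rfl
    norm_num at hN1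
  have : ∀ κ, ∃ a, ∀ z ∈ gridBox j N κ, a ∈ R z := by
    intro κ
    by_cases hne : (gridBox j N κ).Nonempty
    · obtain ⟨x, hx⟩ := hne
      obtain ⟨a, ha⟩ := h x trivial
      refine ⟨a, fun z hz => ?_⟩
      have := ha (dist_lt_of_mem_gridBox hδ hN1 hz hx)
      exact (interior_subset this : z ∈ {z | a ∈ R z})
    · obtain ⟨a, -⟩ := hR 0
      exact ⟨a, fun z hz => absurd ⟨z, hz⟩ hne⟩
  choose A hA using this
  exact ⟨A, hA⟩

variable [Preorder P]

theorem exists_lowerBound {Q : Type*} {O : P → Set Q}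
    (hdir : ∀ z a b, z ∈ O a → z ∈ O b → ∃ c, c ≤ a ∧ c ≤ b ∧ z ∈ O c) {z : Q} {a₀ : P}
    (ha₀ : z ∈ O a₀) (S : Set P) (hS : S.Finite) (hSO : ∀ a ∈ S, z ∈ O a) :
    ∃ c, c ≤ a₀ ∧ z ∈ O c ∧ ∀ a ∈ S, c ≤ a := by
  induction S, hS using Set.Finite.induction_on with
  | empty => exact ⟨a₀, le_rfl, ha₀, by simp⟩
  | @insert b S _ _ ih =>
    obtain ⟨c, hc0, hcO, hc⟩ := ih fun a ha => hSO a (mem_insert_of_mem _ ha)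
    obtain ⟨c', h1, h2, h3⟩ := hdir z c b hcO (hSO b (mem_insert _ _))
    refine ⟨c', h1.trans hc0, h3, ?_⟩
    rintro a (rfl | ha)
    exacts [h2, h1.trans (hc a ha)]

/-- Grids of decreasing mesh: the elements of `P` attached to the boxes of one grid are below
those attached to the boxes of the previous grids that they meet. -/
theorem exists_grids {O : P → Set (ι → I)} (hO : ∀ a, IsOpen (O a))
    (hdir : ∀ z a b, z ∈ O a → z ∈ O b → ∃ c, c ≤ a ∧ c ≤ b ∧ z ∈ O c)
    (R : (ι → I) → Set P) (hRO : ∀ z, ∀ a ∈ R z, z ∈ O a)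
    (hRlower : ∀ z a b, a ∈ R z → b ≤ a → z ∈ O b → b ∈ R z)
    (hR : ∀ z₀, ∃ a, ∀ᶠ z in 𝓝 z₀, a ∈ R z) (m : ℕ) :
    ∃ (N : ℕ → ℕ) (A : ℕ → (ι → ℤ) → P), (∀ j < m, 1 ≤ N j) ∧
      (∀ j < m, ∀ κ, ∀ z ∈ gridBox j (N j) κ, A j κ ∈ R z) ∧
      ∀ j < m, ∀ j' < j, ∀ κ κ' z, z ∈ gridBox j (N j) κ → z ∈ gridBox j' (N j') κ' →
        A j κ ≤ A j' κ' := by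
  classical
  induction m with
  | zero =>
    obtain ⟨a, -⟩ := hR 0
    exact ⟨0, fun _ _ => a, by simp, by simp, by simp⟩
  | succ m ih =>
    obtain ⟨N, A, hN, hAR, hAA⟩ := ih
    let R' : (ι → I) → Set P := fun z =>
      {b | b ∈ R z ∧ ∀ j < m, ∀ κ, z ∈ gridBox j (N j) κ → b ≤ A j κ}
    have hR' : ∀ z₀, ∃ a, ∀ᶠ z in 𝓝 z₀, a ∈ R' z := by
      intro z₀
      obtain ⟨a₀, ha₀⟩ := hR z₀
      let S : Set P := ⋃ j ∈ Iio m, A j '' {κ | z₀ ∈ gridBox j (N j) κ}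
      have hS : S.Finite := (finite_Iio m).biUnion fun j _ =>
        ((locallyFinite_gridBox j (N j)).point_finite z₀).image _
      obtain ⟨c, hc0, hcO, hcS⟩ := exists_lowerBound hdir (hRO _ _ ha₀.self_of_nhds) S hS (by
        intro a ha
        simp only [S, mem_iUnion] at ha
        obtain ⟨j, hj, κ, hκ, rfl⟩ := ha
        exact hRO _ _ (hAR j hj κ z₀ hκ))
      refine ⟨c, ?_⟩
      have h1 : ∀ᶠ z in 𝓝 z₀, ∀ j ∈ Iio m, {κ | z ∈ gridBox j (N j) κ} ⊆
          {κ | z₀ ∈ gridBox j (N j) κ} := by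
        rw [eventually_all_finite (finite_Iio m)]
        exact fun j _ => (locallyFinite_gridBox j (N j)).eventually_subset
          (isClosed_gridBox j (N j)) z₀
      filter_upwards [h1, ha₀, (hO c).mem_nhds hcO] with z hz1 hz2 hz3
      refine ⟨hRlower _ _ _ hz2 hc0 hz3, fun j hj κ hκ => hcS _ ?_⟩
      exact mem_biUnion (mem_Iio.2 hj) ⟨κ, hz1 j hj hκ, rfl⟩
    obtain ⟨N', hN', A', hA'⟩ := exists_grid R' hR' m
    refine ⟨Function.update N m N', Function.update A m A', ?_, ?_, ?_⟩
    · intro j hj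
      rcases Nat.lt_succ_iff_lt_or_eq.1 hj with h | rfl
      · rw [Function.update_of_ne h.ne]; exact hN j h
      · rwa [Function.update_self]
    · intro j hj
      rcases Nat.lt_succ_iff_lt_or_eq.1 hj with h | rfl
      · rw [Function.update_of_ne h.ne, Function.update_of_ne h.ne]; exact hAR j h
      · rw [Function.update_self, Function.update_self]
        exact fun κ z hz => (hA' κ z hz).1
    · intro j hj j' hj' κ κ' z
      have hj'm : j' < m := by omega
      rw [Function.update_of_ne hj'm.ne, Function.update_of_ne hj'm.ne]
      rcases Nat.lt_succ_iff_lt_or_eq.1 hj with h | rfl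
      · rw [Function.update_of_ne h.ne, Function.update_of_ne h.ne]
        exact hAA j h j' hj' κ κ' z
      · rw [Function.update_self, Function.update_self]
        exact fun hz hz' => (hA' κ z hz).2 j' hj'm κ' hz'

/-- A cube has a locally finite closed cover with a chain of elements of `P` for each member of the
cover, and barycentric coordinates `u` such that at common points of two members the two chains
agree, up to vertices of weight zero. All vertices satisfy the constraint `R`. -/
theorem exists_flag_cover {O : P → Set (ι → I)} (hO : ∀ a, IsOpen (O a))
    (hdir : ∀ z a b, z ∈ O a → z ∈ O b → ∃ c, c ≤ a ∧ c ≤ b ∧ z ∈ O c)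
    (R : (ι → I) → Set P) (hRO : ∀ z, ∀ a ∈ R z, z ∈ O a)
    (hRlower : ∀ z a b, a ∈ R z → b ≤ a → z ∈ O b → b ∈ R z)
    (hR : ∀ z₀, ∃ a, ∀ᶠ z in 𝓝 z₀, a ∈ R z) :
    ∃ (n : ℕ) (K : Type w) (T : K → Set (ι → I)) (d : K → (Fin (n + 1) →o P))
      (u : C(ι → I, stdSimplex ℝ (Fin (n + 1)))),
      LocallyFinite T ∧ (∀ k, IsClosed (T k)) ∧ (∀ z, ∃ k, z ∈ T k) ∧
      (∀ k, ∀ z ∈ T k, ∀ i, d k i ∈ R z) ∧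
      ∀ k k' z, z ∈ T k → z ∈ T k' → ∀ i, u z i ≠ 0 → d k i = d k' i := by
  classical
  set n := Fintype.card ι with hn
  obtain ⟨N, A, hN, hAR, hAA⟩ := exists_grids hO hdir R hRO hRlower hR (n + 1)
  -- the finest grid comes first in the chain
  let lev : Fin (n + 1) → ℕ := fun i => n - i
  have hlev : ∀ i, lev i < n + 1 := fun i => Nat.lt_succ_of_le (Nat.sub_le _ _)
  let B : Fin (n + 1) → (ι → ℤ) → Set (ι → I) := fun i => gridBox (lev i) (N (lev i))
  let K : Type w := {k : Fin (n + 1) → ι → ℤ // (⋂ i, B i (k i)).Nonempty}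
  let w : Fin (n + 1) → (ι → I) → ℝ := fun i => gridWeight (lev i) (N (lev i))
  have hwc : ∀ i, Continuous (w i) := fun i => continuous_gridWeight _ _
  have hw0 : ∀ i z, 0 ≤ w i z := fun i z => gridWeight_nonneg _ _ z
  have hwpos : ∀ z, 0 < ∑ i, w i z := fun z => by
    obtain ⟨j, hj, hjw⟩ := exists_gridWeight_ne_zero N (fun j hj => hN j (Nat.lt_succ_of_le hj)) z
    refine Finset.sum_pos' (fun i _ => hw0 i z) ⟨⟨n - j, by omega⟩, Finset.mem_univ _, ?_⟩
    have e : lev ⟨n - j, by omega⟩ = j := Nat.sub_sub_self hj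
    refine lt_of_le_of_ne (hw0 _ z) (Ne.symm ?_)
    change gridWeight (lev _) (N (lev _)) z ≠ 0
    rwa [e]
  let u : C(ι → I, stdSimplex ℝ (Fin (n + 1))) :=
    ⟨fun z => ⟨fun i => w i z / ∑ i, w i z, fun i => div_nonneg (hw0 i z) (hwpos z).le, by
      rw [← Finset.sum_div, div_self (hwpos z).ne']⟩, by
      refine Continuous.subtype_mk (continuous_pi fun i => ?_) _
      exact (hwc i).div (continuous_finsetSum _ fun i _ => hwc i) fun z => (hwpos z).ne'⟩
  have hu : ∀ z i, u z i = w i z / ∑ i, w i z := fun z i => rfl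
  let d : K → (Fin (n + 1) →o P) := fun k =>
    ⟨fun i => A (lev i) (k.1 i), by
      intro i i' hii
      rcases hii.eq_or_lt with rfl | hlt
      · exact le_rfl
      obtain ⟨z, hz⟩ := k.2
      rw [mem_iInter] at hz
      refine hAA _ (hlev i) _ ?_ _ _ z (hz i) (hz i')
      have := Fin.lt_def.1 hlt
      have := i'.2
      simp only [lev]
      omega⟩
  refine ⟨n, K, fun k => ⋂ i, B i (k.1 i), d, u, ?_, ?_, ?_, ?_, ?_⟩
  · intro z
    choose V hV hVf using fun i => locallyFinite_gridBox (ι := ι) (lev i) (N (lev i)) z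
    refine ⟨⋂ i, V i, iInter_mem.2 hV, ?_⟩
    refine Set.Finite.of_finite_image ((Set.Finite.pi' hVf).subset ?_) Subtype.val_injective.injOn
    rintro _ ⟨k, ⟨z', hz', hz''⟩, rfl⟩ i
    exact ⟨z', mem_iInter.1 hz' i, mem_iInter.1 hz'' i⟩
  · exact fun k => isClosed_iInter fun i => isClosed_gridBox _ _ _
  · intro z
    have hz : z ∈ ⋂ i, B i (fun l => ⌊gridCoord (lev i) (N (lev i)) z l⌋) :=
      mem_iInter.2 fun i => mem_gridBox_floor _ _ z
    exact ⟨⟨_, ⟨z, hz⟩⟩, hz⟩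
  · intro k z hz i
    exact hAR _ (hlev i) _ z (mem_iInter.1 hz i)
  · intro k k' z hz hz' i hi
    have : w i z ≠ 0 := fun e => hi (by rw [hu, e, zero_div])
    have := eq_of_gridWeight_ne_zero (mem_iInter.1 hz i) (mem_iInter.1 hz' i) this
    change A (lev i) (k.1 i) = A (lev i) (k'.1 i)
    rw [this]

end Constraints

end Cube

end Flags

/-! ### Lifting cubes to the homotopy colimit -/

section Lifting

universe u v

open Filter unitInterval

namespace Hocolim

variable {P : Type u} [Preorder P] {F : P ⥤ TopCat.{v}} {X : TopCat.{v}}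
  {α : F ⟶ (Functor.const P).obj X}

/-- A map `f` from a cube to `X` lifts to the homotopy colimit, with a prescribed lift `g` on the
set where `s = 1`, provided that `g` is given on a closed neighbourhood of this set. The lift is a
join of `g` with a lift that is everywhere below `g`, obtained from a cover of the cube by flags. -/
theorem exists_lift_of_collar [T2Space X] (hα : IsDirectedCover α)
    {ι : Type*} [Fintype ι] (f : C(ι → I, X)) {C : Set (ι → I)} (hC : IsClosed C)
    {g : (ι → I) → Hocolim F} (hg : ContinuousOn g C) (hgf : ∀ z ∈ C, desc F α (g z) = f z)
    (s : C(ι → I, I)) (hs : ∀ z, s z ≠ 0 → z ∈ C) :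
    ∃ G : C(ι → I, Hocolim F), (∀ z, desc F α (G z) = f z) ∧ ∀ z, s z = 1 → G z = g z := by
  have hO : ∀ a, IsOpen (f ⁻¹' range (α.app a)) :=
    fun a => (hα.isOpenEmbedding a).isOpen_range.preimage f.continuous
  obtain ⟨n, K, T, d, u, hTf, hTc, hcov, hdR, hdd⟩ := Cube.exists_flag_cover (P := P)
    (O := fun a => f ⁻¹' range (α.app a)) hO (fun z a b ha hb => hα.directed (f z) a b ha hb)
    (fun z => {a | f z ∈ range (α.app a) ∧ (z ∈ C → ∀ b, wt (g z) b ≠ 0 → a ≤ b)})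
    (fun z a ha => ha.1)
    (fun z a b ha hba hb => ⟨hb, fun hz b' hb' => hba.trans (ha.2 hz b' hb')⟩) (by
      intro z₀
      by_cases hz₀ : z₀ ∈ C
      · obtain ⟨a, ha, hle⟩ := exists_eventually_le_of_wt_ne_zero hα
          (hg.domRestrict.continuousAt (x := (⟨z₀, hz₀⟩ : C)))
        have ha' : f z₀ ∈ range (α.app a) := by
          rw [← hgf z₀ hz₀]; exact ha
        refine ⟨a, ?_⟩
        have hle' : ∀ᶠ z in 𝓝[C] z₀, ∀ b, wt (g z) b ≠ 0 → a ≤ b := by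
          rw [nhdsWithin_eq_map_subtype_coe hz₀]
          exact hle
        rw [eventually_nhdsWithin_iff] at hle'
        filter_upwards [hle', (hO a).mem_nhds ha'] with z h1 h2 using ⟨h2, h1⟩
      · obtain ⟨a, ha⟩ := hα.exists_mem_range (f z₀)
        refine ⟨a, ?_⟩
        filter_upwards [(hO a).mem_nhds ha, hC.isOpen_compl.mem_nhds hz₀] with z h1 h2
          using ⟨h1, fun h => absurd h h2⟩)
  choose κ hκ using hcov
  let G : (ι → I) → Hocolim F := fun z =>
    join hα.isOpenEmbedding (d (κ z)) (f z) (hdR (κ z) z (hκ z) 0).1 (u z) (s z) (g z)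
  have hG : ∀ k z (hz : z ∈ T k),
      G z = join hα.isOpenEmbedding (d k) (f z) (hdR k z hz 0).1 (u z) (s z) (g z) := by
    intro k z hz
    by_cases hzC : z ∈ C
    · exact join_congr hα.isOpenEmbedding _ _ _ ((hdR _ z (hκ z) _).2 hzC) ((hdR _ z hz _).2 hzC)
        (hdd _ _ z (hκ z) hz)
    · have h0 : s z = 0 := by_contra fun h => hzC (hs z h)
      simp only [G, h0, join_zero]
      exact pt_congr hα.isOpenEmbedding _ _ _ (hdd _ _ z (hκ z) hz)
  have hGC : ∀ k, ContinuousOn G (T k ∩ C) := by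
    intro k
    rw [continuousOn_iff_continuous_domRestrict]
    have h1 : Continuous fun z : ↥(T k ∩ C) =>
        ((⟨g z, by
          change desc F α (g z) ∈ range (α.app (d k 0))
          rw [hgf z z.2.2]; exact (hdR k z z.2.1 0).1⟩ :
            desc F α ⁻¹' range (α.app (d k 0))), (u z, s z)) := by
      refine Continuous.prodMk (Continuous.subtype_mk ?_ _) ?_
      · exact (hg.mono inter_subset_right).domRestrict
      · exact ((u.continuous.comp continuous_subtype_val).prodMk
          (s.continuous.comp continuous_subtype_val))
    refine ((continuous_join hα.isOpenEmbedding (d k)).comp h1).congr fun z => ?_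
    simp only [domRestrict_apply, hG k z z.2.1, Function.comp_apply, hgf z z.2.2]
  have hG0 : ∀ k, ContinuousOn G (T k ∩ {z | s z = 0}) := by
    intro k
    rw [continuousOn_iff_continuous_domRestrict]
    have h1 : Continuous fun z : ↥(T k ∩ {z | s z = 0}) =>
        ((⟨f z, (hdR k z z.2.1 0).1⟩ : range (α.app (d k 0))), u z) :=
      (Continuous.subtype_mk (f.continuous.comp continuous_subtype_val) _).prodMk
        (u.continuous.comp continuous_subtype_val)
    refine ((continuous_pt hα.isOpenEmbedding (d k)).comp h1).congr fun z => ?_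
    have h0 : s z = 0 := z.2.2
    simp only [domRestrict_apply, hG k z z.2.1, h0, join_zero, Function.comp_apply]
  have hGT : ∀ k, ContinuousOn G (T k) := by
    intro k
    refine ((hGC k).union_of_isClosed (hG0 k) ((hTc k).inter hC)
      ((hTc k).inter (isClosed_eq s.continuous continuous_const))).mono fun z hz => ?_
    by_cases h : s z = 0
    · exact Or.inr ⟨hz, h⟩
    · exact Or.inl ⟨hz, hs z h⟩
  refine ⟨⟨G, hTf.continuous (iUnion_eq_univ_iff.2 fun z => ⟨κ z, hκ z⟩) hTc hGT⟩, ?_, ?_⟩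
  · exact fun z => desc_join hα.isOpenEmbedding _ _ (hdR (κ z) z (hκ z) 0).1 _ _ _
  · intro z hz
    have hzC : z ∈ C := hs z (by rw [hz]; exact one_ne_zero)
    have := hgf z hzC
    simp only [ContinuousMap.coe_mk, G, hz, ← this]
    exact join_one hα.isOpenEmbedding _ _ _ _ ((hdR _ z (hκ z) _).2 hzC)

end Hocolim

namespace Cube

variable {ι : Type*}

/-- The map of the unit interval which is constant on `[0, 1/4]` and on `[3/4, 1]`, and stretches
the interval between to the whole interval. -/
noncomputable def stretchCoord (x : I) : I := projIcc 0 1 zero_le_one (2 * (x : ℝ) - 1 / 2)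

theorem continuous_stretchCoord : Continuous stretchCoord :=
  continuous_projIcc.comp (by fun_prop)

/-- The map of a cube that stretches a smaller concentric cube to the whole cube and
collapses the collar around it to the boundary. -/
noncomputable def stretch : C(ι → I, ι → I) :=
  ⟨fun z i => stretchCoord (z i), continuous_pi fun i =>
    continuous_stretchCoord.comp (continuous_apply i)⟩

theorem stretchCoord_zero : stretchCoord 0 = 0 :=
  projIcc_of_le_left _ (by norm_num)

theorem stretchCoord_one : stretchCoord 1 = 1 :=
  projIcc_of_right_le _ (by norm_num)

theorem stretch_mem_boundary {z : ι → I} (hz : z ∈ boundary ι) : stretch z ∈ boundary ι := by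
  obtain ⟨i, hi | hi⟩ := hz
  · exact ⟨i, Or.inl (by change stretchCoord (z i) = 0; rw [hi, stretchCoord_zero])⟩
  · exact ⟨i, Or.inr (by change stretchCoord (z i) = 1; rw [hi, stretchCoord_one])⟩

theorem isClosed_boundary [Finite ι] : IsClosed (boundary ι) := by
  simp only [boundary, ofPred_exists]
  refine isClosed_iUnion_of_finite fun i => ?_
  exact (isClosed_eq (continuous_apply i) continuous_const).union
    (isClosed_eq (continuous_apply i) continuous_const)

/-- A function on the cube which is `1` on the boundary and vanishes off the collar collapsed by
`stretch`. -/
noncomputable def collarFun [Fintype ι] : C(ι → I, I) :=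
  ⟨fun z => projIcc 0 1 zero_le_one (∑ i, 4 * max 0 (|(z i : ℝ) - 1 / 2| - 1 / 4)),
    continuous_projIcc.comp (by fun_prop)⟩

theorem collarFun_eq_one [Fintype ι] {z : ι → I} (hz : z ∈ boundary ι) : collarFun z = 1 := by
  refine projIcc_of_right_le zero_le_one ?_
  obtain ⟨i, hi⟩ := hz
  have h1 : (1 : ℝ) ≤ 4 * max 0 (|(z i : ℝ) - 1 / 2| - 1 / 4) := by
    rcases hi with hi | hi <;> rw [hi] <;> norm_num
  exact h1.trans (Finset.single_le_sum (f := fun i => 4 * max 0 (|(z i : ℝ) - 1 / 2| - 1 / 4))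
    (fun j _ => by positivity) (Finset.mem_univ i))

theorem stretch_mem_boundary_of_collarFun_ne_zero [Fintype ι] {z : ι → I}
    (hz : collarFun z ≠ 0) : stretch z ∈ boundary ι := by
  have h : ∃ i, 0 < |(z i : ℝ) - 1 / 2| - 1 / 4 := by
    by_contra! h
    refine hz (projIcc_of_le_left zero_le_one ?_)
    refine Finset.sum_nonpos fun i _ => ?_
    rw [max_eq_left (h i), mul_zero]
  obtain ⟨i, hi⟩ := h
  refine ⟨i, ?_⟩
  rcases lt_abs.1 (sub_pos.1 hi) with h | h
  · exact Or.inr (projIcc_of_right_le zero_le_one (by linarith))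
  · exact Or.inl (projIcc_of_le_left zero_le_one (by linarith))

/-- The straight-line homotopy from the identity of the cube to `stretch`. -/
noncomputable def stretchHomotopy : C(I × (ι → I), ι → I) :=
  ⟨fun p i => ⟨(1 - (p.1 : ℝ)) * p.2 i + p.1 * stretchCoord (p.2 i), by
    exact convex_Icc (0 : ℝ) 1 (p.2 i).2 (stretchCoord (p.2 i)).2 (sub_nonneg.2 p.1.2.2)
      p.1.2.1 (sub_add_cancel _ _)⟩, by
    have := continuous_stretchCoord
    fun_prop⟩

theorem stretchHomotopy_zero (z : ι → I) : stretchHomotopy (0, z) = z := by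
  funext i
  exact Subtype.ext (by simp [stretchHomotopy])

theorem stretchHomotopy_one (z : ι → I) : stretchHomotopy (1, z) = stretch z := by
  funext i
  exact Subtype.ext (by simp [stretchHomotopy, stretch])

theorem stretchHomotopy_mem_boundary (t : I) {z : ι → I} (hz : z ∈ boundary ι) :
    stretchHomotopy (t, z) ∈ boundary ι := by
  obtain ⟨i, hi | hi⟩ := hz
  · exact ⟨i, Or.inl (Subtype.ext (by simp [stretchHomotopy, hi, stretchCoord_zero]))⟩
  · exact ⟨i, Or.inr (Subtype.ext (by simp [stretchHomotopy, hi, stretchCoord_one]))⟩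

end Cube

namespace Hocolim

variable {P : Type u} [Preorder P] {F : P ⥤ TopCat.{v}} {X : TopCat.{v}}
  {α : F ⟶ (Functor.const P).obj X}

/-- Up to stretching, a map from a cube to `X` lifts to the homotopy colimit with a prescribed
lift on the boundary. -/
theorem exists_lift_stretch [T2Space X] (hα : IsDirectedCover α)
    {ι : Type*} [Fintype ι] (f : C(ι → I, X))
    {g : (ι → I) → Hocolim F} (hg : ContinuousOn g (Cube.boundary ι))
    (hgf : ∀ z ∈ Cube.boundary ι, desc F α (g z) = f z) :
    ∃ G : C(ι → I, Hocolim F), (∀ z, desc F α (G z) = f (Cube.stretch z)) ∧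
      ∀ z ∈ Cube.boundary ι, G z = g (Cube.stretch z) := by
  obtain ⟨G, h1, h2⟩ := exists_lift_of_collar hα (f.comp Cube.stretch)
    (C := Cube.stretch ⁻¹' Cube.boundary ι)
    (Cube.isClosed_boundary.preimage Cube.stretch.continuous) (g := g ∘ Cube.stretch)
    (hg.comp Cube.stretch.continuous.continuousOn fun _ h => h)
    (fun z hz => hgf _ hz) Cube.collarFun
    (fun z hz => Cube.stretch_mem_boundary_of_collarFun_ne_zero hz)
  exact ⟨G, h1, fun z hz => h2 z (Cube.collarFun_eq_one hz)⟩

end Hocolim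

end Lifting

/-! ### The homotopy colimit of an open cover -/

section OpenCover

universe u v

open Filter unitInterval

theorem GenLoop.homotopicRel_stretch {N X : Type*} [TopologicalSpace X] {x : X}
    (γ : GenLoop N X x) :
    γ.1.HomotopicRel (γ.1.comp Cube.stretch) (Cube.boundary N) := by
  refine ⟨⟨⟨γ.1.comp Cube.stretchHomotopy, fun z => ?_, fun z => ?_⟩, fun t z hz => ?_⟩⟩
  · exact congrArg γ.1 (Cube.stretchHomotopy_zero z)
  · exact congrArg γ.1 (Cube.stretchHomotopy_one z)
  · exact (γ.2 _ (Cube.stretchHomotopy_mem_boundary t hz)).trans (γ.2 z hz).symm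

namespace Hocolim

variable {P : Type u} [Preorder P] {F : P ⥤ TopCat.{v}} {X : TopCat.{v}}
  {α : F ⟶ (Functor.const P).obj X}

theorem bijective_zerothHomotopy_desc [T2Space X] (hα : IsDirectedCover α) :
    Function.Bijective (ZerothHomotopy.induced (desc F α)) := by
  constructor
  · intro a b
    induction a using Quotient.inductionOn with | _ x =>
    induction b using Quotient.inductionOn with | _ y =>
    intro h
    obtain ⟨p⟩ : Joined (desc F α x) (desc F α y) := Quotient.exact h
    classical
    let g : (Fin 1 → I) → Hocolim F := fun z => if z 0 = 0 then x else y
    have hg0 : ∀ z, z 0 = 0 → g z = x := fun z hz => if_pos hz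
    have hg1 : ∀ z, z 0 = 1 → g z = y := fun z hz => if_neg (by rw [hz]; exact one_ne_zero)
    have hc : ContinuousOn g ({z | z 0 = 0} ∪ {z | z 0 = 1}) := by
      refine ContinuousOn.union_of_isClosed ?_ ?_
        (isClosed_eq (continuous_apply 0) continuous_const)
        (isClosed_eq (continuous_apply 0) continuous_const)
      · exact continuousOn_const.congr hg0
      · exact continuousOn_const.congr hg1
    have hb : ∀ z ∈ Cube.boundary (Fin 1), z 0 = 0 ∨ z 0 = 1 := by
      rintro z ⟨i, hi⟩
      rwa [Subsingleton.elim i 0] at hi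
    obtain ⟨G, -, hG⟩ := exists_lift_stretch hα
      (p.toContinuousMap.comp ⟨fun z : Fin 1 → I => z 0, continuous_apply 0⟩) (g := g)
      (hc.mono hb) (fun z hz => by
        rcases hb z hz with h | h
        · rw [hg0 z h]; exact (p.source.symm.trans (congrArg p h.symm))
        · rw [hg1 z h]; exact (p.target.symm.trans (congrArg p h.symm)))
    refine Quotient.sound ⟨⟨G.comp ⟨fun t _ => t, by fun_prop⟩, ?_, ?_⟩⟩
    · exact (hG _ ⟨0, Or.inl rfl⟩).trans (hg0 _ Cube.stretchCoord_zero)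
    · exact (hG _ ⟨0, Or.inr rfl⟩).trans (hg1 _ Cube.stretchCoord_one)
  · intro b
    induction b using Quotient.inductionOn with | _ y =>
    have hb : ∀ z, z ∉ Cube.boundary (Fin 0) := fun z ⟨i, _⟩ => i.elim0
    obtain ⟨G, hG, -⟩ := exists_lift_stretch hα
      (ContinuousMap.const (Fin 0 → I) y) (g := fun _ => Classical.choice (by
        obtain ⟨a, x, -⟩ := hα.exists_mem_range y
        exact ⟨Quot.mk _ ⟨0, ⟨fun _ => a, monotone_const⟩, x, default⟩⟩))
      continuousOn_const fun z hz => absurd hz (hb z)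
    exact ⟨Quotient.mk _ (G 0), congrArg (Quotient.mk _) (hG 0)⟩

theorem surjective_homotopyGroup_desc [T2Space X] (hα : IsDirectedCover α) (n : ℕ)
    (x : Hocolim F) :
    Function.Surjective (HomotopyGroup.induced (Fin n) (desc F α) x) := by
  intro b
  induction b using Quotient.inductionOn with | _ γ =>
  obtain ⟨G, hG, hGb⟩ := exists_lift_stretch hα γ.1 (g := fun _ => x)
    continuousOn_const fun z hz => (γ.2 z hz).symm
  refine ⟨Quotient.mk _ ⟨G, fun z hz => hGb z hz⟩, Quotient.sound ?_⟩
  have : (desc F α).comp G = γ.1.comp Cube.stretch := ContinuousMap.ext hG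
  change ((desc F α).comp G).HomotopicRel γ.1 _
  rw [this]
  exact (GenLoop.homotopicRel_stretch γ).symm

/-- A homotopy in `X` between the images of two loops is a map from a cube of one dimension more,
with a lift prescribed on the boundary by the loops and the base point. -/
theorem injective_homotopyGroup_desc [T2Space X] (hα : IsDirectedCover α) (n : ℕ)
    (x : Hocolim F) :
    Function.Injective (HomotopyGroup.induced (Fin n) (desc F α) x) := by
  classical
  intro a b
  induction a using Quotient.inductionOn with | _ γ₁ =>
  induction b using Quotient.inductionOn with | _ γ₂ =>
  intro h
  obtain ⟨H⟩ : ((desc F α).comp γ₁.1).HomotopicRel ((desc F α).comp γ₂.1) (Cube.boundary (Fin n)) :=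
    Quotient.exact h
  let tl : (Fin (n + 1) → I) → (Fin n → I) := fun z i => z i.succ
  let g : (Fin (n + 1) → I) → Hocolim F := fun z =>
    if tl z ∈ Cube.boundary (Fin n) then x
    else if z 0 = 0 then γ₁ (tl z) else γ₂ (tl z)
  have hg : ∀ z, tl z ∈ Cube.boundary (Fin n) → g z = x := fun z hz => if_pos hz
  have hg0 : ∀ z, z 0 = 0 → g z = γ₁ (tl z) := fun z hz => by
    by_cases hb : tl z ∈ Cube.boundary (Fin n)
    · rw [hg z hb]; exact (γ₁.2 _ hb).symm
    · simp only [g, if_neg hb, if_pos hz]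
  have hg1 : ∀ z, z 0 = 1 → g z = γ₂ (tl z) := fun z hz => by
    by_cases hb : tl z ∈ Cube.boundary (Fin n)
    · rw [hg z hb]; exact (γ₂.2 _ hb).symm
    · have : z 0 ≠ 0 := by rw [hz]; exact one_ne_zero
      simp only [g, if_neg hb, if_neg this]
  have htail : Continuous fun z : Fin (n + 1) → I => tl z :=
    continuous_pi fun i => continuous_apply i.succ
  have hcl : ∀ t : I, IsClosed {z : Fin (n + 1) → I | z 0 = t} :=
    fun t => isClosed_eq (continuous_apply 0) continuous_const
  have hc : ContinuousOn g
      ({z | z 0 = 0} ∪ {z | z 0 = 1} ∪ tl ⁻¹' Cube.boundary (Fin n)) := by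
    refine ContinuousOn.union_of_isClosed (ContinuousOn.union_of_isClosed ?_ ?_ (hcl 0) (hcl 1))
      ?_ ((hcl 0).union (hcl 1)) (Cube.isClosed_boundary.preimage htail)
    · exact (γ₁.1.continuous.comp htail).continuousOn.congr hg0
    · exact (γ₂.1.continuous.comp htail).continuousOn.congr hg1
    · exact continuousOn_const.congr hg
  have hb : ∀ z ∈ Cube.boundary (Fin (n + 1)),
      (z 0 = 0 ∨ z 0 = 1) ∨ tl z ∈ Cube.boundary (Fin n) := by
    rintro z ⟨i, hi⟩
    refine Fin.cases (fun hi => Or.inl hi) (fun i hi => Or.inr ⟨i, hi⟩) i hi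
  obtain ⟨G, -, hG⟩ := exists_lift_stretch hα
    (H.toContinuousMap.comp ⟨fun z : Fin (n + 1) → I => (z 0, tl z),
      (continuous_apply 0).prodMk htail⟩) (g := g) (hc.mono hb) (fun z hz => by
        rcases hb z hz with (h | h) | h
        · rw [hg0 z h]
          change _ = H (z 0, tl z)
          rw [h]; exact (H.apply_zero _).symm
        · rw [hg1 z h]
          change _ = H (z 0, tl z)
          rw [h]; exact (H.apply_one _).symm
        · rw [hg z h]
          refine Eq.trans ?_ (H.prop' (z 0) _ h).symm
          exact congrArg (desc F α) (γ₁.2 _ h).symm)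
  have key : (γ₁.1.comp Cube.stretch).HomotopicRel (γ₂.1.comp Cube.stretch)
      (Cube.boundary (Fin n)) := by
    refine ⟨⟨⟨G.comp ⟨fun p : I × (Fin n → I) => (Fin.cons p.1 p.2 : Fin (n + 1) → I), ?_⟩,
      fun z => ?_, fun z => ?_⟩, fun t z hz => ?_⟩⟩
    · refine continuous_pi fun i => ?_
      refine Fin.cases ?_ (fun i => ?_) i
      · exact continuous_fst
      · exact (continuous_apply i).comp continuous_snd
    · refine (hG _ ⟨0, Or.inl rfl⟩).trans ?_
      rw [hg0 _ Cube.stretchCoord_zero]; rfl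
    · refine (hG _ ⟨0, Or.inr rfl⟩).trans ?_
      rw [hg1 _ Cube.stretchCoord_one]; rfl
    · obtain ⟨i, hi⟩ := hz
      refine (hG _ ⟨i.succ, hi⟩).trans ?_
      have hz : Cube.stretch z ∈ Cube.boundary (Fin n) := Cube.stretch_mem_boundary ⟨i, hi⟩
      refine (hg _ hz).trans ?_
      exact (γ₁.2 _ hz).symm
  exact Quotient.sound (((GenLoop.homotopicRel_stretch γ₁).trans key).trans
    (GenLoop.homotopicRel_stretch γ₂).symm)

/-- Let the values of a diagram be open subsets of a Hausdorff space `X`, such that the ones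
containing a given point of `X` form a nonempty, downward directed family. Then the map from the
homotopy colimit to `X` is a weak homotopy equivalence. -/
theorem isWeakHomotopyEquiv_desc [T2Space X] (hα : IsDirectedCover α) :
    IsWeakHomotopyEquiv (desc F α) :=
  ⟨bijective_zerothHomotopy_desc hα, fun n x _ =>
    ⟨injective_homotopyGroup_desc hα n x, surjective_homotopyGroup_desc hα n x⟩⟩

end Hocolim

end OpenCover

/-! ### Topology of configuration spaces -/

section ConfTopology

variable {X : Type*} [TopologicalSpace X]

namespace Conf

/-- The configuration underlying an ordered configuration. -/
def mk {k : ℕ} {X : Type*} (f : OrderedConf k X) : Conf k X := Quotient.mk _ f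

theorem mk_eq_mk_iff {k : ℕ} {X : Type*} {f g : OrderedConf k X} :
    mk f = mk g ↔ ∃ σ : Equiv.Perm (Fin k), g.1 = f.1 ∘ σ :=
  Quotient.eq

theorem mk_surjective {k : ℕ} {X : Type*} : Function.Surjective (mk : OrderedConf k X → Conf k X) :=
  Quotient.exists_rep

theorem isOpenQuotientMap_mk (k : ℕ) :
    IsOpenQuotientMap (mk : OrderedConf k X → Conf k X) := by
  have hq : IsQuotientMap (mk : OrderedConf k X → Conf k X) := isQuotientMap_quot_mk
  refine ⟨hq.surjective, hq.continuous, fun U hU => ?_⟩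
  rw [← hq.isOpen_preimage]
  have : mk ⁻¹' (mk '' U) = ⋃ σ : Equiv.Perm (Fin k),
      (fun f : OrderedConf k X => (⟨f.1 ∘ σ, f.2.comp σ.injective⟩ : OrderedConf k X)) ⁻¹' U := by
    ext f
    simp only [mem_preimage, mem_image, mem_iUnion]
    constructor
    · rintro ⟨g, hg, e⟩
      obtain ⟨σ, hσ⟩ := mk_eq_mk_iff.1 e.symm
      exact ⟨σ, by convert hg; exact hσ.symm⟩
    · rintro ⟨σ, hσ⟩
      exact ⟨_, hσ, (mk_eq_mk_iff.2 ⟨σ, rfl⟩).symm⟩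
  rw [this]
  refine isOpen_iUnion fun σ => hU.preimage (Continuous.subtype_mk (continuous_pi fun i => ?_) _)
  exact (continuous_apply (σ i)).comp continuous_subtype_val

instance t2Space (k : ℕ) [T2Space X] : T2Space (Conf k X) := by
  rw [t2Space_iff_of_isOpenQuotientMap (isOpenQuotientMap_mk k)]
  have : {q : OrderedConf k X × OrderedConf k X | mk q.1 = mk q.2} =
      ⋃ σ : Equiv.Perm (Fin k), {q | q.2.1 = q.1.1 ∘ σ} := by
    ext q
    simp only [mem_ofPred_eq, mem_iUnion]
    exact mk_eq_mk_iff
  rw [this]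
  refine isClosed_iUnion_of_finite fun σ => isClosed_eq (by fun_prop) (continuous_pi fun i => ?_)
  exact (continuous_apply (σ i)).comp (continuous_subtype_val.comp continuous_fst)

theorem incl_mk {k : ℕ} {A B : Set X} (h : A ⊆ B) (f : OrderedConf k A) :
    incl k h (mk f) = mk ⟨inclusion h ∘ f.1, (inclusion_injective h).comp f.2⟩ :=
  rfl

theorem mk_mem_range_incl_iff {k : ℕ} {A B : Set X} (h : A ⊆ B) (f : OrderedConf k B) :
    mk f ∈ range (incl k h) ↔ ∀ i, (f.1 i : X) ∈ A := by
  constructor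
  · rintro ⟨z, hz⟩ i
    obtain ⟨g, rfl⟩ := mk_surjective z
    rw [incl_mk] at hz
    obtain ⟨σ, hσ⟩ := mk_eq_mk_iff.1 hz
    rw [hσ]
    exact (g.1 (σ i)).2
  · intro hf
    refine ⟨mk ⟨fun i => ⟨f.1 i, hf i⟩, fun i j e => f.2 (Subtype.ext ?_)⟩, ?_⟩
    · simpa using e
    · rw [incl_mk]; rfl

theorem isOpenEmbedding_incl (k : ℕ) {A B : Set X} (h : A ⊆ B)
    (hA : IsOpen ((↑) ⁻¹' A : Set B)) : IsOpenEmbedding (incl k h) := by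
  refine .of_continuous_injective_isOpenMap (incl k h).continuous ?_ ?_
  · intro z w hzw
    obtain ⟨f, rfl⟩ := mk_surjective z
    obtain ⟨g, rfl⟩ := mk_surjective w
    rw [incl_mk, incl_mk, mk_eq_mk_iff] at hzw
    obtain ⟨σ, hσ⟩ := hzw
    refine mk_eq_mk_iff.2 ⟨σ, funext fun i => inclusion_injective h (congrFun hσ i)⟩
  · have hincl : IsOpenEmbedding (inclusion h) := by
      refine ⟨IsEmbedding.inclusion h, ?_⟩
      rwa [range_inclusion]
    intro U hU
    have hopen : IsOpenMap fun f : OrderedConf k A =>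
        (⟨inclusion h ∘ f.1, (inclusion_injective h).comp f.2⟩ : OrderedConf k B) := by
      have hpi : IsOpenEmbedding fun f : Fin k → A => inclusion h ∘ f := by
        refine ⟨IsEmbedding.piMap fun _ => hincl.isEmbedding, ?_⟩
        have : range (fun f : Fin k → A => inclusion h ∘ f) =
            pi univ fun _ => range (inclusion h) := by
          exact range_piMap fun _ => inclusion h
        rw [this]
        exact isOpen_set_pi finite_univ fun _ _ => hincl.isOpen_range
      refine fun V hV => ?_
      obtain ⟨W, hW, rfl⟩ := isOpen_induced_iff.1 hV
      refine isOpen_induced_iff.2 ⟨_, hpi.isOpenMap W hW, ?_⟩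
      ext f
      constructor
      · rintro ⟨g, hg, e⟩
        have hg' : Function.Injective g := fun i j hij => f.2 (by
          rw [← e]; exact congrArg (inclusion h) hij)
        exact ⟨⟨g, hg'⟩, hg, Subtype.ext e⟩
      · rintro ⟨g, hg, rfl⟩
        exact ⟨g.1, hg, rfl⟩
    have : incl k h '' U = mk '' ((fun f : OrderedConf k A =>
        (⟨inclusion h ∘ f.1, (inclusion_injective h).comp f.2⟩ : OrderedConf k B)) ''
          (mk ⁻¹' U)) := by
      rw [image_image]
      ext w
      constructor
      · rintro ⟨z, hz, rfl⟩
        obtain ⟨f, rfl⟩ := mk_surjective z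
        exact ⟨f, hz, rfl⟩
      · rintro ⟨f, hf, rfl⟩
        exact ⟨mk f, hf, rfl⟩
    rw [this]
    exact (isOpenQuotientMap_mk k).isOpenMap _
      (hopen _ (hU.preimage (isOpenQuotientMap_mk k).continuous))

end Conf

end ConfTopology

/-! ### Second-order equations: solutions with small initial velocity -/

section SecondOrder

open Filter

/-! #### Superposition operators on spaces of continuous functions -/

namespace ContinuousMap

variable {T : Type*} [TopologicalSpace T] [CompactSpace T]
  {V W : Type*} [NormedAddCommGroup V] [NormedSpace ℝ V] [NormedAddCommGroup W] [NormedSpace ℝ W]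

/-- A continuous family of linear maps acts on continuous functions. -/
noncomputable def pointwiseApply (A : C(T, V →L[ℝ] W)) : C(T, V) →L[ℝ] C(T, W) :=
  LinearMap.mkContinuousOfExistsBound
    { toFun := fun h => (⟨fun t => A t (h t), A.continuous.clm_apply h.continuous⟩ : C(T, W))
      map_add' := fun h k => by ext t; simp
      map_smul' := fun c h => by ext t; simp } (by
    obtain ⟨C, hC⟩ := isCompact_univ.exists_bound_of_continuousOn A.continuous.continuousOn
    refine ⟨max C 0, fun h => ?_⟩
    rw [ContinuousMap.norm_le _ (by positivity)]
    exact fun t => ((A t).le_opNorm _).trans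
      (mul_le_mul ((hC t trivial).trans (le_max_left _ _)) (h.norm_coe_le_norm t)
        (norm_nonneg _) (le_max_right _ _)))

theorem pointwiseApply_apply (A : C(T, V →L[ℝ] W)) (h : C(T, V)) (t : T) :
    pointwiseApply A h t = A t (h t) := rfl

variable {B : V → W}

/-- The derivative of a `C^1` map is uniformly continuous along a compact family of points. -/
theorem eventually_norm_fderiv_sub_lt (hB : ContDiff ℝ 1 B) (f : C(T, V)) {ε : ℝ} (hε : 0 < ε) :
    ∀ᶠ g in 𝓝 f, ∀ t, ‖fderiv ℝ B (g t) - fderiv ℝ B (f t)‖ < ε := by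
  have hcont := (ContinuousMap.continuous_postcomp
    (⟨fderiv ℝ B, hB.continuous_fderiv one_ne_zero⟩ : C(V, V →L[ℝ] W))).tendsto f
  have h1 := Metric.tendstoUniformly_iff.1
    (ContinuousMap.tendsto_iff_tendstoUniformly.1 hcont) ε hε
  filter_upwards [h1] with g hg t
  rw [← dist_eq_norm, dist_comm]
  exact hg t

/-- The superposition operator of a `C^1` map is differentiable; its derivative is given by the
pointwise derivative. -/
theorem hasFDerivAt_superposition (hB : ContDiff ℝ 1 B) (f : C(T, V)) :
    HasFDerivAt (fun f : C(T, V) => (⟨B, hB.continuous⟩ : C(V, W)).comp f)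
      (pointwiseApply
        ((⟨fderiv ℝ B, hB.continuous_fderiv one_ne_zero⟩ : C(V, V →L[ℝ] W)).comp f)) f := by
  rw [hasFDerivAt_iff_isLittleO_nhds_zero, Asymptotics.isLittleO_iff]
  intro ε hε
  obtain ⟨δ, hδ, hδε⟩ := Metric.eventually_nhds_iff.1 (eventually_norm_fderiv_sub_lt hB f hε)
  filter_upwards [Metric.ball_mem_nhds (0 : C(T, V)) hδ] with h hh
  rw [mem_ball_zero_iff] at hh
  rw [ContinuousMap.norm_le _ (by positivity)]
  intro t
  -- points near `f t` are values at `t` of translates of `f` by constants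
  have key : ∀ y ∈ Metric.ball (f t) δ, ‖fderiv ℝ B y - fderiv ℝ B (f t)‖ ≤ ε := by
    intro y hy
    have h1 : dist (f + ContinuousMap.const T (y - f t)) f < δ := by
      rw [dist_eq_norm, add_sub_cancel_left]
      refine ((ContinuousMap.norm_le _ (norm_nonneg (y - f t))).2 fun _ => le_rfl).trans_lt ?_
      rwa [← dist_eq_norm]
    simpa using (hδε h1 t).le
  have hmem : f t + h t ∈ Metric.ball (f t) δ := by
    rw [mem_ball_iff_norm, add_sub_cancel_left]
    exact (h.norm_coe_le_norm t).trans_lt hh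
  have h4 := (convex_ball (f t) δ).norm_image_sub_le_of_norm_hasFDerivWithin_le'
    (f := B) (f' := fderiv ℝ B) (φ := fderiv ℝ B (f t)) (C := ε) (x := f t) (y := f t + h t)
    (fun y _ => (hB.differentiable one_ne_zero y).hasFDerivAt.hasFDerivWithinAt) key
    (Metric.mem_ball_self hδ) hmem
  rw [add_sub_cancel_left] at h4
  exact h4.trans (mul_le_mul_of_nonneg_left (h.norm_coe_le_norm t) hε.le)

theorem contDiff_superposition (hB : ContDiff ℝ 1 B) :
    ContDiff ℝ 1 (fun f : C(T, V) => (⟨B, hB.continuous⟩ : C(V, W)).comp f) := by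
  rw [contDiff_one_iff_hasFDerivAt]
  refine ⟨_, continuous_iff_continuousAt.2 fun f => ?_, hasFDerivAt_superposition hB⟩
  rw [Metric.continuousAt_iff']
  intro ε hε
  filter_upwards [eventually_norm_fderiv_sub_lt hB f (half_pos hε)] with g hg
  rw [dist_eq_norm]
  refine lt_of_le_of_lt (ContinuousLinearMap.opNorm_le_bound _ (half_pos hε).le fun h => ?_)
    (half_lt_self hε)
  rw [ContinuousMap.norm_le _ (by positivity)]
  exact fun t => ((fderiv ℝ B (g t) - fderiv ℝ B (f t)).le_opNorm _).trans
    (mul_le_mul (hg t).le (h.norm_coe_le_norm t) (norm_nonneg _) (half_pos hε).le)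

end ContinuousMap

/-! #### Integration -/

section Volterra

/-- The time interval `[-1, 2]`. -/
abbrev TimeInterval : Type := Icc (-1 : ℝ) 2

/-- The extension of a function on `[-1, 2]` to the line, constant on both sides. -/
noncomputable def extendTime {E : Type*} [TopologicalSpace E] (f : C(TimeInterval, E)) (t : ℝ) :
    E :=
  f (projIcc (-1) 2 (by norm_num) t)

theorem continuous_extendTime {E : Type*} [TopologicalSpace E] (f : C(TimeInterval, E)) :
    Continuous (extendTime f) :=
  f.continuous.comp continuous_projIcc

theorem extendTime_of_mem {E : Type*} [TopologicalSpace E] (f : C(TimeInterval, E)) {t : ℝ}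
    (ht : t ∈ Icc (-1 : ℝ) 2) :
    extendTime f t = f ⟨t, ht⟩ := by
  rw [extendTime, projIcc_of_mem _ ht]

variable {E : Type*} [NormedAddCommGroup E] [NormedSpace ℝ E] [CompleteSpace E]

/-- Integration from `0`, as an operator on continuous functions on `[-1, 2]`. -/
noncomputable def volterra : C(TimeInterval, E) →L[ℝ] C(TimeInterval, E) :=
  LinearMap.mkContinuous
    { toFun := fun f => ⟨fun t => ∫ τ in (0 : ℝ)..t, extendTime f τ,
        (continuous_iff_continuousAt.2 fun t =>
          ((continuous_extendTime f).integral_hasStrictDerivAt 0 t).hasDerivAt.continuousAt).comp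
            continuous_subtype_val⟩
      map_add' := fun f g => by
        ext t
        exact intervalIntegral.integral_add ((continuous_extendTime f).intervalIntegrable _ _)
          ((continuous_extendTime g).intervalIntegrable _ _)
      map_smul' := fun c f => by
        ext t
        exact intervalIntegral.integral_smul c _ } 2 fun f => by
    rw [ContinuousMap.norm_le _ (by positivity)]
    intro t
    refine (intervalIntegral.norm_integral_le_of_norm_le_const (C := ‖f‖)
      fun τ _ => f.norm_coe_le_norm _).trans ?_
    rw [mul_comm]
    refine mul_le_mul_of_nonneg_right ?_ (norm_nonneg f)
    rw [sub_zero, abs_le]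
    exact ⟨by linarith [t.2.1], t.2.2⟩

theorem volterra_apply (f : C(TimeInterval, E)) (t : TimeInterval) :
    volterra f t = ∫ τ in (0 : ℝ)..t, extendTime f τ := rfl

theorem hasDerivAt_extendTime_of_eq_volterra {f g : C(TimeInterval, E)} {c : E}
    (h : ∀ t, f t = c + volterra g t) {t : ℝ} (ht : t ∈ Ioo (-1 : ℝ) 2) :
    HasDerivAt (extendTime f) (extendTime g t) t := by
  have h1 : HasDerivAt (fun t => c + ∫ τ in (0 : ℝ)..t, extendTime g τ) (extendTime g t) t :=
    ((continuous_extendTime g).integral_hasStrictDerivAt 0 t).hasDerivAt.const_add c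
  refine h1.congr_of_eventuallyEq ?_
  filter_upwards [isOpen_Ioo.mem_nhds ht] with τ hτ
  rw [extendTime_of_mem f (Ioo_subset_Icc_self hτ), h]
  rfl

end Volterra

/-! #### Dependence on the initial velocity -/

section Flow

variable {E : Type*} [NormedAddCommGroup E] [NormedSpace ℝ E] [FiniteDimensional ℝ E]

/-- A map which is smooth near a point agrees near this point with a globally smooth map. -/
theorem exists_contDiff_eventuallyEq {V W : Type*} [NormedAddCommGroup V] [NormedSpace ℝ V]
    [FiniteDimensional ℝ V] [NormedAddCommGroup W] [NormedSpace ℝ W] {B : V → W} {U : Set V}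
    {n : ℕ∞} (hU : IsOpen U) (hB : ContDiffOn ℝ n B U) {x : V} (hx : x ∈ U) :
    ∃ B' : V → W, ContDiff ℝ n B' ∧ B' =ᶠ[𝓝 x] B := by
  obtain ⟨ε, hε, hεU⟩ := Metric.isOpen_iff.1 hU x hx
  let χ : ContDiffBump x := ⟨ε / 4, ε / 2, by positivity, by linarith⟩
  refine ⟨fun y => χ y • B y, ?_, ?_⟩
  · rw [contDiff_iff_contDiffAt]
    intro y
    by_cases hy : dist y x < ε
    · exact χ.contDiffAt.smul (hB.contDiffAt (hU.mem_nhds (hεU hy)))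
    · have : (fun y => χ y • B y) =ᶠ[𝓝 y] fun _ => 0 := by
        have hy' : ε / 2 < dist y x := by linarith
        filter_upwards [(isOpen_lt continuous_const
          (continuous_id'.dist continuous_const)).mem_nhds hy'] with z hz
        rw [χ.zero_of_le_dist (le_of_lt hz), zero_smul]
      exact contDiffAt_const.congr_of_eventuallyEq this
  · filter_upwards [χ.eventuallyEq_one] with y hy
    rw [hy, Pi.one_apply, one_smul]

/-- Solutions of the second-order equation `u'' = -B(u, u')` with initial position `y₀` and small
initial velocity `v`, where `B` vanishes to first order at `(y₀, 0)`. They exist on `(-1, 2)`, stay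
close to `y₀`, and the position at time `1` is a `C^1` function of `v` with derivative the identity
at `v = 0`. The velocity `w` is found by applying the inverse function theorem in the space of
continuous functions to `w ↦ w + ∫ B(y₀ + ∫ w, w)`, whose derivative at `0` is the identity. -/
theorem exists_solution_small_velocity {B : E × E → E} {U : Set (E × E)} (hU : IsOpen U) {y₀ : E}
    (hy₀ : (y₀, 0) ∈ U) (hB : ContDiffOn ℝ 1 B U) (hB0 : B (y₀, 0) = 0)
    (hB1 : fderiv ℝ B (y₀, 0) = 0) {N : Set (E × E)} (hN : N ∈ 𝓝 (y₀, (0 : E))) :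
    ∃ u w : E → ℝ → E, (∀ᶠ v in 𝓝 (0 : E), u v 0 = y₀ ∧ w v 0 = v ∧ ∀ t ∈ Ioo (-1 : ℝ) 2,
        (u v t, w v t) ∈ N ∧ HasDerivAt (u v) (w v t) t ∧
          HasDerivAt (w v) (-B (u v t, w v t)) t) ∧
      ContDiffAt ℝ 1 (fun v => u v 1) 0 ∧
      HasFDerivAt (fun v => u v 1) (ContinuousLinearMap.id ℝ E) 0 ∧ u 0 1 = y₀ := by
  obtain ⟨B', hB', hBB'⟩ := exists_contDiff_eventuallyEq (n := 1) hU hB hy₀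
  have hB'0 : B' (y₀, 0) = 0 := hBB'.eq_of_nhds.trans hB0
  have hB'1 : fderiv ℝ B' (y₀, 0) = 0 := hBB'.fderiv_eq.trans hB1
  -- the pair of position and velocity, as an affine function of the velocity
  let Z : C(TimeInterval, E) →L[ℝ] C(TimeInterval, E × E) :=
    (ContinuousLinearMap.compLeftContinuous ℝ TimeInterval (ContinuousLinearMap.inl ℝ E E)).comp
      volterra +
    ContinuousLinearMap.compLeftContinuous ℝ TimeInterval (ContinuousLinearMap.inr ℝ E E)
  have hZ : ∀ (w : C(TimeInterval, E)) t, Z w t = (volterra w t, w t) := fun w t => by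
    simp [Z]
  let z₀ : C(TimeInterval, E × E) := ContinuousMap.const _ (y₀, 0)
  let S : C(TimeInterval, E × E) → C(TimeInterval, E) :=
    fun f => (⟨B', hB'.continuous⟩ : C(E × E, E)).comp f
  have hS : ContDiff ℝ 1 S := ContinuousMap.contDiff_superposition hB'
  have hS1 : HasFDerivAt S (0 : C(TimeInterval, E × E) →L[ℝ] C(TimeInterval, E)) z₀ := by
    convert ContinuousMap.hasFDerivAt_superposition (T := TimeInterval) hB' z₀ using 1
    ext h t
    rw [ContinuousMap.pointwiseApply_apply]
    simp [z₀, hB'1]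
  let Φ : C(TimeInterval, E) → C(TimeInterval, E) := fun w => w + volterra (S (z₀ + Z w))
  have hΦ : ContDiff ℝ 1 Φ :=
    contDiff_id.add ((volterra (E := E)).contDiff.comp (hS.comp (contDiff_const.add Z.contDiff)))
  have hΦ1 : HasFDerivAt Φ
      ((ContinuousLinearEquiv.refl ℝ C(TimeInterval, E) : C(TimeInterval, E) ≃L[ℝ] _) :
        C(TimeInterval, E) →L[ℝ] C(TimeInterval, E)) 0 := by
    have h1 : HasFDerivAt (fun w => z₀ + Z w) Z 0 := Z.hasFDerivAt.const_add z₀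
    have h2 : HasFDerivAt S (0 : C(TimeInterval, E × E) →L[ℝ] C(TimeInterval, E))
        (z₀ + Z 0) := by simpa using hS1
    have h3 : HasFDerivAt (fun w => S (z₀ + Z w))
        (0 : C(TimeInterval, E) →L[ℝ] C(TimeInterval, E)) 0 := by
      exact (h2.comp (0 : C(TimeInterval, E)) h1).congr_fderiv (ContinuousLinearMap.zero_comp _)
    have h4 : HasFDerivAt (fun w => volterra (S (z₀ + Z w)))
        (0 : C(TimeInterval, E) →L[ℝ] C(TimeInterval, E)) 0 := by
      have h5 : HasFDerivAt (fun f : C(TimeInterval, E) => volterra f) (volterra (E := E))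
          (S (z₀ + Z 0)) := ContinuousLinearMap.hasFDerivAt _
      exact (h5.comp (0 : C(TimeInterval, E)) h3).congr_fderiv (ContinuousLinearMap.comp_zero _)
    have h6 := (hasFDerivAt_id (𝕜 := ℝ) (0 : C(TimeInterval, E))).add h4
    rw [add_zero] at h6
    exact h6
  have hΦ0 : Φ 0 = 0 := by
    have : S (z₀ + Z 0) = 0 := by
      ext t
      simp [S, z₀, hB'0]
    change (0 : C(TimeInterval, E)) + volterra (S (z₀ + Z 0)) = 0
    rw [this, map_zero, add_zero]
  let g := hΦ.contDiffAt.localInverse hΦ1 one_ne_zero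
  have hg : ContDiffAt ℝ 1 g 0 := by
    have := hΦ.contDiffAt.to_localInverse hΦ1 one_ne_zero
    rwa [hΦ0] at this
  have hst : HasStrictFDerivAt Φ _ 0 := hΦ.contDiffAt.hasStrictFDerivAt' hΦ1 one_ne_zero
  have hg0 : g 0 = 0 := by
    have := hΦ.contDiffAt.localInverse_apply_image hΦ1 one_ne_zero
    rwa [hΦ0] at this
  have hgΦ : ∀ᶠ y in 𝓝 0, Φ (g y) = y := by
    have := hst.eventually_right_inverse
    rwa [hΦ0] at this
  have hg1 : HasFDerivAt g (ContinuousLinearMap.id ℝ C(TimeInterval, E)) 0 := by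
    have := hst.to_localInverse.hasFDerivAt
    rwa [hΦ0] at this
  let κ : E →L[ℝ] C(TimeInterval, E) := ContinuousLinearMap.const ℝ TimeInterval
  have hκ0 : κ 0 = 0 := map_zero κ
  have hκ : Tendsto κ (𝓝 0) (𝓝 0) := by
    have := κ.continuous.tendsto 0
    rwa [hκ0] at this
  have hgκ : Tendsto (fun v => Z (g (κ v))) (𝓝 0) (𝓝 0) := by
    have := (Z.continuous.tendsto _).comp (hg.continuousAt.tendsto.comp hκ)
    rwa [hg0, map_zero] at this
  have h0mem : (0 : ℝ) ∈ Icc (-1 : ℝ) 2 := by norm_num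
  have h1mem : (1 : ℝ) ∈ Icc (-1 : ℝ) 2 := by norm_num
  have hu1 : ∀ v, y₀ + extendTime (volterra (g (κ v))) 1 =
      y₀ + (ContinuousMap.evalCLM ℝ (⟨1, h1mem⟩ : TimeInterval)) (volterra (g (κ v))) := fun v => by
    rw [extendTime_of_mem _ h1mem]; rfl
  refine ⟨fun v t => y₀ + extendTime (volterra (g (κ v))) t, fun v => extendTime (g (κ v)),
    ?_, ?_, ?_, ?_⟩
  · obtain ⟨ε, hε, hεN⟩ := Metric.mem_nhds_iff.1 (inter_mem hN hBB')
    filter_upwards [hκ.eventually hgΦ, hgκ.eventually (Metric.ball_mem_nhds 0 hε)] with v hv hvε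
    set f := g (κ v) with hf
    have hfeq : ∀ t, f t = v + volterra (-S (z₀ + Z f)) t := fun t => by
      have : f t + volterra (S (z₀ + Z f)) t = v := congrArg (fun h : C(TimeInterval, E) => h t) hv
      rw [map_neg, ContinuousMap.neg_apply, ← this]
      abel
    have hvolt0 : ∀ h : C(TimeInterval, E), volterra h ⟨0, h0mem⟩ = 0 := fun h => by
      rw [volterra_apply]; exact intervalIntegral.integral_same
    refine ⟨?_, ?_, fun t ht => ?_⟩
    · rw [extendTime_of_mem _ h0mem, hvolt0, add_zero]
    · rw [extendTime_of_mem _ h0mem, hfeq, hvolt0, add_zero]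
    · have ht' := Ioo_subset_Icc_self ht
      have hmem : (y₀ + extendTime (volterra f) t, extendTime f t) ∈ N ∩ {x | B' x = B x} := by
        refine hεN ?_
        rw [mem_ball_iff_norm]
        have h1 := ((Z f).norm_coe_le_norm ⟨t, ht'⟩).trans_lt (mem_ball_zero_iff.1 hvε)
        rw [hZ] at h1
        simpa [extendTime_of_mem _ ht'] using h1
      refine ⟨hmem.1, ?_, ?_⟩
      · exact (hasDerivAt_extendTime_of_eq_volterra (c := 0)
          (fun t => (zero_add _).symm) ht).const_add y₀
      · have h2 := hasDerivAt_extendTime_of_eq_volterra hfeq ht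
        convert h2 using 1
        have h3 : B' _ = B _ := hmem.2
        rw [← h3]
        rw [extendTime_of_mem _ ht', extendTime_of_mem _ ht', extendTime_of_mem _ ht']
        simp [S, z₀, hZ]
  · simp_rw [hu1]
    refine contDiffAt_const.add ?_
    refine (ContinuousLinearMap.contDiff _).contDiffAt.comp _
      ((ContinuousLinearMap.contDiff _).contDiffAt.comp _ (ContDiffAt.comp _ ?_
        κ.contDiff.contDiffAt))
    rwa [hκ0]
  · simp_rw [hu1]
    have h1 : HasFDerivAt g (ContinuousLinearMap.id ℝ C(TimeInterval, E)) (κ 0) := by rwa [hκ0]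
    have h2 := ((ContinuousMap.evalCLM ℝ (⟨1, h1mem⟩ : TimeInterval)).hasFDerivAt.comp _
      ((volterra (E := E)).hasFDerivAt.comp _ (h1.comp _ κ.hasFDerivAt))).const_add y₀
    refine h2.congr_fderiv ?_
    ext v
    change volterra (κ v) ⟨1, h1mem⟩ = v
    rw [volterra_apply]
    have : ∀ τ, extendTime (κ v) τ = v := fun τ => rfl
    simp [this]
  · change y₀ + extendTime (volterra (g (κ 0))) 1 = y₀
    rw [hu1, hκ0, hg0, map_zero, map_zero, add_zero]

end Flow

end SecondOrder

/-! ### The geodesic equation of a metric on an open subset of a vector space -/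

section EulerLagrange

set_option maxSynthPendingDepth 3

variable {E : Type*} [NormedAddCommGroup E] [NormedSpace ℝ E]

/-- The left-hand side of the geodesic equation for the metric `G`, at position `y`, with velocity
`v` and acceleration `a`, tested against `w`. -/
noncomputable def eulerLagrange (G : E → E →L[ℝ] E →L[ℝ] ℝ) (y v a w : E) : ℝ :=
  G y a w + fderiv ℝ (fun y => G y v w) y v - (1 / 2) * fderiv ℝ (fun y => G y v v) y w

variable {G : E → E →L[ℝ] E →L[ℝ] ℝ} {y : E}

theorem fderiv_apply_apply (hG : DifferentiableAt ℝ G y) (v w a : E) :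
    fderiv ℝ (fun y => G y v w) y a = fderiv ℝ G y a v w := by
  have h1 := (hG.hasFDerivAt.clm_apply (hasFDerivAt_const v y)).clm_apply (hasFDerivAt_const w y)
  rw [h1.fderiv]
  simp

theorem eulerLagrange_eq (hG : DifferentiableAt ℝ G y) (v a w : E) :
    eulerLagrange G y v a w =
      G y a w + fderiv ℝ G y v v w - (1 / 2) * fderiv ℝ G y w v v := by
  rw [eulerLagrange, fderiv_apply_apply hG, fderiv_apply_apply hG]

/-- The part of `eulerLagrange` which is quadratic in the velocity, as a linear form. -/
noncomputable def sprayForm (G : E → E →L[ℝ] E →L[ℝ] ℝ) (z : E × E) : E →L[ℝ] ℝ :=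
  fderiv ℝ G z.1 z.2 z.2 - (1 / 2 : ℝ) • ((fderiv ℝ G z.1).flip z.2).flip z.2

theorem sprayForm_apply (z : E × E) (w : E) :
    sprayForm G z w = fderiv ℝ G z.1 z.2 z.2 w - (1 / 2) * fderiv ℝ G z.1 w z.2 z.2 := rfl

/-- The geodesic spray `(y, v) ↦ B(y, v)`, in terms of which the geodesic equation reads
`u'' = -B(u, u')`. -/
noncomputable def geodesicSpray (G : E → E →L[ℝ] E →L[ℝ] ℝ) (z : E × E) : E :=
  (G z.1).inverse (sprayForm G z)

theorem geodesicSpray_smul (c : ℝ) (z : E × E) :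
    geodesicSpray G (z.1, c • z.2) = c ^ 2 • geodesicSpray G z := by
  have : sprayForm G (z.1, c • z.2) = c ^ 2 • sprayForm G z := by
    ext w
    simp [sprayForm_apply]
    ring
  rw [geodesicSpray, this, map_smul]
  rfl

theorem geodesicSpray_zero : geodesicSpray G (y, 0) = 0 := by
  simpa using geodesicSpray_smul (G := G) 0 (y, 0)

/-- The geodesic equation is invariant under changes of coordinates: if `G'` is the pullback of the
metric `G` under `τ`, then the expression for `G'` at the curve `u` is the expression for `G` at the
curve `τ ∘ u`. -/
theorem eulerLagrange_pullback {G' : E → E →L[ℝ] E →L[ℝ] ℝ} {τ : E → E} {u : ℝ → E} {t : ℝ}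
    (hG : DifferentiableAt ℝ G (τ (u t))) (hτ : ContDiffAt ℝ 2 τ (u t))
    (hsymm : ∀ v w, G (τ (u t)) v w = G (τ (u t)) w v)
    (hpull : ∀ᶠ y in 𝓝 (u t), ∀ v w, G' y v w = G (τ y) (fderiv ℝ τ y v) (fderiv ℝ τ y w))
    (hu : ContDiffAt ℝ 2 u t) (w : E) :
    eulerLagrange G' (u t) (deriv u t) (deriv (deriv u) t) w =
      eulerLagrange G (τ (u t)) (deriv (τ ∘ u) t) (deriv (deriv (τ ∘ u)) t)
        (fderiv ℝ τ (u t) w) := by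
  have hτ1 : HasFDerivAt τ (fderiv ℝ τ (u t)) (u t) :=
    (hτ.differentiableAt two_ne_zero).hasFDerivAt
  have hτ2 : HasFDerivAt (fderiv ℝ τ) (fderiv ℝ (fderiv ℝ τ) (u t)) (u t) :=
    ((hτ.fderiv_right (m := 1) (by norm_num)).differentiableAt one_ne_zero).hasFDerivAt
  have hτs : ∀ v w, fderiv ℝ (fderiv ℝ τ) (u t) v w = fderiv ℝ (fderiv ℝ τ) (u t) w v :=
    (hτ.isSymmSndFDerivAt (by simp)).eq
  have hev : ∀ᶠ r in 𝓝 t, deriv (τ ∘ u) r = fderiv ℝ τ (u r) (deriv u r) := by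
    filter_upwards [hu.eventually (by simp),
      hu.continuousAt.eventually (hτ.eventually (by simp))] with r hr hr'
    exact (((hr'.differentiableAt two_ne_zero).hasFDerivAt).comp_hasDerivAt r
      (hr.differentiableAt two_ne_zero).hasDerivAt).deriv
  have hu1 : HasDerivAt u (deriv u t) t := (hu.differentiableAt two_ne_zero).hasDerivAt
  have hu2 : HasDerivAt (deriv u) (deriv (deriv u) t) t := by
    have h1 : ContDiffAt ℝ 1 (fun r => fderiv ℝ u r 1) t :=
      (hu.fderiv_right (m := 1) (by norm_num)).clm_apply contDiffAt_const
    simp only [fderiv_apply_one_eq_deriv] at h1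
    exact (h1.differentiableAt one_ne_zero).hasDerivAt
  have hacc : deriv (deriv (τ ∘ u)) t =
      fderiv ℝ (fderiv ℝ τ) (u t) (deriv u t) (deriv u t) +
        fderiv ℝ τ (u t) (deriv (deriv u) t) := by
    rw [Filter.EventuallyEq.deriv_eq hev]
    exact ((hτ2.comp_hasDerivAt t hu1).clm_apply hu2).deriv
  have hG1 : HasFDerivAt (fun y => G (τ y)) ((fderiv ℝ G (τ (u t))).comp (fderiv ℝ τ (u t)))
      (u t) := HasFDerivAt.comp (g := G) (u t) hG.hasFDerivAt hτ1
  have hD : ∀ v w a, fderiv ℝ (fun y => G' y v w) (u t) a =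
      fderiv ℝ G (τ (u t)) (fderiv ℝ τ (u t) a) (fderiv ℝ τ (u t) v) (fderiv ℝ τ (u t) w) +
      G (τ (u t)) (fderiv ℝ (fderiv ℝ τ) (u t) a v) (fderiv ℝ τ (u t) w) +
      G (τ (u t)) (fderiv ℝ τ (u t) v) (fderiv ℝ (fderiv ℝ τ) (u t) a w) := by
    intro v w a
    have h1 : (fun y => G' y v w) =ᶠ[𝓝 (u t)]
        fun y => G (τ y) (fderiv ℝ τ y v) (fderiv ℝ τ y w) := by
      filter_upwards [hpull] with y hy using hy v w
    have h2 := (hG1.clm_apply (hτ2.clm_apply (hasFDerivAt_const v _))).clm_apply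
      (hτ2.clm_apply (hasFDerivAt_const w _))
    rw [h1.fderiv_eq, h2.fderiv]
    simp
    ring
  rw [eulerLagrange_eq hG, eulerLagrange, hD, hD, hpull.self_of_nhds, hacc, hev.self_of_nhds,
    map_add, add_apply, hτs w, hsymm (fderiv ℝ (fderiv ℝ τ) (u t) _ w)]
  ring

variable [FiniteDimensional ℝ E]

theorem isInvertible_of_posDef (h : ∀ v, v ≠ 0 → 0 < G y v v) : (G y).IsInvertible := by
  have hinj : Function.Injective (G y : E →ₗ[ℝ] E →L[ℝ] ℝ) := by
    rw [injective_iff_map_eq_zero]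
    intro v hv
    by_contra hne
    have h1 := h v hne
    have h2 : G y v = 0 := hv
    rw [h2] at h1
    exact lt_irrefl _ h1
  have hdim : Module.finrank ℝ E = Module.finrank ℝ (E →L[ℝ] ℝ) := by
    rw [← (LinearMap.toContinuousLinearMap (𝕜 := ℝ) (E := E) (F' := ℝ)).finrank_eq]
    exact (Subspace.dual_finrank_eq).symm
  exact ⟨(LinearEquiv.ofInjectiveOfFinrankEq _ hinj hdim).toContinuousLinearEquiv, by ext; rfl⟩

theorem eulerLagrange_eq_zero_iff (hG : DifferentiableAt ℝ G y)
    (h : ∀ v, v ≠ 0 → 0 < G y v v) {v a : E} :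
    (∀ w, eulerLagrange G y v a w = 0) ↔ a = -geodesicSpray G (y, v) := by
  have h1 : (∀ w, eulerLagrange G y v a w = 0) ↔ G y a = -sprayForm G (y, v) := by
    rw [ContinuousLinearMap.ext_iff]
    refine forall_congr' fun w => ?_
    rw [eulerLagrange_eq hG, neg_apply, sprayForm_apply]
    constructor <;> intro h <;> linarith
  obtain ⟨M, hM⟩ := isInvertible_of_posDef h
  rw [h1, geodesicSpray, ← hM, ContinuousLinearMap.inverse_equiv]
  change M a = _ ↔ a = -(M.symm _)
  rw [← map_neg, M.eq_symm_apply]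

theorem contDiffOn_geodesicSpray {U : Set E} (hU : IsOpen U) (hG : ContDiffOn ℝ ∞ G U)
    (h : ∀ y ∈ U, ∀ v, v ≠ 0 → 0 < G y v v) :
    ContDiffOn ℝ ∞ (geodesicSpray G) (U ×ˢ univ) := by
  have hfst : ContDiffOn ℝ ∞ (Prod.fst : E × E → E) (U ×ˢ univ) := contDiff_fst.contDiffOn
  have hsnd : ContDiffOn ℝ ∞ (Prod.snd : E × E → E) (U ×ˢ univ) := contDiff_snd.contDiffOn
  have hmaps : MapsTo (Prod.fst : E × E → E) (U ×ˢ univ) U := fun z hz => hz.1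
  have hDG : ContDiffOn ℝ ∞ (fun z : E × E => fderiv ℝ G z.1) (U ×ˢ univ) :=
    (hG.fderiv_of_isOpen hU (by simp)).comp hfst hmaps
  have hGz : ContDiffOn ℝ ∞ (fun z : E × E => G z.1) (U ×ˢ univ) := hG.comp hfst hmaps
  have hinv : ContDiffOn ℝ ∞ (fun z : E × E => (G z.1).inverse) (U ×ˢ univ) := by
    intro z hz
    obtain ⟨M, hM⟩ := isInvertible_of_posDef (h z.1 hz.1)
    have := contDiffAt_map_inverse (𝕜 := ℝ) (n := ∞) M
    rw [hM] at this
    exact this.comp_contDiffWithinAt z (hGz z hz)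
  refine hinv.clm_apply (contDiffOn_clm_apply.2 fun w => ?_)
  simp only [sprayForm_apply]
  exact (((hDG.clm_apply hsnd).clm_apply hsnd).clm_apply contDiffOn_const).sub
    (contDiffOn_const.mul (((hDG.clm_apply contDiffOn_const).clm_apply hsnd).clm_apply hsnd))

theorem fderiv_geodesicSpray_zero {U : Set E} (hU : IsOpen U) (hG : ContDiffOn ℝ ∞ G U)
    (h : ∀ y ∈ U, ∀ v, v ≠ 0 → 0 < G y v v) (hy : y ∈ U) :
    fderiv ℝ (geodesicSpray G) (y, 0) = 0 := by
  have hd : ∀ z ∈ U ×ˢ (univ : Set E), DifferentiableAt ℝ (geodesicSpray G) z := fun z hz =>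
    ((contDiffOn_geodesicSpray hU hG h).contDiffAt
      ((hU.prod isOpen_univ).mem_nhds hz)).differentiableAt (by simp)
  refine ContinuousLinearMap.ext fun ⟨a, b⟩ => ?_
  -- along the line through `(y, 0)` with direction `(a, b)` the spray is `t ^ 2` times a
  -- differentiable function
  have h1 : HasDerivAt (fun t : ℝ => geodesicSpray G (y + t • a, t • b))
      (fderiv ℝ (geodesicSpray G) (y, 0) (a, b)) 0 := by
    have hl : HasDerivAt (fun t : ℝ => (y + t • a, t • b)) (a, b) 0 := by
      simpa using (((hasDerivAt_id (0 : ℝ)).smul_const a).const_add y).prodMk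
        ((hasDerivAt_id (0 : ℝ)).smul_const b)
    have := (hd (y, 0) ⟨hy, trivial⟩).hasFDerivAt
    exact HasFDerivAt.comp_hasDerivAt_of_eq (0 : ℝ) this hl (by simp)
  have h2 : HasDerivAt (fun t : ℝ => t ^ 2 • geodesicSpray G (y + t • a, b)) 0 0 := by
    have hl : DifferentiableAt ℝ (fun t : ℝ => (y + t • a, b)) 0 := by fun_prop
    have h3 : DifferentiableAt ℝ (fun t : ℝ => geodesicSpray G (y + t • a, b)) 0 :=
      DifferentiableAt.comp (0 : ℝ) (g := geodesicSpray G)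
        (by simpa using hd (y, b) ⟨hy, trivial⟩) hl
    exact ((hasDerivAt_pow 2 (0 : ℝ)).smul h3.hasDerivAt).congr_deriv (by simp)
  refine h1.unique (h2.congr_of_eventuallyEq (Filter.Eventually.of_forall fun t => ?_))
  exact geodesicSpray_smul t (y + t • a, b)

end EulerLagrange

/-! ### The Riemannian metric in charts -/

section ChartMetric

set_option maxSynthPendingDepth 3

variable {E : Type*} [NormedAddCommGroup E] [NormedSpace ℝ E]
  {L : Type*} [TopologicalSpace L] [ChartedSpace E L]

section Charts

theorem eventually_mem_overlap {x₀ x₁ : L} {y : E}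
    (hy : y ∈ (extChartAt 𝓘(ℝ, E) x₁).target)
    (hy' : (extChartAt 𝓘(ℝ, E) x₁).symm y ∈ (extChartAt 𝓘(ℝ, E) x₀).source) :
    ∀ᶠ z in 𝓝 y, z ∈ (extChartAt 𝓘(ℝ, E) x₁).target ∧
      (extChartAt 𝓘(ℝ, E) x₁).symm z ∈ (extChartAt 𝓘(ℝ, E) x₀).source :=
  Filter.Eventually.and ((isOpen_extChartAt_target x₁).mem_nhds hy)
    ((continuousAt_extChartAt_symm'' hy).eventually
      ((isOpen_extChartAt_source x₀).mem_nhds hy'))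

variable [IsManifold 𝓘(ℝ, E) ∞ L]

theorem contMDiffOn_extChartAt_symm_target (x₀ : L) :
    ContMDiffOn 𝓘(ℝ, E) 𝓘(ℝ, E) ∞ (extChartAt 𝓘(ℝ, E) x₀).symm (extChartAt 𝓘(ℝ, E) x₀).target :=
  contMDiffOn_extChartAt_symm x₀

theorem contMDiffAt_extChartAt_symm {x₀ : L} {y : E} (hy : y ∈ (extChartAt 𝓘(ℝ, E) x₀).target) :
    ContMDiffAt 𝓘(ℝ, E) 𝓘(ℝ, E) ∞ (extChartAt 𝓘(ℝ, E) x₀).symm y :=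
  (contMDiffOn_extChartAt_symm x₀).contMDiffAt ((isOpen_extChartAt_target x₀).mem_nhds hy)

theorem mdifferentiableAt_extChartAt_symm {x₀ : L} {y : E}
    (hy : y ∈ (extChartAt 𝓘(ℝ, E) x₀).target) :
    MDifferentiableAt 𝓘(ℝ, E) 𝓘(ℝ, E) (extChartAt 𝓘(ℝ, E) x₀).symm y :=
  (contMDiffAt_extChartAt_symm hy).mdifferentiableAt (by simp)

theorem isInvertible_mfderiv_extChartAt_symm {x₀ : L} {y : E}
    (hy : y ∈ (extChartAt 𝓘(ℝ, E) x₀).target) :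
    (mfderiv 𝓘(ℝ, E) 𝓘(ℝ, E) (extChartAt 𝓘(ℝ, E) x₀).symm y).IsInvertible := by
  have := isInvertible_mfderivWithin_extChartAt_symm hy
  rwa [ModelWithCorners.range_eq_univ, mfderivWithin_univ] at this

/-- The transition map from the chart at `x₁` to the chart at `x₀`. -/
noncomputable def transitionMap (x₁ x₀ : L) : E → E :=
  extChartAt 𝓘(ℝ, E) x₀ ∘ (extChartAt 𝓘(ℝ, E) x₁).symm

variable {x₀ x₁ : L} {y : E}

theorem contDiffAt_transitionMap (hy : y ∈ (extChartAt 𝓘(ℝ, E) x₁).target)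
    (hy' : (extChartAt 𝓘(ℝ, E) x₁).symm y ∈ (extChartAt 𝓘(ℝ, E) x₀).source) :
    ContDiffAt ℝ ∞ (transitionMap x₁ x₀) y := by
  rw [← contMDiffAt_iff_contDiffAt]
  refine ContMDiffAt.comp y (contMDiffAt_extChartAt' ?_) (contMDiffAt_extChartAt_symm hy)
  rwa [← extChartAt_source 𝓘(ℝ, E)]

theorem mfderiv_extChartAt_symm_eq (hy : y ∈ (extChartAt 𝓘(ℝ, E) x₁).target)
    (hy' : (extChartAt 𝓘(ℝ, E) x₁).symm y ∈ (extChartAt 𝓘(ℝ, E) x₀).source) (v : E) :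
    (mfderiv 𝓘(ℝ, E) 𝓘(ℝ, E) (extChartAt 𝓘(ℝ, E) x₁).symm y v : E) =
      mfderiv 𝓘(ℝ, E) 𝓘(ℝ, E) (extChartAt 𝓘(ℝ, E) x₀).symm (transitionMap x₁ x₀ y)
        (fderiv ℝ (transitionMap x₁ x₀) y v) := by
  have h1 : (extChartAt 𝓘(ℝ, E) x₁).symm =ᶠ[𝓝 y]
      (extChartAt 𝓘(ℝ, E) x₀).symm ∘ transitionMap x₁ x₀ := by
    filter_upwards [eventually_mem_overlap hy hy'] with z hz
    exact ((extChartAt 𝓘(ℝ, E) x₀).left_inv hz.2).symm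
  have h2 : transitionMap x₁ x₀ y ∈ (extChartAt 𝓘(ℝ, E) x₀).target :=
    (extChartAt 𝓘(ℝ, E) x₀).map_source hy'
  have h3 := ((contDiffAt_transitionMap hy hy').differentiableAt
    (by simp)).hasFDerivAt.hasMFDerivAt
  have h4 := (mdifferentiableAt_extChartAt_symm h2).hasMFDerivAt.comp y h3
  have h5 := (h4.congr_of_eventuallyEq h1).mfderiv
  exact congrArg (fun A : E →L[ℝ] E => A v) h5

end Charts

variable [RiemannianBundle (fun x : L => TangentSpace 𝓘(ℝ, E) x)]

/-- The inner product on the tangent space at `p`. -/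
noncomputable def tangentInner (p : L) (a b : TangentSpace 𝓘(ℝ, E) p) : ℝ :=
  inner ℝ a b

theorem chartMetric_eq_tangentInner (x₀ : L) (y v w : E) :
    chartMetric 𝓘(ℝ, E) x₀ y v w = tangentInner ((extChartAt 𝓘(ℝ, E) x₀).symm y)
      (mfderiv 𝓘(ℝ, E) 𝓘(ℝ, E) (extChartAt 𝓘(ℝ, E) x₀).symm y v)
      (mfderiv 𝓘(ℝ, E) 𝓘(ℝ, E) (extChartAt 𝓘(ℝ, E) x₀).symm y w) := rfl

theorem chartMetric_comm (x₀ : L) (y v w : E) :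
    chartMetric 𝓘(ℝ, E) x₀ y v w = chartMetric 𝓘(ℝ, E) x₀ y w v :=
  real_inner_comm _ _

theorem chartMetric_add_left (x₀ : L) (y v v' w : E) :
    chartMetric 𝓘(ℝ, E) x₀ y (v + v') w =
      chartMetric 𝓘(ℝ, E) x₀ y v w + chartMetric 𝓘(ℝ, E) x₀ y v' w := by
  unfold chartMetric
  erw [map_add]
  exact inner_add_left _ _ _

theorem chartMetric_smul_left (x₀ : L) (y : E) (c : ℝ) (v w : E) :
    chartMetric 𝓘(ℝ, E) x₀ y (c • v) w = c * chartMetric 𝓘(ℝ, E) x₀ y v w := by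
  unfold chartMetric
  erw [map_smul]
  exact real_inner_smul_left _ _ _

variable [FiniteDimensional ℝ E]

/-- The Riemannian metric in the chart at `x₀`, as a function with values in the bilinear forms on
the model vector space. -/
noncomputable def metricForm (x₀ : L) (y : E) : E →L[ℝ] E →L[ℝ] ℝ :=
  LinearMap.toContinuousBilinearMap (LinearMap.mk₂ ℝ (chartMetric 𝓘(ℝ, E) x₀ y)
    (chartMetric_add_left x₀ y) (fun c => chartMetric_smul_left x₀ y c)
    (fun v w w' => by simp only [chartMetric_comm x₀ y v, chartMetric_add_left])
    (fun c v w => by simp only [chartMetric_comm x₀ y v, chartMetric_smul_left, smul_eq_mul]))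

theorem metricForm_apply (x₀ : L) (y v w : E) :
    metricForm x₀ y v w = chartMetric 𝓘(ℝ, E) x₀ y v w := rfl

theorem geodesicEquation_iff (x₀ : L) (γ : ℝ → L) (t : ℝ) :
    GeodesicEquation 𝓘(ℝ, E) x₀ γ t ↔ ∀ w, eulerLagrange (metricForm x₀)
      (extChartAt 𝓘(ℝ, E) x₀ (γ t)) (deriv (extChartAt 𝓘(ℝ, E) x₀ ∘ γ) t)
      (deriv (deriv (extChartAt 𝓘(ℝ, E) x₀ ∘ γ)) t) w = 0 := Iff.rfl

variable [IsManifold 𝓘(ℝ, E) ∞ L]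

theorem metricForm_pos {x₀ : L} {y : E} (hy : y ∈ (extChartAt 𝓘(ℝ, E) x₀).target) {v : E}
    (hv : v ≠ 0) : 0 < metricForm x₀ y v v := by
  rw [metricForm_apply]
  refine real_inner_self_pos.2 fun h => hv ?_
  obtain ⟨M, hM⟩ := isInvertible_mfderiv_extChartAt_symm hy
  exact M.injective (((congrArg (fun A => A v) hM).trans h).trans (map_zero M).symm)

theorem metricForm_transitionMap {x₀ x₁ : L} {y : E}
    (hy : y ∈ (extChartAt 𝓘(ℝ, E) x₁).target)
    (hy' : (extChartAt 𝓘(ℝ, E) x₁).symm y ∈ (extChartAt 𝓘(ℝ, E) x₀).source) (v w : E) :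
    metricForm x₁ y v w = metricForm x₀ (transitionMap x₁ x₀ y)
      (fderiv ℝ (transitionMap x₁ x₀) y v) (fderiv ℝ (transitionMap x₁ x₀) y w) := by
  rw [metricForm_apply, metricForm_apply, chartMetric_eq_tangentInner, chartMetric_eq_tangentInner]
  have h1 := mfderiv_extChartAt_symm_eq hy hy' v
  have h2 := mfderiv_extChartAt_symm_eq hy hy' w
  have h3 : (extChartAt 𝓘(ℝ, E) x₀).symm (transitionMap x₁ x₀ y) =
    (extChartAt 𝓘(ℝ, E) x₁).symm y := (extChartAt 𝓘(ℝ, E) x₀).left_inv hy'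
  erw [h1, h2, h3]

variable [IsContMDiffRiemannianBundle 𝓘(ℝ, E) ∞ E (fun x : L => TangentSpace 𝓘(ℝ, E) x)]

theorem contDiffOn_metricForm (x₀ : L) :
    ContDiffOn ℝ ∞ (metricForm x₀) (extChartAt 𝓘(ℝ, E) x₀).target := by
  have hsec : ∀ v : E, ContMDiffOn 𝓘(ℝ, E) 𝓘(ℝ, E).tangent ∞
      (fun y => (⟨(extChartAt 𝓘(ℝ, E) x₀).symm y,
        mfderiv 𝓘(ℝ, E) 𝓘(ℝ, E) (extChartAt 𝓘(ℝ, E) x₀).symm y v⟩ : TangentBundle 𝓘(ℝ, E) L))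
      (extChartAt 𝓘(ℝ, E) x₀).target := by
    intro v
    have hop := isOpen_extChartAt_target (I := 𝓘(ℝ, E)) x₀
    have h1 := (contMDiffOn_extChartAt_symm_target x₀).contMDiffOn_tangentMapWithin
      (m := ∞) (by simp) hop.uniqueMDiffOn
    have h2 : ContMDiffOn 𝓘(ℝ, E) 𝓘(ℝ, E).tangent ∞
        (fun y => (⟨y, v⟩ : TangentBundle 𝓘(ℝ, E) E)) (extChartAt 𝓘(ℝ, E) x₀).target :=
      contMDiffOn_vectorSpace_iff_contDiffOn.2 contDiffOn_const
    refine (h1.comp h2 fun y hy => hy).congr fun y hy => ?_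
    simp only [Function.comp_def, tangentMapWithin]
    rw [mfderivWithin_of_isOpen hop hy]
  refine contDiffOn_clm_apply.2 fun v => contDiffOn_clm_apply.2 fun w => ?_
  rw [← contMDiffOn_iff_contDiffOn]
  exact ContMDiffOn.inner_bundle (IB := 𝓘(ℝ, E)) (F := E)
    (E := fun x : L => TangentSpace 𝓘(ℝ, E) x) (hsec v) (hsec w)

end ChartMetric

/-! ### Geodesics with small initial velocity and the exponential map -/

section Geodesics

set_option maxSynthPendingDepth 3

open Filter

theorem contDiffOn_two_of_hasDerivAt {E : Type*} [NormedAddCommGroup E] [NormedSpace ℝ E]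
    {u w a : ℝ → E} {T : Set ℝ} (hT : IsOpen T) (hu : ∀ t ∈ T, HasDerivAt u (w t) t)
    (hw : ∀ t ∈ T, HasDerivAt w (a t) t) (ha : ContinuousOn a T) : ContDiffOn ℝ 2 u T := by
  have h1 : ContDiffOn ℝ 1 w T := by
    rw [show (1 : WithTop ℕ∞) = 0 + 1 from rfl, contDiffOn_succ_iff_deriv_of_isOpen hT]
    refine ⟨fun t ht => (hw t ht).differentiableAt.differentiableWithinAt, by simp, ?_⟩
    rw [contDiffOn_zero]
    exact ha.congr fun t ht => (hw t ht).deriv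
  rw [show (2 : WithTop ℕ∞) = 1 + 1 from rfl, contDiffOn_succ_iff_deriv_of_isOpen hT]
  exact ⟨fun t ht => (hu t ht).differentiableAt.differentiableWithinAt, by simp,
    h1.congr fun t ht => (hu t ht).deriv⟩

variable {E : Type*} [NormedAddCommGroup E] [NormedSpace ℝ E]
  {L : Type*} [TopologicalSpace L] [ChartedSpace E L] [IsManifold 𝓘(ℝ, E) ∞ L]

/-- A curve whose expression in the chart at `s` starts at the base point of the chart starts at
`s`, with the same velocity. -/
theorem initial_velocity_of_chart {s : L} {u : ℝ → E} {v : TangentSpace 𝓘(ℝ, E) s}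
    (h0 : u 0 = extChartAt 𝓘(ℝ, E) s s) (h1 : HasDerivAt u v 0) :
    (⟨((extChartAt 𝓘(ℝ, E) s).symm ∘ u) 0,
      mfderiv 𝓘(ℝ, ℝ) 𝓘(ℝ, E) ((extChartAt 𝓘(ℝ, E) s).symm ∘ u) 0 (1 : ℝ)⟩ :
        TangentBundle 𝓘(ℝ, E) L) = ⟨s, v⟩ := by
  have key : ∀ (p q : L) (a : TangentSpace 𝓘(ℝ, E) p) (b : TangentSpace 𝓘(ℝ, E) q), p = q →
      (show E from a) = (show E from b) → (⟨p, a⟩ : TangentBundle 𝓘(ℝ, E) L) = ⟨q, b⟩ := by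
    rintro p q a b rfl hab
    exact congrArg (fun x : TangentSpace 𝓘(ℝ, E) p => (⟨p, x⟩ : TangentBundle 𝓘(ℝ, E) L)) hab
  refine key _ _ _ _ ?_ ?_
  · rw [Function.comp_apply, h0]
    exact extChartAt_to_inv s
  · have h2 : u 0 ∈ (extChartAt 𝓘(ℝ, E) s).target := by
      rw [h0]; exact mem_extChartAt_target s
    have h3 := (mdifferentiableAt_extChartAt_symm h2).hasMFDerivAt.comp 0
      h1.hasFDerivAt.hasMFDerivAt
    have h4 := mfderivWithin_range_extChartAt_symm (I := 𝓘(ℝ, E)) (x := s)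
    rw [ModelWithCorners.range_eq_univ, mfderivWithin_univ, ← h0] at h4
    have h5 := congrArg (fun A : ℝ →L[ℝ] E => A 1) h3.mfderiv
    refine h5.trans ?_
    have h6 := congrArg (fun A : E →L[ℝ] E => A ((1 : ℝ) • (show E from v))) h4
    refine Eq.trans h6 ?_
    exact one_smul ℝ _

theorem hasDerivAt_extChartAt_comp {s : L} {γ : ℝ → L} {t : ℝ}
    (hγ : MDifferentiableAt 𝓘(ℝ, ℝ) 𝓘(ℝ, E) γ t) (ht : γ t ∈ (chartAt E s).source) :
    HasDerivAt (extChartAt 𝓘(ℝ, E) s ∘ γ)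
      (mfderiv 𝓘(ℝ, E) 𝓘(ℝ, E) (extChartAt 𝓘(ℝ, E) s) (γ t)
        (mfderiv 𝓘(ℝ, ℝ) 𝓘(ℝ, E) γ t (1 : ℝ)) : E) t := by
  have h1 := (mdifferentiableAt_extChartAt ht).hasMFDerivAt.comp t hγ.hasMFDerivAt
  have h2 : ∀ A : ℝ →L[ℝ] E, HasMFDerivAt 𝓘(ℝ, ℝ) 𝓘(ℝ, E) (extChartAt 𝓘(ℝ, E) s ∘ γ) t A →
      HasDerivAt (extChartAt 𝓘(ℝ, E) s ∘ γ) (A 1) t := fun A hA => by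
    have h3 : HasFDerivAt (extChartAt 𝓘(ℝ, E) s ∘ γ) A t := hasMFDerivAt_iff_hasFDerivAt.1 hA
    exact h3.hasDerivAt
  exact h2 _ h1

theorem chart_initial_velocity {s : L} {γ : ℝ → L} {v : TangentSpace 𝓘(ℝ, E) s}
    (hγ : MDifferentiableAt 𝓘(ℝ, ℝ) 𝓘(ℝ, E) γ 0)
    (h : (⟨γ 0, mfderiv 𝓘(ℝ, ℝ) 𝓘(ℝ, E) γ 0 (1 : ℝ)⟩ : TangentBundle 𝓘(ℝ, E) L) = ⟨s, v⟩) :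
    γ 0 = s ∧ deriv (extChartAt 𝓘(ℝ, E) s ∘ γ) 0 = v := by
  have h0 : γ 0 = s := congrArg (fun z : TangentBundle 𝓘(ℝ, E) L => z.1) h
  refine ⟨h0, ?_⟩
  rw [(hasDerivAt_extChartAt_comp hγ (h0 ▸ mem_chart_source E s)).deriv]
  have h1 := congrArg (fun z : TangentBundle 𝓘(ℝ, E) L =>
    (mfderiv 𝓘(ℝ, E) 𝓘(ℝ, E) (extChartAt 𝓘(ℝ, E) s) z.1 z.2 : E)) h
  refine h1.trans ?_
  exact congrArg (fun A : E →L[ℝ] E => A v) (mfderiv_extChartAt_self (I := 𝓘(ℝ, E)) (x := s))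

theorem contDiffAt_extChartAt_comp {s : L} {γ : ℝ → L} {T : Set ℝ} {t : ℝ} (hT : IsOpen T)
    (ht : t ∈ T) (hγ : ContMDiffOn 𝓘(ℝ, ℝ) 𝓘(ℝ, E) 2 γ T) (hs : γ t ∈ (chartAt E s).source) :
    ContDiffAt ℝ 2 (extChartAt 𝓘(ℝ, E) s ∘ γ) t := by
  rw [← contMDiffAt_iff_contDiffAt]
  exact ContMDiffAt.comp t ((contMDiffAt_extChartAt' (n := ∞) hs).of_le (by norm_cast))
    (hγ.contMDiffAt (hT.mem_nhds ht))

variable [RiemannianBundle (fun x : L => TangentSpace 𝓘(ℝ, E) x)] [FiniteDimensional ℝ E]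
  [IsContMDiffRiemannianBundle 𝓘(ℝ, E) ∞ E (fun x : L => TangentSpace 𝓘(ℝ, E) x)]

theorem differentiableAt_metricForm {s : L} {y : E} (hy : y ∈ (extChartAt 𝓘(ℝ, E) s).target) :
    DifferentiableAt ℝ (metricForm s) y :=
  ((contDiffOn_metricForm s).contDiffAt ((isOpen_extChartAt_target s).mem_nhds hy)).differentiableAt
    (by simp)

/-- In a chart, a geodesic solves the second-order equation given by the spray. -/
theorem GeodesicEquation.deriv_deriv_eq {s : L} {γ : ℝ → L} {t : ℝ}
    (h : GeodesicEquation 𝓘(ℝ, E) s γ t) (ht : γ t ∈ (chartAt E s).source) :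
    deriv (deriv (extChartAt 𝓘(ℝ, E) s ∘ γ)) t = -geodesicSpray (metricForm s)
      (extChartAt 𝓘(ℝ, E) s (γ t), deriv (extChartAt 𝓘(ℝ, E) s ∘ γ) t) := by
  have hy : extChartAt 𝓘(ℝ, E) s (γ t) ∈ (extChartAt 𝓘(ℝ, E) s).target :=
    (extChartAt 𝓘(ℝ, E) s).map_source (by rwa [extChartAt_source])
  exact (eulerLagrange_eq_zero_iff (differentiableAt_metricForm hy)
    fun v hv => metricForm_pos hy hv).1 ((geodesicEquation_iff s γ t).1 h)

/-- A curve which solves the second-order equation given by the spray in the chart at `s` is a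
geodesic: it satisfies the geodesic equation in all charts. -/
theorem isGeodesicOn_of_chart {s : L} {u w : ℝ → E} {T : Set ℝ} (hT : IsOpen T)
    (hmem : ∀ t ∈ T, u t ∈ (extChartAt 𝓘(ℝ, E) s).target)
    (hu : ∀ t ∈ T, HasDerivAt u (w t) t)
    (hw : ∀ t ∈ T, HasDerivAt w (-geodesicSpray (metricForm s) (u t, w t)) t) :
    IsGeodesicOn 𝓘(ℝ, E) ((extChartAt 𝓘(ℝ, E) s).symm ∘ u) T := by
  have hspray : ContDiffOn ℝ ∞ (geodesicSpray (metricForm s))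
      ((extChartAt 𝓘(ℝ, E) s).target ×ˢ univ) :=
    contDiffOn_geodesicSpray (isOpen_extChartAt_target s) (contDiffOn_metricForm s)
      fun y hy v hv => metricForm_pos hy hv
  have hu2 : ContDiffOn ℝ 2 u T := by
    refine contDiffOn_two_of_hasDerivAt hT hu hw (ContinuousOn.neg ?_)
    refine hspray.continuousOn.comp (ContinuousOn.prodMk ?_ ?_) fun t ht => ⟨hmem t ht, trivial⟩
    · exact fun t ht => (hu t ht).continuousAt.continuousWithinAt
    · exact fun t ht => (hw t ht).continuousAt.continuousWithinAt
  refine ⟨?_, fun t ht x₀ hx₀ => ?_⟩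
  · exact ((contMDiffOn_extChartAt_symm_target s).of_le (by norm_cast)).comp
      hu2.contMDiffOn hmem
  set γ := (extChartAt 𝓘(ℝ, E) s).symm ∘ u with hγ
  rw [geodesicEquation_iff]
  intro a
  -- `u` is the image of the expression of `γ` in the chart at `x₀` under the transition map
  have hxs : γ t ∈ (extChartAt 𝓘(ℝ, E) x₀).source := by rwa [extChartAt_source]
  have hss : γ t ∈ (extChartAt 𝓘(ℝ, E) s).source := (extChartAt 𝓘(ℝ, E) s).map_target (hmem t ht)
  have hyt : extChartAt 𝓘(ℝ, E) x₀ (γ t) ∈ (extChartAt 𝓘(ℝ, E) x₀).target :=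
    (extChartAt 𝓘(ℝ, E) x₀).map_source hxs
  have hys : (extChartAt 𝓘(ℝ, E) x₀).symm (extChartAt 𝓘(ℝ, E) x₀ (γ t)) ∈
      (extChartAt 𝓘(ℝ, E) s).source := by
    rwa [(extChartAt 𝓘(ℝ, E) x₀).left_inv hxs]
  have hcont : ContinuousAt γ t :=
    (continuousAt_extChartAt_symm'' (hmem t ht)).comp (hu t ht).continuousAt
  have hτu : transitionMap x₀ s ∘ (extChartAt 𝓘(ℝ, E) x₀ ∘ γ) =ᶠ[𝓝 t] u := by
    filter_upwards [hcont.eventually ((isOpen_extChartAt_source x₀).mem_nhds hxs),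
      hT.mem_nhds ht] with r hr hrT
    change extChartAt 𝓘(ℝ, E) s ((extChartAt 𝓘(ℝ, E) x₀).symm
      (extChartAt 𝓘(ℝ, E) x₀ (γ r))) = u r
    rw [(extChartAt 𝓘(ℝ, E) x₀).left_inv hr]
    exact (extChartAt 𝓘(ℝ, E) s).right_inv (hmem r hrT)
  have hτt : transitionMap x₀ s (extChartAt 𝓘(ℝ, E) x₀ (γ t)) = u t := hτu.eq_of_nhds
  have hu' : ∀ᶠ r in 𝓝 t, deriv u r = w r := by
    filter_upwards [hT.mem_nhds ht] with r hr using (hu r hr).deriv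
  have hx2 : ContDiffAt ℝ 2 (extChartAt 𝓘(ℝ, E) x₀ ∘ γ) t := by
    have h1 : ContDiffAt ℝ 2 (transitionMap s x₀) (u t) :=
      (contDiffAt_transitionMap (hmem t ht) hxs).of_le (by norm_cast)
    exact h1.comp t (hu2.contDiffAt (hT.mem_nhds ht))
  have key := eulerLagrange_pullback (G := metricForm s) (G' := metricForm x₀)
    (τ := transitionMap x₀ s) (u := extChartAt 𝓘(ℝ, E) x₀ ∘ γ) (t := t)
    (by
      change DifferentiableAt ℝ (metricForm s)
        (transitionMap x₀ s (extChartAt 𝓘(ℝ, E) x₀ (γ t)))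
      rw [hτt]; exact differentiableAt_metricForm (hmem t ht))
    ((contDiffAt_transitionMap hyt hys).of_le (by norm_cast))
    (fun v w => chartMetric_comm _ _ _ _)
    (by
      filter_upwards [eventually_mem_overlap hyt hys] with y hy v w
      exact metricForm_transitionMap hy.1 hy.2 v w) hx2 a
  refine key.trans ?_
  have hτ0 : transitionMap x₀ s ((extChartAt 𝓘(ℝ, E) x₀ ∘ γ) t) = u t := hτt
  rw [hτu.deriv.deriv_eq, hτu.deriv_eq, hτ0, EventuallyEq.deriv_eq hu', (hw t ht).deriv,
    hu'.self_of_nhds]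
  exact (eulerLagrange_eq_zero_iff (differentiableAt_metricForm (hmem t ht))
    fun v hv => metricForm_pos (hmem t ht) hv).2 rfl _

end Geodesics

section Exponential

set_option maxSynthPendingDepth 3

open Filter

/-- Small closed balls in the tangent space are contained in given neighbourhoods of `0`. -/
theorem exists_closedBall_subset_tangentSpace {E : Type*} [NormedAddCommGroup E] [NormedSpace ℝ E]
    {L : Type*} [TopologicalSpace L] [ChartedSpace E L]
    [RiemannianBundle (fun x : L => TangentSpace 𝓘(ℝ, E) x)] (s : L)
    {K : Set E} (hK : K ∈ 𝓝 (0 : E)) :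
    ∃ r : ℝ, 0 < r ∧ ∀ v : TangentSpace 𝓘(ℝ, E) s, ‖v‖ ≤ r → (v : E) ∈ K := by
  have hK' : (K : Set (TangentSpace 𝓘(ℝ, E) s)) ∈ 𝓝 (0 : TangentSpace 𝓘(ℝ, E) s) := hK
  obtain ⟨r, hr, hrK⟩ := Metric.nhds_basis_closedBall.mem_iff.1 hK'
  exact ⟨r, hr, fun v hv => hrK (mem_closedBall_zero_iff.2 hv)⟩

variable {E : Type*} [NormedAddCommGroup E] [NormedSpace ℝ E] [FiniteDimensional ℝ E]
  {L : Type*} [TopologicalSpace L] [ChartedSpace E L] [IsManifold 𝓘(ℝ, E) ∞ L]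
  [RiemannianBundle (fun x : L => TangentSpace 𝓘(ℝ, E) x)]
  [IsContMDiffRiemannianBundle 𝓘(ℝ, E) ∞ E (fun x : L => TangentSpace 𝓘(ℝ, E) x)]

/-- Geodesics through a point of a chart are determined near this point by their position and
velocity. -/
theorem IsGeodesicOn.eventuallyEq {s : L} {γ₁ γ₂ : ℝ → L} {T : Set ℝ} (hT : IsOpen T)
    (h₁ : IsGeodesicOn 𝓘(ℝ, E) γ₁ T) (h₂ : IsGeodesicOn 𝓘(ℝ, E) γ₂ T) {t : ℝ} (ht : t ∈ T)
    (hs : γ₁ t ∈ (chartAt E s).source) (heq : γ₁ t = γ₂ t)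
    (hderiv : deriv (extChartAt 𝓘(ℝ, E) s ∘ γ₁) t = deriv (extChartAt 𝓘(ℝ, E) s ∘ γ₂) t) :
    ∀ᶠ r in 𝓝 t, γ₁ r = γ₂ r ∧
      deriv (extChartAt 𝓘(ℝ, E) s ∘ γ₁) r = deriv (extChartAt 𝓘(ℝ, E) s ∘ γ₂) r := by
  set e := extChartAt 𝓘(ℝ, E) s with he
  let F : E × E → E × E := fun z => (z.2, -geodesicSpray (metricForm s) z)
  let z : (ℝ → L) → ℝ → E × E := fun γ r => (e (γ r), deriv (e ∘ γ) r)
  have hy : e (γ₁ t) ∈ e.target := e.map_source (by rwa [he, extChartAt_source])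
  have hspray : ContDiffAt ℝ 1 (geodesicSpray (metricForm s)) (z γ₁ t) :=
    ((contDiffOn_geodesicSpray (isOpen_extChartAt_target s) (contDiffOn_metricForm s)
      fun y hy v hv => metricForm_pos hy hv).contDiffAt
        (((isOpen_extChartAt_target s).prod isOpen_univ).mem_nhds ⟨hy, trivial⟩)).of_le
          (by norm_cast)
  obtain ⟨K, N, hN, hK⟩ := (contDiffAt_snd.prodMk hspray.neg :
    ContDiffAt ℝ 1 F (z γ₁ t)).exists_lipschitzOnWith
  have hsrc : ∀ γ : ℝ → L, IsGeodesicOn 𝓘(ℝ, E) γ T → γ t ∈ (chartAt E s).source →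
      ∀ᶠ r in 𝓝 t, r ∈ T ∧ γ r ∈ (chartAt E s).source := fun γ hγ hγt =>
    Eventually.and (hT.mem_nhds ht) ((hγ.1.continuousOn.continuousAt (hT.mem_nhds ht)).eventually
      ((chartAt E s).open_source.mem_nhds hγt))
  have hsol : ∀ γ : ℝ → L, IsGeodesicOn 𝓘(ℝ, E) γ T → γ t ∈ (chartAt E s).source →
      ∀ᶠ r in 𝓝 t, HasDerivAt (z γ) (F (z γ r)) r := by
    intro γ hγ hγt
    filter_upwards [hsrc γ hγ hγt] with r hr
    have h1 : ContDiffAt ℝ 2 (e ∘ γ) r := contDiffAt_extChartAt_comp hT hr.1 hγ.1 hr.2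
    have h2 : HasDerivAt (e ∘ γ) (deriv (e ∘ γ) r) r :=
      (h1.differentiableAt two_ne_zero).hasDerivAt
    have h3 : ContDiffAt ℝ 1 (fun r => fderiv ℝ (e ∘ γ) r 1) r :=
      (h1.fderiv_right (m := 1) (by norm_num)).clm_apply contDiffAt_const
    simp only [fderiv_apply_one_eq_deriv] at h3
    have h4 := (h3.differentiableAt one_ne_zero).hasDerivAt
    rw [(hγ.2 r hr.1 s hr.2).deriv_deriv_eq hr.2] at h4
    exact h2.prodMk h4
  have hs' : γ₂ t ∈ (chartAt E s).source := heq ▸ hs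
  have hz : z γ₁ t = z γ₂ t := Prod.ext (congrArg e heq) hderiv
  have hnear : ∀ γ : ℝ → L, (∀ᶠ r in 𝓝 t, HasDerivAt (z γ) (F (z γ r)) r) → z γ t = z γ₁ t →
      ∀ᶠ r in 𝓝 t, z γ r ∈ N := fun γ hγ hγt =>
    hγ.self_of_nhds.continuousAt.eventually (hγt ▸ hN)
  have h1 := hsol γ₁ h₁ hs
  have h2 := hsol γ₂ h₂ hs'
  have huniq : z γ₁ =ᶠ[𝓝 t] z γ₂ :=
    ODE_solution_unique_of_eventually (v := fun _ => F) (s := fun _ => N)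
      (Eventually.of_forall fun _ => hK) (h1.and (hnear γ₁ h1 rfl)) (h2.and (hnear γ₂ h2 hz.symm))
      hz
  filter_upwards [huniq, hsrc γ₁ h₁ hs, hsrc γ₂ h₂ hs'] with r hr hr1 hr2
  refine ⟨e.injOn ?_ ?_ (congrArg Prod.fst hr), congrArg Prod.snd hr⟩
  · rw [he, extChartAt_source]; exact hr1.2
  · rw [he, extChartAt_source]; exact hr2.2

variable [T2Space L]

/-- A geodesic which stays in a chart up to time `1` agrees there with every geodesic with the same
initial position and velocity. -/
theorem IsGeodesicOn.apply_one_eq {s : L} {γ₁ γ₂ : ℝ → L} {T : Set ℝ} (hT : IsOpen T)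
    (hT1 : Icc 0 1 ⊆ T) (h₁ : IsGeodesicOn 𝓘(ℝ, E) γ₁ T) (h₂ : IsGeodesicOn 𝓘(ℝ, E) γ₂ T)
    (hs : ∀ t ∈ Icc (0 : ℝ) 1, γ₁ t ∈ (chartAt E s).source) (heq : γ₁ 0 = γ₂ 0)
    (hderiv : deriv (extChartAt 𝓘(ℝ, E) s ∘ γ₁) 0 = deriv (extChartAt 𝓘(ℝ, E) s ∘ γ₂) 0) :
    γ₁ 1 = γ₂ 1 := by
  set e := extChartAt 𝓘(ℝ, E) s with he
  let A : Set ℝ := {t | γ₁ t = γ₂ t ∧ deriv (e ∘ γ₁) t = deriv (e ∘ γ₂) t}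
  have hcont : ∀ γ : ℝ → L, IsGeodesicOn 𝓘(ℝ, E) γ T → ∀ t ∈ T, ContinuousAt γ t :=
    fun γ hγ t ht => hγ.1.continuousOn.continuousAt (hT.mem_nhds ht)
  have hcont' : ∀ γ : ℝ → L, IsGeodesicOn 𝓘(ℝ, E) γ T → ∀ t ∈ T, γ t ∈ (chartAt E s).source →
      ContinuousAt (deriv (e ∘ γ)) t := by
    intro γ hγ t ht hγt
    have h1 : ContDiffAt ℝ 2 (e ∘ γ) t := contDiffAt_extChartAt_comp hT ht hγ.1 hγt
    have h3 : ContDiffAt ℝ 1 (fun r => fderiv ℝ (e ∘ γ) r 1) t :=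
      (h1.fderiv_right (m := 1) (by norm_num)).clm_apply contDiffAt_const
    simp only [fderiv_apply_one_eq_deriv] at h3
    exact h3.continuousAt
  have hA : Icc (0 : ℝ) 1 ⊆ A := by
    refine IsClosed.Icc_subset_of_forall_exists_gt ?_ ⟨heq, hderiv⟩ ?_
    · refine isClosed_of_closure_subset fun t ht => ?_
      have htI : t ∈ Icc (0 : ℝ) 1 :=
        closure_minimal inter_subset_right isClosed_Icc ht
      have hfr := mem_closure_iff_frequently.1 ht
      have h1 : γ₁ t = γ₂ t := tendsto_nhds_unique_of_frequently_eq (hcont γ₁ h₁ t (hT1 htI))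
        (hcont γ₂ h₂ t (hT1 htI)) (hfr.mono fun r hr => hr.1.1)
      exact ⟨⟨h1, tendsto_nhds_unique_of_frequently_eq (hcont' γ₁ h₁ t (hT1 htI) (hs t htI))
        (hcont' γ₂ h₂ t (hT1 htI) (h1 ▸ hs t htI)) (hfr.mono fun r hr => hr.1.2)⟩, htI⟩
    · intro t ht r hr
      have htI : t ∈ Icc (0 : ℝ) 1 := Ico_subset_Icc_self ht.2
      have h1 := h₁.eventuallyEq hT h₂ (hT1 htI) (hs t htI) ht.1.1 ht.1.2
      obtain ⟨x, hx, hxr⟩ := ((h1.filter_mono nhdsWithin_le_nhds).and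
        (Ioc_mem_nhdsGT (show t < r from hr))).exists
      exact ⟨x, hx, hxr⟩
  exact (hA ⟨zero_le_one, le_rfl⟩).1
/-- In the chart at `s`, the exponential map is given for small vectors by a `C^1` map `h` whose
derivative at `0` is the identity. -/
theorem exists_chart_expression_exp (s : L) {N : Set L} (hN : N ∈ 𝓝 s) :
    ∃ h : E → E, ContDiffAt ℝ 1 h 0 ∧ HasFDerivAt h (ContinuousLinearMap.id ℝ E) 0 ∧
      ∀ᶠ v in 𝓝 (0 : E), h v ∈ (extChartAt 𝓘(ℝ, E) s).target ∧
        (extChartAt 𝓘(ℝ, E) s).symm (h v) ∈ N ∧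
        ∀ y, HasExp 𝓘(ℝ, E) s v y ↔ y = (extChartAt 𝓘(ℝ, E) s).symm (h v) := by
  set e := extChartAt 𝓘(ℝ, E) s with he
  have hpos : ∀ y ∈ e.target, ∀ v, v ≠ 0 → 0 < metricForm s y v v :=
    fun y hy v hv => metricForm_pos hy hv
  have hop : IsOpen e.target := isOpen_extChartAt_target s
  have hes : e s ∈ e.target := mem_extChartAt_target s
  have hsmooth := contDiffOn_metricForm (E := E) s
  have hN' : {z : E × E | z.1 ∈ e.target ∧ e.symm z.1 ∈ N} ∈ 𝓝 (e s, (0 : E)) := by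
    have h1 : e.symm ⁻¹' N ∈ 𝓝 (e s) := by
      refine (continuousAt_extChartAt_symm s).preimage_mem_nhds ?_
      rwa [extChartAt_to_inv s]
    exact continuousAt_fst.preimage_mem_nhds (x := (e s, (0 : E)))
      (inter_mem (hop.mem_nhds hes) h1)
  obtain ⟨u, w, huw, hu1, hu2, -⟩ := exists_solution_small_velocity
    (hop.prod isOpen_univ) (y₀ := e s) ⟨hes, trivial⟩
    ((contDiffOn_geodesicSpray hop hsmooth hpos).of_le (by norm_cast))
    geodesicSpray_zero (fderiv_geodesicSpray_zero hop hsmooth hpos hes) hN'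
  refine ⟨fun v => u v 1, hu1, hu2, ?_⟩
  filter_upwards [huw] with v hv
  obtain ⟨hv0, hv1, hv2⟩ := hv
  have h1 : (1 : ℝ) ∈ Ioo (-1 : ℝ) 2 := by norm_num
  have hgeo : IsGeodesicOn 𝓘(ℝ, E) (e.symm ∘ u v) (Ioo (-1) 2) :=
    isGeodesicOn_of_chart isOpen_Ioo (fun t ht => (hv2 t ht).1.1) (fun t ht => (hv2 t ht).2.1)
      fun t ht => (hv2 t ht).2.2
  have hinit : HasDerivAt (u v) v 0 := by
    have := (hv2 0 (by norm_num)).2.1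
    rwa [hv1] at this
  have hcurve := initial_velocity_of_chart (v := v) hv0 hinit
  refine ⟨(hv2 1 h1).1.1, (hv2 1 h1).1.2, fun y => ⟨?_, ?_⟩⟩
  · rintro ⟨γ, ε, hε, hγ, hγv, rfl⟩
    -- compare `γ` with the geodesic in the chart, on a common interval
    have hmd : ∀ γ' : ℝ → L, ∀ T : Set ℝ, T ∈ 𝓝 (0 : ℝ) → IsGeodesicOn 𝓘(ℝ, E) γ' T →
        MDifferentiableAt 𝓘(ℝ, ℝ) 𝓘(ℝ, E) γ' 0 := fun γ' T hT hγ' =>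
      (hγ'.1.contMDiffAt hT).mdifferentiableAt two_ne_zero
    have ha := chart_initial_velocity (hmd γ _ (Ioo_mem_nhds (by linarith) (by linarith)) hγ) hγv
    have hb := chart_initial_velocity
      (hmd _ _ (Ioo_mem_nhds (by norm_num) (by norm_num)) hgeo) hcurve
    have hmono : ∀ γ' : ℝ → L, ∀ T T' : Set ℝ, T ⊆ T' → IsGeodesicOn 𝓘(ℝ, E) γ' T' →
        IsGeodesicOn 𝓘(ℝ, E) γ' T := fun γ' T T' hT hγ' =>
      ⟨hγ'.1.mono hT, fun t ht => hγ'.2 t (hT ht)⟩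
    refine (IsGeodesicOn.apply_one_eq (s := s) (isOpen_Ioo.inter isOpen_Ioo) (fun t ht => ?_)
      (hmono _ _ _ inter_subset_left hgeo) (hmono _ _ _ inter_subset_right hγ)
      (fun t ht => ?_) (hb.1.trans ha.1.symm) (hb.2.trans ha.2.symm)).symm
    · exact ⟨⟨by linarith [ht.1], by linarith [ht.2]⟩, by linarith [ht.1], by linarith [ht.2]⟩
    · rw [← extChartAt_source 𝓘(ℝ, E)]
      exact e.map_target (hv2 t ⟨by linarith [ht.1], by linarith [ht.2]⟩).1.1
  · rintro rfl
    exact ⟨e.symm ∘ u v, 1, one_pos, by norm_num; exact hgeo, hcurve, rfl⟩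

/-- On a neighbourhood of `0` in the tangent space the exponential map is defined and regular, with
values in a given neighbourhood of the base point. -/
theorem exists_nhds_exp_regular (s : L) {N : Set L} (hN : N ∈ 𝓝 s) :
    ∃ K ∈ 𝓝 (0 : E), (∀ v ∈ K, (∃ y, HasExp 𝓘(ℝ, E) s v y) ∧
        Function.Bijective (mfderiv 𝓘(ℝ, E) 𝓘(ℝ, E) (fun v : E => riemannianExp 𝓘(ℝ, E) s v) v) ∧
        riemannianExp 𝓘(ℝ, E) s v ∈ N) ∧
      InjOn (fun v : E => riemannianExp 𝓘(ℝ, E) s v) K := by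
  obtain ⟨h, hh, hh1, hev⟩ := exists_chart_expression_exp (E := E) s hN
  set e := extChartAt 𝓘(ℝ, E) s with he
  have hexp : ∀ᶠ v in 𝓝 (0 : E), riemannianExp 𝓘(ℝ, E) s v = e.symm (h v) := by
    filter_upwards [hev] with v hv
    have hex : ∃ y, HasExp 𝓘(ℝ, E) s v y := ⟨_, (hv.2.2 _).2 rfl⟩
    rw [riemannianExp, dif_pos hex]
    exact (hv.2.2 _).1 hex.choose_spec
  have hstrict : HasStrictFDerivAt h
      ((ContinuousLinearEquiv.refl ℝ E : E ≃L[ℝ] E) : E →L[ℝ] E) 0 :=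
    hh.hasStrictFDerivAt' hh1 one_ne_zero
  have hinj : ∃ K ∈ 𝓝 (0 : E), InjOn h K :=
    ⟨_, (hstrict.toOpenPartialHomeomorph h).open_source.mem_nhds
      hstrict.mem_toOpenPartialHomeomorph_source,
      (hstrict.toOpenPartialHomeomorph h).injOn⟩
  obtain ⟨K, hK, hKinj⟩ := hinj
  have hdiff : ∀ᶠ v in 𝓝 (0 : E), ContDiffAt ℝ 1 h v := hh.eventually (by simp)
  have hinv : ∀ᶠ v in 𝓝 (0 : E), (fderiv ℝ h v).IsInvertible := by
    have hc : ContinuousAt (fderiv ℝ h) 0 :=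
      (hh.fderiv_right (m := 0) (by norm_num)).continuousAt
    have h0 : fderiv ℝ h 0 ∈
        range ((↑) : (E ≃L[ℝ] E) → E →L[ℝ] E) := ⟨ContinuousLinearEquiv.refl ℝ E, hh1.fderiv.symm⟩
    exact hc.eventually (ContinuousLinearEquiv.isOpen.mem_nhds h0)
  refine ⟨K ∩ {v | (h v ∈ e.target ∧ e.symm (h v) ∈ N ∧
    ∀ y, HasExp 𝓘(ℝ, E) s v y ↔ y = e.symm (h v)) ∧
    riemannianExp 𝓘(ℝ, E) s v = e.symm (h v) ∧ (∀ᶠ v' in 𝓝 v,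
      riemannianExp 𝓘(ℝ, E) s v' = e.symm (h v')) ∧ ContDiffAt ℝ 1 h v ∧
      (fderiv ℝ h v).IsInvertible},
    inter_mem hK (hev.and (hexp.and (hexp.eventually_nhds.and (hdiff.and hinv)))), ?_, ?_⟩
  · rintro v ⟨-, ⟨hv1, hv2, hv3⟩, hv4, hv5, hv6, hv7⟩
    refine ⟨⟨_, (hv3 _).2 rfl⟩, ?_, hv4 ▸ hv2⟩
    have h1 := (mdifferentiableAt_extChartAt_symm hv1).hasMFDerivAt.comp v
      (hv6.differentiableAt one_ne_zero).hasFDerivAt.hasMFDerivAt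
    have h2 := (h1.congr_of_eventuallyEq (f₁ := fun v : E => riemannianExp 𝓘(ℝ, E) s v)
      hv5).mfderiv
    obtain ⟨A, hA⟩ := isInvertible_mfderiv_extChartAt_symm hv1
    obtain ⟨B, hB⟩ := hv7
    have h3 : Function.Bijective (fun x : E => A (B x)) := A.bijective.comp B.bijective
    refine (show ∀ f : E → E, (∀ x, f x = A (B x)) → Function.Bijective f from
      fun f hf => (funext hf : f = _) ▸ h3) _ fun x => ?_
    refine (congrArg (fun C : E →L[ℝ] E => C x) h2).trans ?_
    have h4 : fderiv ℝ h v x = B x := congrArg (fun C : E →L[ℝ] E => C x) hB.symm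
    exact (congrArg (fun C : E →L[ℝ] E => C (fderiv ℝ h v x)) hA.symm).trans (congrArg A h4)
  · rintro v ⟨hvK, ⟨hv1, -, -⟩, hv4, -⟩ v' ⟨hvK', ⟨hv1', -, -⟩, hv4', -⟩ hvv
    refine hKinj hvK hvK' (e.symm.injOn hv1 hv1' ?_)
    rw [← hv4, ← hv4']
    exact hvv

end Exponential

/-! ### Fat configurations form a directed cover -/

section FatConfigurations

set_option maxSynthPendingDepth 3

open Filter

variable {E : Type*} [NormedAddCommGroup E] [NormedSpace ℝ E]
  {L : Type*} [TopologicalSpace L] [ChartedSpace E L] [IsManifold 𝓘(ℝ, E) ∞ L]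
  [RiemannianBundle (fun x : L => TangentSpace 𝓘(ℝ, E) x)]
  [IsContMDiffRiemannianBundle 𝓘(ℝ, E) ∞ E (fun x : L => TangentSpace 𝓘(ℝ, E) x)]

variable (E L) in
theorem isContinuousRiemannianBundle_tangentSpace :
    IsContinuousRiemannianBundle E (fun x : L => TangentSpace 𝓘(ℝ, E) x) := by
  obtain ⟨g, hg, h⟩ := IsContMDiffRiemannianBundle.exists_contMDiff (IB := 𝓘(ℝ, E)) (n := ∞)
    (F := E) (E := fun x : L => TangentSpace 𝓘(ℝ, E) x)
  exact ⟨g, hg.continuous, h⟩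

theorem FatConf.isOpen_V (a : FatConf 𝓘(ℝ, E) L) : IsOpen a.V := by
  have := isContinuousRiemannianBundle_tangentSpace E L
  refine isOpen_iUnion fun s => isOpen_iff_mem_nhds.2 fun y hy => ?_
  have h1 : 0 < ENNReal.ofReal (a.radius s) - riemannianEDist 𝓘(ℝ, E) s.1 y := tsub_pos_of_lt hy
  filter_upwards [eventually_riemannianEDist_lt 𝓘(ℝ, E) y h1] with z hz
  exact riemannianEDist_triangle.trans_lt (lt_tsub_iff_left.1 hz)

variable [FiniteDimensional ℝ E]

/-- Every finite set has a fat configuration around it inside a given open neighbourhood. -/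
theorem FatConf.exists_subset_V [T2Space L] [RegularSpace L] (S : Finset L) {W : Set L}
    (hW : IsOpen W) (hS : ↑S ⊆ W) : ∃ a : FatConf 𝓘(ℝ, E) L, ↑S ⊆ a.V ∧ a.V ⊆ W := by
  have := isContinuousRiemannianBundle_tangentSpace E L
  obtain ⟨U, hU, hdisj⟩ := S.finite_toSet.t2_separation
  choose K hK hreg hinj using fun s : L =>
    exists_nhds_exp_regular (E := E) s ((hU s).2.mem_nhds (hU s).1)
  choose r hr hrK using fun s : L => exists_closedBall_subset_tangentSpace s (hK s)
  choose δ hδ hδW using fun s : S =>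
    setOfPred_riemannianEDist_lt_subset_nhds 𝓘(ℝ, E) (hW.mem_nhds (hS s.2))
  refine ⟨
    { centers := S
      radius := fun s => min (r s.1) (δ s)
      radius_pos := fun s => lt_min (hr s.1) (hδ s)
      exp_defined := fun s v hv => (hreg s.1 v (hrK s.1 v (hv.trans (min_le_left _ _)))).1
      exp_regular := fun s v hv => (hreg s.1 v (hrK s.1 v (hv.trans (min_le_left _ _)))).2.1
      exp_injOn := fun s v hv w hw h => hinj s.1 (hrK s.1 v (le_trans hv (min_le_left _ _)))
        (hrK s.1 w (le_trans hw (min_le_left _ _))) h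
      disjoint := fun s s' hss => ?_ }, ?_, ?_⟩
  · refine (hdisj s.2 s'.2 fun h => hss (Subtype.ext h)).mono ?_ ?_ <;>
    · rintro _ ⟨v, hv, rfl⟩
      exact (hreg _ v (hrK _ v (le_trans hv (min_le_left _ _)))).2.2
  · intro s hs
    refine mem_iUnion.2 ⟨⟨s, hs⟩, ?_⟩
    change riemannianEDist 𝓘(ℝ, E) s s < _
    rw [riemannianEDist_self]
    exact ENNReal.ofReal_pos.2 (lt_min (hr s) (hδ ⟨s, hs⟩))
  · refine iUnion_subset fun s y hy => hδW s ?_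
    refine lt_of_lt_of_le (show riemannianEDist 𝓘(ℝ, E) s.1 y < _ from hy) ?_
    exact (ENNReal.ofReal_le_ofReal (min_le_right _ _)).trans_eq (ENNReal.ofReal_coe_nnreal)

variable {E' : Type*} [NormedAddCommGroup E'] [NormedSpace ℝ E']
  {H' : Type*} [TopologicalSpace H'] {J : ModelWithCorners ℝ E' H'}
  {M : Type*} [TopologicalSpace M] [ChartedSpace H' M]

/-- The configuration spaces of the tubes `p⁻¹(V_L(S, ρ)) ∖ ∂M` form a directed cover of the
configuration space of `M ∖ ∂M`: around the images in `L` of the points of a configuration there are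
arbitrarily small fat configurations. -/
theorem isDirectedCover_tubeConfIncl [T2Space L] [RegularSpace L] {p : M → L} (hp : Continuous p)
    (k : ℕ) : Hocolim.IsDirectedCover (tubeConfIncl 𝓘(ℝ, E) J p k) := by
  have hrange : ∀ (a : FatConf 𝓘(ℝ, E) L) (f : OrderedConf k ((J.boundary M)ᶜ : Set M)),
      Conf.mk f ∈ range ((tubeConfIncl 𝓘(ℝ, E) J p k).app a) ↔ ∀ i, p (f.1 i) ∈ a.V := by
    intro a f
    refine (Conf.mk_mem_range_incl_iff (A := tube 𝓘(ℝ, E) J p a) (fun _ hz => hz.2) f).trans ?_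
    exact forall_congr' fun i => ⟨fun h => h.1, fun h => ⟨h, (f.1 i).2⟩⟩
  have hsmall : ∀ (f : OrderedConf k ((J.boundary M)ᶜ : Set M)) (W : Set L), IsOpen W →
      (∀ i, p (f.1 i) ∈ W) →
      ∃ a : FatConf 𝓘(ℝ, E) L, (∀ i, p (f.1 i) ∈ a.V) ∧ a.V ⊆ W := by
    classical
    intro f W hW hf
    obtain ⟨a, ha, haW⟩ := FatConf.exists_subset_V (E := E)
      (Finset.univ.image fun i => p (f.1 i)) hW (by simpa [range_subset_iff] using hf)
    exact ⟨a, fun i => ha (by simp), haW⟩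
  refine ⟨fun a => ?_, fun y => ?_, fun y a b hya hyb => ?_⟩
  · refine Conf.isOpenEmbedding_incl k (A := tube 𝓘(ℝ, E) J p a) (fun _ hz => hz.2) ?_
    convert a.isOpen_V.preimage (hp.comp continuous_subtype_val) using 1
    ext z
    exact ⟨fun h => h.1, fun h => ⟨h, z.2⟩⟩
  · obtain ⟨f, rfl⟩ := Conf.mk_surjective y
    obtain ⟨a, ha, -⟩ := hsmall f univ isOpen_univ fun i => trivial
    exact ⟨a, (hrange a f).2 ha⟩
  · obtain ⟨f, rfl⟩ := Conf.mk_surjective y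
    obtain ⟨c, hc, hcW⟩ := hsmall f (a.V ∩ b.V) (a.isOpen_V.inter b.isOpen_V)
      fun i => ⟨(hrange a f).1 hya i, (hrange b f).1 hyb i⟩
    exact ⟨c, hcW.trans inter_subset_left, hcW.trans inter_subset_right, (hrange c f).2 hc⟩

end FatConfigurations

theorem mainTheorem5 {ℓ c : ℕ}
    {L : Type*} [TopologicalSpace L] [T2Space L] [CompactSpace L]
    [ChartedSpace (EuclideanSpace ℝ (Fin ℓ)) L] [IsManifold (𝓡 ℓ) ∞ L]
    [RiemannianBundle (fun x : L => TangentSpace (𝓡 ℓ) x)]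
    [IsContMDiffRiemannianBundle (𝓡 ℓ) ∞ (EuclideanSpace ℝ (Fin ℓ))
      (fun x : L => TangentSpace (𝓡 ℓ) x)]
    {E' : Type*} [NormedAddCommGroup E'] [NormedSpace ℝ E'] [FiniteDimensional ℝ E']
    {H' : Type*} [TopologicalSpace H'] (J : ModelWithCorners ℝ E' H') (hJ : IsHalfSpaceModel J)
    {M : Type*} [TopologicalSpace M] [T2Space M] [CompactSpace M]
    [ChartedSpace H' M] [IsManifold J ∞ M]
    (p : M → L) (hp : IsSmoothDiskBundle (𝓡 ℓ) J c p) (k : ℕ) :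
    IsWeakHomotopyEquiv (tubeMap (𝓡 ℓ) J p k) :=
  haveI : T2Space (TopCat.of (Conf k ((J.boundary M)ᶜ : Set M))) :=
    inferInstanceAs (T2Space (Conf k ((J.boundary M)ᶜ : Set M)))
  Hocolim.isWeakHomotopyEquiv_desc (isDirectedCover_tubeConfIncl hp.1.continuous k)
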